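/- An origami is a connected surface $X$ obtained from finitely many copies of the unit square $[0,1]^2$ by gluing, via translations, each right side to a left side and each top side to a bottom side; let $\rho:X\to\mathbb T^2=\mathbb R^2/\mathbb Z^2$ be the induced covering, ramified at most over the origin. $X$ belongs to $\mathcal H(2)$ if it has exactly one conical singularity (point of total angle greater than $2\pi$) and the angle there is $6\pi$. A saddle connection is a geodesic segment joining conical singularities without conical singularities in its interior, and $X$ is reduced if the developments in $\mathbb R^2$ of its saddle connections generate $\mathbb Z^2$. For $A\in SL(2,\mathbb Z)$, $A\cdot X$ is the origami which admits a homeomorphism $f:X\to A\cdot X$ with $\rho_{A\cdot X}\circ f=A\circ\rho_X$, and $\mathcal O(X)=\{A\cdot X: A\in SL(2,\mathbb Z)\}$. The cylinder around a vertical closed geodesic $\sigma$ (one that avoids the conical singularities) is the maximal connected open set $C_\sigma$ foliated by vertical closed geodesics of the same length $|\sigma|$; its transversal width $W(C_\sigma)$ is the distance between its two boundary components. A vertical splitting pair on $X_0$ is a pair $(\sigma_0,\gamma_0)$ of a vertical closed geodesic $\sigma_0$ and a vertical saddle connection $\gamma_0$ such that, with $C_0=C_{\sigma_0}$ and $W_0=W(C_0)$,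 1. $\gamma_0$ is contained in both components, left and right, of the intrinsic boundary of $C_0$; 2. the closure of $C_0$ is not all of $X_0$, that is, there is another vertical cylinder $C_0'\neq C_0$; 3. the positive integers $|\sigma_0|$ and $W_0$ are coprime. **Lemma.** For every reduced origami $X$ in $\mathcal H(2)$ there exists $X_0\in\mathcal O(X)$ which admits a vertical splitting pair $(\sigma_0,\gamma_0)$. More precisely, one can always find such an $X_0$ and a splitting pair with $W_0=1$. -/

import Mathlib

/-- An origami (square-tiled surface), given by a set `Q` of labels of unit squares together with the
side identifications: the right side of the square `q` is glued by a translation to the left side of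
the square `right q`, and its top side to the bottom side of the square `up q`.
The resulting surface is required to be connected. -/
structure Origami (Q : Type*) where
  right : Equiv.Perm Q
  up : Equiv.Perm Q
  connected : MulAction.IsPretransitive (Subgroup.closure {right, up}) Q

namespace Origami

variable {Q : Type*}

/-- The side identifications on the disjoint union of the squares `{q} × [0,1]²`. -/
inductive Glue (X : Origami Q) :
    (Σ _ : Q, unitInterval × unitInterval) → (Σ _ : Q, unitInterval × unitInterval) → Prop
  | side (q : Q) (y : unitInterval) : Glue X ⟨q, (1, y)⟩ ⟨X.right q, (0, y)⟩
  | top (q : Q) (x : unitInterval) : Glue X ⟨q, (x, 1)⟩ ⟨X.up q, (x, 0)⟩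

/-- The surface: the quotient of the disjoint union of the squares by the equivalence relation
generated by the side identifications. -/
def Surface (X : Origami Q) : Type _ := Quot X.Glue

/-- The quotient topology. -/
instance (X : Origami Q) : TopologicalSpace X.Surface :=
  inferInstanceAs (TopologicalSpace (Quot X.Glue))

/-- The point of the surface with coordinates `(x, y)` in the square `q`. -/
def point (X : Origami Q) (q : Q) (x y : unitInterval) : X.Surface := Quot.mk _ ⟨q, (x, y)⟩

/-- The canonical map `ℝ² → 𝕋² = ℝ²/ℤ²`. -/
def toTorus (v : ℝ × ℝ) : UnitAddCircle × UnitAddCircle := ((v.1 : UnitAddCircle), (v.2 : UnitAddCircle))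

/-- The covering `ρ : X → 𝕋²`, ramified at most over the origin, which maps every square onto the
torus. It carries the translation structure: away from the ramification points it is a local
homeomorphism whose local inverses are the translation charts. -/
def proj (X : Origami Q) : X.Surface → UnitAddCircle × UnitAddCircle :=
  Quot.lift (fun p => toTorus ((p.2.1 : ℝ), (p.2.2 : ℝ))) (by
    rintro _ _ (⟨q, y⟩ | ⟨q, x⟩) <;> simp [toTorus])

/-- The number of squares having `P` as their lower left corner. The total angle of the surface
around a vertex `P` of the tiling is `2 * π * X.mult P`, since one full turn around `P` meets exactly
one lower left, one lower right, one upper right and one upper left corner. It is `0` if `P` is not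
a vertex. -/
noncomputable def mult (X : Origami Q) (P : X.Surface) : ℕ := Set.ncard {q : Q | X.point q 0 0 = P}

/-- The set `Σ` of conical singularities: the points with total angle greater than `2π`. -/
def Sing (X : Origami Q) : Set X.Surface := {P | 2 ≤ X.mult P}

/-- The surface belongs to the stratum `H(2)`: it has exactly one conical singularity, and the angle
there is `6π`. -/
def InH2 (X : Origami Q) : Prop := ∃ P, X.mult P = 3 ∧ X.Sing = {P}

/-- `γ`, restricted to `[0, 1]`, is a saddle connection with planar development (holonomy) `v`:
a constant speed geodesic segment joining conical singularities, with no conical singularity in its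
interior. -/
structure IsSaddleConnection (X : Origami Q) (γ : ℝ → X.Surface) (v : ℝ × ℝ) : Prop where
  ne_zero : v ≠ 0
  continuousOn : ContinuousOn γ (Set.Icc 0 1)
  proj_eq : ∀ t ∈ Set.Icc (0 : ℝ) 1, X.proj (γ t) = X.proj (γ 0) + toTorus (t • v)
  start_mem : γ 0 ∈ X.Sing
  end_mem : γ 1 ∈ X.Sing
  interior : ∀ t ∈ Set.Ioo (0 : ℝ) 1, γ t ∉ X.Sing

/-- The set `hol(X)` of relative periods. -/
def hol (X : Origami Q) : Set (ℝ × ℝ) := {v | ∃ γ, X.IsSaddleConnection γ v}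

/-- The origami is reduced: the subgroup of `ℝ²` generated by `hol(X)` is `ℤ²`. -/
def IsReduced (X : Origami Q) : Prop :=
  (AddSubgroup.closure X.hol : Set (ℝ × ℝ)) = Set.range fun m : ℤ × ℤ => ((m.1 : ℝ), (m.2 : ℝ))

/-- The automorphism of `𝕋²` induced by a matrix of `SL(2,ℤ)`. -/
def torusMap (A : Matrix.SpecialLinearGroup (Fin 2) ℤ) (s : UnitAddCircle × UnitAddCircle) :
    UnitAddCircle × UnitAddCircle :=
  (A.1 0 0 • s.1 + A.1 0 1 • s.2, A.1 1 0 • s.1 + A.1 1 1 • s.2)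

/-- `Y = A · X` as translation surfaces: there is a homeomorphism from `X` to `Y` which is affine with
linear part `A` in the translation charts. -/
def IsImage (A : Matrix.SpecialLinearGroup (Fin 2) ℤ) (X Y : Origami Q) : Prop :=
  ∃ f : X.Surface ≃ₜ Y.Surface, ∀ P, Y.proj (f P) = torusMap A (X.proj P)

/-- The orbit `O(X)` under `SL(2,ℤ)`. All surfaces in it have as many squares as `X`, so the same set
of labels can be used. -/
def orbit (X : Origami Q) : Set (Origami Q) := {Y | ∃ A, IsImage A X Y}

/-- `σ` is a vertical closed geodesic of length `ℓ`, parametrized by arc length. -/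
structure IsVerticalClosedGeodesic (X : Origami Q) (σ : ℝ → X.Surface) (ℓ : ℝ) : Prop where
  pos : 0 < ℓ
  continuous : Continuous σ
  proj_eq : ∀ t, X.proj (σ t) = X.proj (σ 0) + toTorus (0, t)
  not_mem : ∀ t, σ t ∉ X.Sing
  eq_iff : ∀ s t, σ s = σ t ↔ ∃ n : ℤ, t = s + n * ℓ

/-- `Φ`, restricted to `[0, w] × ℝ`, parametrizes isometrically a vertical cylinder of transversal
width `w`, foliated by vertical closed geodesics of length `ℓ`, together with its intrinsic boundary:
`{0} × ℝ` and `{w} × ℝ` run through the left and the right boundary component.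
The cylinder is maximal: there is a conical singularity on each boundary component. -/
structure IsVerticalCylinder (X : Origami Q) (Φ : ℝ × ℝ → X.Surface) (ℓ w : ℝ) : Prop where
  width_pos : 0 < w
  continuousOn : ContinuousOn Φ (Set.Icc 0 w ×ˢ Set.univ)
  proj_eq : ∀ x ∈ Set.Icc 0 w, ∀ y, X.proj (Φ (x, y)) = X.proj (Φ (0, 0)) + toTorus (x, y)
  closed : ∀ x ∈ Set.Ioo 0 w, X.IsVerticalClosedGeodesic (fun y => Φ (x, y)) ℓ
  injective : ∀ x ∈ Set.Ioo 0 w, ∀ x' ∈ Set.Ioo 0 w, ∀ y y', Φ (x, y) = Φ (x', y') → x = x'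
  left_sing : ∃ y, Φ (0, y) ∈ X.Sing
  right_sing : ∃ y, Φ (w, y) ∈ X.Sing

/-- The open cylinder parametrized by `Φ`. -/
def cylinder (X : Origami Q) (Φ : ℝ × ℝ → X.Surface) (w : ℝ) : Set X.Surface :=
  Φ '' (Set.Ioo 0 w ×ˢ Set.univ)

/-- `(σ, γ)` is a vertical splitting pair, where `σ` has length `ℓ` and the cylinder around `σ` has
transversal width `W`. -/
def IsVerticalSplittingPair (X : Origami Q) (σ γ : ℝ → X.Surface) (ℓ W : ℕ) : Prop :=
  X.IsVerticalClosedGeodesic σ ℓ ∧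
  ∃ L : ℝ, 0 < L ∧ X.IsSaddleConnection γ (0, L) ∧
  ∃ Φ : ℝ × ℝ → X.Surface, X.IsVerticalCylinder Φ ℓ W ∧
    -- the cylinder is the one around `σ`
    (∃ x ∈ Set.Ioo (0 : ℝ) W, ∀ y, σ y = Φ (x, y)) ∧
    -- `γ` belongs to both the left and the right boundary component
    (∃ a, ∀ t ∈ Set.Icc (0 : ℝ) 1, γ t = Φ (0, a + t * L)) ∧
    (∃ b, ∀ t ∈ Set.Icc (0 : ℝ) 1, γ t = Φ (W, b + t * L)) ∧
    -- the closure of the cylinder is not the whole surface, there is another vertical cylinder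
    closure (X.cylinder Φ W) ≠ Set.univ ∧
    (∃ (Φ' : ℝ × ℝ → X.Surface) (ℓ' w' : ℝ),
      X.IsVerticalCylinder Φ' ℓ' w' ∧ X.cylinder Φ' w' ≠ X.cylinder Φ W) ∧
    -- the arithmetic condition
    Nat.Coprime ℓ W

end Origami

/-!
Call a tiling of a surface *L-shaped* if it consists of three parallelograms, glued in the pattern
of the origami `ell`: a first one with sides `x₁, y₁`, one with sides `x₂, y₁` on its right,
closing up vertically, and one with sides `x₁, y₂` on top of it, closing up horizontally, the
vertex of the tiling being the conical singularity (`Origami.IsEll`).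

An origami in `H(2)` with two horizontal cylinders has such a tiling. Indeed the three squares
whose lower left corner is the singularity are the support of the commutator of the two gluing
permutations (`Origami.hasCommutatorSupport`). After the rows of each cylinder have been merged
into one (`Origami.IsRowBase.exists_homeo_merge`), this forces the gluing of a long row, with two
singularities on its bottom side, and a short one
(`Origami.HasCommutatorSupport.exists_isTwoRow`). If there is only one horizontal cylinder,
reducedness makes it a single row of squares, and a shear followed by a quarter turn brings a
horizontal cylinder of circumference `1` into view, which cannot be the only one. Hence every
reduced origami in `H(2)` has an L-shaped tiling (`Origami.exists_isEll`).

Dehn twists (`Origami.IsTiling.twist`) change `x₂` by multiples of `y₁`, and replace `x₁` by `x₁ +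
y₁ + y₂` as long as the orientations stay positive; reflecting in the diagonal exchanges the roles
of the `x`'s and the `y`'s. Consider an L-shaped tiling for which the area `B = x₁ ∧ y₁` of the
first parallelogram is minimal. Minimality gives a Euclidean algorithm: `B` divides `y₁ ∧ y₂` and
`x₁ ∧ x₂`, so that both can be made zero, and the same divisibilities after one more move show
that `B` divides `A + D` and `C + D`, where `A = x₁ ∧ y₂`, `C = x₂ ∧ y₁` and `D = x₂ ∧ y₂` satisfy
`A C = B D`. A prime factor of `B` would then divide all the determinants of side vectors, which
would lie in a proper sublattice of `ℤ²`; this is excluded by reducedness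
(`Origami.dvd_of_isTiling`). Therefore `B = 1` (`Origami.IsReduced.exists_isEll_one`).

The matrix of `SL(2,ℤ)` that takes `x₁, y₁` to the standard basis carries the surface to one tiled
by a unit square, a rectangle of height `1` on its right and a rectangle of width `1` on top of
it. There the column over the unit square is a vertical cylinder of width `1`, and the upper
rectangle is glued to itself along its vertical sides, which are the saddle connection of the
splitting pair (`Origami.IsEll.exists_splittingPair`).
-/

namespace Origami

open Set

variable {Q : Type*}

/-! ### Coordinates on the surface -/

lemma perm_apply_inv (g : Equiv.Perm Q) (q : Q) : g (g⁻¹ q) = q := g.apply_symm_apply q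

lemma perm_inv_apply (g : Equiv.Perm Q) (q : Q) : g⁻¹ (g q) = q := g.symm_apply_apply q

/-- The retraction of the line onto the unit interval. -/
noncomputable def clamp (x : ℝ) : unitInterval := Set.projIcc 0 1 zero_le_one x

lemma continuous_clamp : Continuous clamp := continuous_projIcc (h := zero_le_one)

lemma coe_clamp {x : ℝ} (hx : x ∈ Icc (0 : ℝ) 1) : (clamp x : ℝ) = x := by
  rw [clamp, projIcc_of_mem zero_le_one hx]

lemma clamp_coe (x : unitInterval) : clamp x = x := projIcc_val zero_le_one x

lemma clamp_zero : clamp 0 = 0 := projIcc_left zero_le_one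

lemma clamp_one : clamp 1 = 1 := projIcc_right zero_le_one

/-- The point with coordinates `(x, y)` in the square `q`, for real coordinates: they are clamped to
the unit interval, so that `pt` is defined and continuous on the whole plane. -/
noncomputable def pt (X : Origami Q) (q : Q) (x y : ℝ) : X.Surface :=
  X.point q (clamp x) (clamp y)

lemma pt_side (X : Origami Q) (q : Q) (y : ℝ) : X.pt q 1 y = X.pt (X.right q) 0 y := by
  simp only [pt, clamp_zero, clamp_one]
  exact Quot.sound (Glue.side q _)

lemma pt_top (X : Origami Q) (q : Q) (x : ℝ) : X.pt q x 1 = X.pt (X.up q) x 0 := by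
  simp only [pt, clamp_zero, clamp_one]
  exact Quot.sound (Glue.top q _)

lemma pt_zero_zero (X : Origami Q) (q : Q) : X.pt q 0 0 = X.point q 0 0 := by
  simp only [pt, clamp_zero]

lemma continuous_pt (X : Origami Q) (q : Q) : Continuous fun z : ℝ × ℝ => X.pt q z.1 z.2 := by
  have h1 : Continuous (Quot.mk X.Glue) := continuous_quot_mk
  have h2 : Continuous fun z : ℝ × ℝ =>
      (⟨q, (clamp z.1, clamp z.2)⟩ : Σ _ : Q, unitInterval × unitInterval) :=
    continuous_sigmaMk.comp ((continuous_clamp.comp continuous_fst).prodMk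
      (continuous_clamp.comp continuous_snd))
  exact h1.comp h2

lemma proj_pt (X : Origami Q) (q : Q) {x y : ℝ} (hx : x ∈ Icc (0 : ℝ) 1) (hy : y ∈ Icc (0 : ℝ) 1) :
    X.proj (X.pt q x y) = toTorus (x, y) := by
  change toTorus ((clamp x : ℝ), (clamp y : ℝ)) = _
  rw [coe_clamp hx, coe_clamp hy]

lemma exists_pt (X : Origami Q) (P : X.Surface) :
    ∃ q, ∃ x ∈ Icc (0 : ℝ) 1, ∃ y ∈ Icc (0 : ℝ) 1, P = X.pt q x y := by
  obtain ⟨⟨q, x, y⟩, rfl⟩ := Quot.exists_rep P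
  exact ⟨q, x, x.2, y, y.2, by rw [pt, clamp_coe, clamp_coe]; rfl⟩

/-- The map out of the surface given by `F q` on the square `q`, when `F` is compatible with the
gluings of the right and of the top sides. -/
def desc {Z : Type*} (X : Origami Q) (F : Q → ℝ → ℝ → Z)
    (hs : ∀ q, ∀ y ∈ Icc (0 : ℝ) 1, F q 1 y = F (X.right q) 0 y)
    (ht : ∀ q, ∀ x ∈ Icc (0 : ℝ) 1, F q x 1 = F (X.up q) x 0) : X.Surface → Z :=
  Quot.lift (fun p => F p.1 p.2.1 p.2.2) (by
    rintro _ _ (⟨q, y⟩ | ⟨q, x⟩)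
    · simpa using hs q y y.2
    · simpa using ht q x x.2)

section desc

variable {Z : Type*} (X : Origami Q) {F : Q → ℝ → ℝ → Z}
  {hs : ∀ q, ∀ y ∈ Icc (0 : ℝ) 1, F q 1 y = F (X.right q) 0 y}
  {ht : ∀ q, ∀ x ∈ Icc (0 : ℝ) 1, F q x 1 = F (X.up q) x 0}

lemma desc_pt (q : Q) {x y : ℝ} (hx : x ∈ Icc (0 : ℝ) 1) (hy : y ∈ Icc (0 : ℝ) 1) :
    X.desc F hs ht (X.pt q x y) = F q x y := by
  change F q (clamp x) (clamp y) = _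
  rw [coe_clamp hx, coe_clamp hy]

lemma continuous_desc [TopologicalSpace Z] (hF : ∀ q, Continuous fun z : ℝ × ℝ => F q z.1 z.2) :
    Continuous (X.desc F hs ht) := by
  refine continuous_quot_lift _ (continuous_sigma fun q => ?_)
  exact (hF q).comp ((continuous_subtype_val.comp continuous_fst).prodMk
    (continuous_subtype_val.comp continuous_snd))

end desc

/-! ### Concatenation along a permutation -/

section line

variable {S Z : Type*} (g : Equiv.Perm Q) {e : Q → ℝ → Z → S}

/-- Consecutive pieces agree at the integers, so the piece with index `n` also computes the right
end of its interval. -/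
lemma line_of_mem (hg : ∀ q z, e q 1 z = e (g q) 0 z) (q : Q) (z : Z) (n : ℤ) {x : ℝ}
    (hx : x ∈ Icc (n : ℝ) (n + 1)) :
    e ((g ^ ⌊x⌋) q) (Int.fract x) z = e ((g ^ n) q) (x - n) z := by
  rcases hx.2.lt_or_eq with h | h
  · have : ⌊x⌋ = n := Int.floor_eq_iff.2 ⟨hx.1, h⟩
    rw [Int.fract, this]
  · have h1 : ⌊x⌋ = n + 1 := Int.floor_eq_iff.2 ⟨by push_cast; exact h.ge, by push_cast; linarith⟩
    rw [Int.fract, h1, h, add_comm n 1, zpow_add, zpow_one, Equiv.Perm.mul_apply]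
    have h2 : (n : ℝ) + 1 - n = 1 := by ring
    have h3 : (n : ℝ) + 1 - ((1 + n : ℤ) : ℝ) = 0 := by push_cast; ring
    rw [h2, h3, hg]

lemma continuous_line [TopologicalSpace S] [TopologicalSpace Z]
    (he : ∀ q, Continuous fun p : ℝ × Z => e q p.1 p.2)
    (hg : ∀ q z, e q 1 z = e (g q) 0 z) (q : Q) :
    Continuous fun p : ℝ × Z => e ((g ^ ⌊p.1⌋) q) (Int.fract p.1) p.2 := by
  rw [continuous_iff_continuousAt]
  rintro ⟨x, z⟩
  set n : ℤ := ⌊x⌋ with hn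
  have hc : Continuous fun p : ℝ × Z =>
      if p.1 ≤ n then e ((g ^ (n - 1)) q) (p.1 - (n - 1 : ℤ)) p.2
      else e ((g ^ n) q) (p.1 - n) p.2 := by
    refine Continuous.if_le ?_ ?_ continuous_fst continuous_const ?_
    · exact (he _).comp ((continuous_fst.sub continuous_const).prodMk continuous_snd)
    · exact (he _).comp ((continuous_fst.sub continuous_const).prodMk continuous_snd)
    · rintro ⟨y, w⟩ h
      dsimp only at h ⊢
      have h1 : y - ((n - 1 : ℤ) : ℝ) = 1 := by push_cast; linarith
      have h2 : y - (n : ℝ) = 0 := by linarith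
      rw [h1, h2, hg, ← Equiv.Perm.mul_apply, ← zpow_one_add]
      congr 3; ring_nf
  refine hc.continuousAt.congr ?_
  have hU : IsOpen (Prod.fst ⁻¹' Ioo ((n : ℝ) - 1) (n + 1) : Set (ℝ × Z)) :=
    isOpen_Ioo.preimage continuous_fst
  have hmem : ((x, z) : ℝ × Z) ∈ (Prod.fst ⁻¹' Ioo ((n : ℝ) - 1) (n + 1) : Set (ℝ × Z)) := by
    have h1 := Int.floor_le x
    have h2 := Int.lt_floor_add_one x
    exact ⟨by simp only; linarith, by simp only; linarith⟩
  filter_upwards [hU.mem_nhds hmem] with p hp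
  have hp1 : (n : ℝ) - 1 < p.1 := hp.1
  have hp2 : p.1 < (n : ℝ) + 1 := hp.2
  split_ifs with h
  · rw [line_of_mem g hg q p.2 (n - 1)]
    exact ⟨by push_cast; linarith, by push_cast; linarith⟩
  · rw [line_of_mem g hg q p.2 n]
    exact ⟨by linarith, by linarith⟩

end line

/-- The horizontal strip through the square `q`, with its lower left corner at the origin. -/
noncomputable def row (X : Origami Q) (q : Q) (x y : ℝ) : X.Surface :=
  X.pt ((X.right ^ ⌊x⌋) q) (Int.fract x) y

/-- The vertical strip through the square `q`, with its lower left corner at the origin. -/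
noncomputable def col (X : Origami Q) (q : Q) (x y : ℝ) : X.Surface :=
  X.pt ((X.up ^ ⌊y⌋) q) x (Int.fract y)

lemma row_of_mem (X : Origami Q) (q : Q) (y : ℝ) (n : ℤ) {x : ℝ} (hx : x ∈ Icc (n : ℝ) (n + 1)) :
    X.row q x y = X.pt ((X.right ^ n) q) (x - n) y :=
  line_of_mem (e := X.pt) X.right X.pt_side q y n hx

lemma col_of_mem (X : Origami Q) (q : Q) (x : ℝ) (n : ℤ) {y : ℝ} (hy : y ∈ Icc (n : ℝ) (n + 1)) :
    X.col q x y = X.pt ((X.up ^ n) q) x (y - n) :=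
  line_of_mem (e := fun q y x => X.pt q x y) X.up X.pt_top q x n hy

lemma row_eq_pt (X : Origami Q) (q : Q) (y : ℝ) {x : ℝ} (hx : x ∈ Icc (0 : ℝ) 1) :
    X.row q x y = X.pt q x y := by
  simpa using X.row_of_mem q y 0 (x := x) (by simpa using hx)

lemma col_eq_pt (X : Origami Q) (q : Q) (x : ℝ) {y : ℝ} (hy : y ∈ Icc (0 : ℝ) 1) :
    X.col q x y = X.pt q x y := by
  simpa using X.col_of_mem q x 0 (y := y) (by simpa using hy)

lemma continuous_row (X : Origami Q) (q : Q) : Continuous fun z : ℝ × ℝ => X.row q z.1 z.2 :=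
  continuous_line (e := X.pt) X.right X.continuous_pt X.pt_side q

lemma continuous_col (X : Origami Q) (q : Q) : Continuous fun z : ℝ × ℝ => X.col q z.1 z.2 :=
  (continuous_line (e := fun q y x => X.pt q x y) X.up
    (fun q => (X.continuous_pt q).comp continuous_swap) X.pt_top q).comp continuous_swap

lemma row_add_int (X : Origami Q) (q : Q) (x y : ℝ) (n : ℤ) :
    X.row q (x + n) y = X.row ((X.right ^ n) q) x y := by
  simp only [row, Int.floor_add_intCast, Int.fract_add_intCast, zpow_add, Equiv.Perm.mul_apply]

lemma col_add_int (X : Origami Q) (q : Q) (x y : ℝ) (n : ℤ) :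
    X.col q x (y + n) = X.col ((X.up ^ n) q) x y := by
  simp only [col, Int.floor_add_intCast, Int.fract_add_intCast, zpow_add, Equiv.Perm.mul_apply]

lemma fract_mem_Icc (x : ℝ) : Int.fract x ∈ Icc (0 : ℝ) 1 :=
  ⟨Int.fract_nonneg x, (Int.fract_lt_one x).le⟩

lemma toTorus_add_int (v : ℝ × ℝ) (m n : ℤ) : toTorus (v.1 + m, v.2 + n) = toTorus v := by
  simp [toTorus]

lemma toTorus_add (v w : ℝ × ℝ) : toTorus (v + w) = toTorus v + toTorus w := by
  simp [toTorus]

/-! ### The action of `SL(2,ℤ)` on origamis -/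

/-- `Y = A · X`, through a homeomorphism that moreover respects the cone angles. -/
def Rel (A : Matrix.SpecialLinearGroup (Fin 2) ℤ) (X Y : Origami Q) : Prop :=
  ∃ f : X.Surface ≃ₜ Y.Surface, (∀ P, Y.proj (f P) = torusMap A (X.proj P)) ∧
    ∀ P, Y.mult (f P) = X.mult P

lemma torusMap_mul (A B : Matrix.SpecialLinearGroup (Fin 2) ℤ) (s : UnitAddCircle × UnitAddCircle) :
    torusMap (A * B) s = torusMap A (torusMap B s) := by
  have h : ∀ i j, (A * B).1 i j = A.1 i 0 * B.1 0 j + A.1 i 1 * B.1 1 j := fun i j => by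
    change (A.1 * B.1) i j = _
    rw [Matrix.mul_apply, Fin.sum_univ_two]
  simp only [torusMap, h, smul_add, add_smul, mul_smul]
  ext <;> dsimp only <;> abel

lemma torusMap_one (s : UnitAddCircle × UnitAddCircle) : torusMap 1 s = s := by
  simp [torusMap]

lemma torusMap_toTorus (A : Matrix.SpecialLinearGroup (Fin 2) ℤ) (v : ℝ × ℝ) :
    torusMap A (toTorus v) =
      toTorus (A.1 0 0 * v.1 + A.1 0 1 * v.2, A.1 1 0 * v.1 + A.1 1 1 * v.2) := by
  simp only [torusMap, toTorus, ← AddCircle.coe_zsmul, ← AddCircle.coe_add, zsmul_eq_mul]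

lemma Rel.one (X : Origami Q) : Rel 1 X X :=
  ⟨Homeomorph.refl _, fun P => by simp [torusMap_one], fun P => rfl⟩

lemma Rel.mul {A B : Matrix.SpecialLinearGroup (Fin 2) ℤ} {X Y Z : Origami Q} (h : Rel A X Y)
    (h' : Rel B Y Z) : Rel (B * A) X Z := by
  obtain ⟨f, hf, hf'⟩ := h
  obtain ⟨g, hg, hg'⟩ := h'
  exact ⟨f.trans g, fun P => by simp [hg, hf, torusMap_mul], fun P => by simp [hg', hf']⟩

lemma Rel.inv {A : Matrix.SpecialLinearGroup (Fin 2) ℤ} {X Y : Origami Q} (h : Rel A X Y) :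
    Rel A⁻¹ Y X := by
  obtain ⟨f, hf, hf'⟩ := h
  refine ⟨f.symm, fun P => ?_, fun P => ?_⟩
  · have := hf (f.symm P)
    rw [f.apply_symm_apply] at this
    rw [this, ← torusMap_mul, inv_mul_cancel, torusMap_one]
  · rw [← hf' (f.symm P), f.apply_symm_apply]

lemma pretransitive_of_mem (X : Origami Q) {H : Subgroup (Equiv.Perm Q)} (h1 : X.right ∈ H)
    (h2 : X.up ∈ H) : MulAction.IsPretransitive H Q := by
  have hle : Subgroup.closure {X.right, X.up} ≤ H :=
    (Subgroup.closure_le _).2 (by rintro g (rfl | rfl) <;> assumption)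
  refine ⟨fun x y => ?_⟩
  obtain ⟨g, hg⟩ := X.connected.exists_smul_eq x y
  exact ⟨⟨g.1, hle g.2⟩, hg⟩

/-- A homeomorphism from two maps that are inverse to each other in coordinates. -/
def homeoOfInverse {Q' : Type*} {X : Origami Q} {Y : Origami Q'} (f : X.Surface → Y.Surface)
    (g : Y.Surface → X.Surface) (hf : Continuous f) (hg : Continuous g)
    (hgf : ∀ q, ∀ x ∈ Icc (0 : ℝ) 1, ∀ y ∈ Icc (0 : ℝ) 1, g (f (X.pt q x y)) = X.pt q x y)
    (hfg : ∀ q, ∀ x ∈ Icc (0 : ℝ) 1, ∀ y ∈ Icc (0 : ℝ) 1, f (g (Y.pt q x y)) = Y.pt q x y) :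
    X.Surface ≃ₜ Y.Surface where
  toFun := f
  invFun := g
  left_inv P := by
    obtain ⟨q, x, hx, y, hy, rfl⟩ := X.exists_pt P
    exact hgf q x hx y hy
  right_inv P := by
    obtain ⟨q, x, hx, y, hy, rfl⟩ := Y.exists_pt P
    exact hfg q x hx y hy
  continuous_toFun := hf
  continuous_invFun := hg

/-- The image of an origami under the shear `(x, y) ↦ (x + y, y)`. -/
def shear (X : Origami Q) : Origami Q where
  right := X.right
  up := X.up * X.right⁻¹
  connected := X.pretransitive_of_mem (Subgroup.subset_closure (by simp)) (by
    have h1 : X.right ∈ Subgroup.closure {X.right, X.up * X.right⁻¹} :=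
      Subgroup.subset_closure (by simp)
    have h2 : X.up * X.right⁻¹ ∈ Subgroup.closure {X.right, X.up * X.right⁻¹} :=
      Subgroup.subset_closure (by simp)
    simpa using mul_mem h2 h1)

/-- The image of an origami under the counterclockwise quarter turn. -/
def turn (X : Origami Q) : Origami Q where
  right := X.up⁻¹
  up := X.right
  connected := X.pretransitive_of_mem (Subgroup.subset_closure (by simp)) (by
    have h1 : X.up⁻¹ ∈ Subgroup.closure {X.up⁻¹, X.right} := Subgroup.subset_closure (by simp)
    simpa using inv_mem h1)

lemma proj_row (X : Origami Q) (q : Q) (x : ℝ) {y : ℝ} (hy : y ∈ Icc (0 : ℝ) 1) :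
    X.proj (X.row q x y) = toTorus (x, y) := by
  rw [row, X.proj_pt _ (fract_mem_Icc x) hy, ← toTorus_add_int _ ⌊x⌋ 0]
  simp

lemma proj_col (X : Origami Q) (q : Q) {x : ℝ} (y : ℝ) (hx : x ∈ Icc (0 : ℝ) 1) :
    X.proj (X.col q x y) = toTorus (x, y) := by
  rw [col, X.proj_pt _ hx (fract_mem_Icc y), ← toTorus_add_int _ 0 ⌊y⌋]
  simp

lemma rel_shear (X : Origami Q) : Rel ModularGroup.T X X.shear := by
  set Y := X.shear with hY
  have hr : Y.right = X.right := rfl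
  let f : X.Surface → Y.Surface := X.desc (fun q x y => Y.row q (x + y) y)
    (fun q y _ => by
      have := Y.row_add_int q y y 1
      simpa [add_comm, hr] using this)
    (fun q x hx => by
      have := Y.row_add_int q x 1 1
      simp only [Int.cast_one, zpow_one] at this
      rw [this, Y.row_eq_pt _ _ hx, add_zero, Y.row_eq_pt _ _ hx, Y.pt_top]
      simp [hY, shear])
  let g : Y.Surface → X.Surface := Y.desc (fun q x y => X.row q (x - y) y)
    (fun q y _ => by
      have := X.row_add_int q (0 - y) y 1
      simp only [Int.cast_one, zpow_one] at this
      rw [hr, ← this]; congr 1; ring)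
    (fun q x hx => by
      have h2 := X.row_add_int (X.right⁻¹ q) (x - 1) 1 1
      simp only [Int.cast_one, zpow_one, perm_apply_inv, sub_add_cancel] at h2
      rw [← h2, sub_zero, X.row_eq_pt _ _ hx, X.row_eq_pt _ _ hx, X.pt_top]
      simp [hY, shear])
  have hf : ∀ q z, ∀ y ∈ Icc (0 : ℝ) 1, f (X.row q z y) = Y.row q (z + y) y := by
    intro q z y hy
    have := Y.row_add_int q (Int.fract z + y) y ⌊z⌋
    rw [row, show f _ = _ from X.desc_pt _ (fract_mem_Icc z) hy, ← hr, ← this]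
    congr 1
    linarith [Int.fract_add_floor z]
  have hg : ∀ q z, ∀ y ∈ Icc (0 : ℝ) 1, g (Y.row q z y) = X.row q (z - y) y := by
    intro q z y hy
    have := X.row_add_int q (Int.fract z - y) y ⌊z⌋
    rw [row, show g _ = _ from Y.desc_pt _ (fract_mem_Icc z) hy, hr, ← this]
    congr 1
    linarith [Int.fract_add_floor z]
  have hfc : Continuous f := X.continuous_desc fun q =>
    (Y.continuous_row q).comp ((continuous_fst.add continuous_snd).prodMk continuous_snd)
  have hgc : Continuous g := Y.continuous_desc fun q =>
    (X.continuous_row q).comp ((continuous_fst.sub continuous_snd).prodMk continuous_snd)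
  let F : X.Surface ≃ₜ Y.Surface := homeoOfInverse f g hfc hgc
    (fun q x hx y hy => by
      rw [← X.row_eq_pt q y hx, hf _ _ _ hy, hg _ _ _ hy, add_sub_cancel_right])
    (fun q x hx y hy => by
      rw [← Y.row_eq_pt q y hx, hg _ _ _ hy, hf _ _ _ hy, sub_add_cancel])
  have hF : ∀ P, F P = f P := fun P => rfl
  refine ⟨F, fun P => ?_, fun P => ?_⟩
  · obtain ⟨q, x, hx, y, hy, rfl⟩ := X.exists_pt P
    rw [hF, ← X.row_eq_pt q y hx, hf _ _ _ hy, Y.proj_row _ _ hy, X.proj_row _ _ hy,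
      torusMap_toTorus]
    simp [ModularGroup.T]
  · have h0 : ∀ q, F (X.point q 0 0) = Y.point q 0 0 := fun q => by
      have := hf q 0 0 (by simp)
      rw [X.row_eq_pt _ _ (by simp), add_zero, Y.row_eq_pt _ _ (by simp)] at this
      rw [pt_zero_zero, pt_zero_zero] at this
      exact this
    unfold mult
    congr 1
    ext q
    simp only [mem_ofPred_eq, ← h0, F.injective.eq_iff]

lemma rel_turn (X : Origami Q) : Rel ModularGroup.S X X.turn := by
  set Y := X.turn with hY
  have hI : ∀ x ∈ Icc (0 : ℝ) 1, 1 - x ∈ Icc (0 : ℝ) 1 := fun x hx =>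
    ⟨by linarith [hx.2], by linarith [hx.1]⟩
  let f : X.Surface → Y.Surface := X.desc (fun q x y => Y.pt q (1 - y) x)
    (fun q y _ => by rw [Y.pt_top]; rfl)
    (fun q x hx => by
      have := Y.pt_side (X.up q) x
      simp only [sub_self, sub_zero]
      rw [this]; simp [hY, turn])
  let g : Y.Surface → X.Surface := Y.desc (fun q x y => X.pt q y (1 - x))
    (fun q y _ => by
      have := X.pt_top (X.up⁻¹ q) y
      rw [perm_apply_inv] at this
      simp only [sub_self, sub_zero]
      rw [← this]; rfl)
    (fun q x hx => by rw [X.pt_side]; rfl)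
  have hfc : Continuous f := X.continuous_desc fun q =>
    (Y.continuous_pt q).comp ((continuous_const.sub continuous_snd).prodMk continuous_fst)
  have hgc : Continuous g := Y.continuous_desc fun q =>
    (X.continuous_pt q).comp (continuous_snd.prodMk (continuous_const.sub continuous_fst))
  have hf : ∀ q, ∀ x ∈ Icc (0 : ℝ) 1, ∀ y ∈ Icc (0 : ℝ) 1, f (X.pt q x y) = Y.pt q (1 - y) x :=
    fun q x hx y hy => X.desc_pt _ hx hy
  have hg : ∀ q, ∀ x ∈ Icc (0 : ℝ) 1, ∀ y ∈ Icc (0 : ℝ) 1, g (Y.pt q x y) = X.pt q y (1 - x) :=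
    fun q x hx y hy => Y.desc_pt _ hx hy
  let F : X.Surface ≃ₜ Y.Surface := homeoOfInverse f g hfc hgc
    (fun q x hx y hy => by rw [hf _ _ hx _ hy, hg _ _ (hI y hy) _ hx, sub_sub_cancel])
    (fun q x hx y hy => by rw [hg _ _ hx _ hy, hf _ _ hy _ (hI x hx), sub_sub_cancel])
  have hF : ∀ P, F P = f P := fun P => rfl
  refine ⟨F, fun P => ?_, fun P => ?_⟩
  · obtain ⟨q, x, hx, y, hy, rfl⟩ := X.exists_pt P
    rw [hF, hf _ _ hx _ hy, Y.proj_pt _ (hI y hy) hx, X.proj_pt _ hx hy, torusMap_toTorus,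
      ← toTorus_add_int (1 - y, x) (-1) 0]
    simp only [ModularGroup.S]
    congr 2 <;> simp
    ring
  · have h0 : ∀ q, F (X.point q 0 0) = Y.point (Y.right q) 0 0 := fun q => by
      have := hf q 0 (by simp) 0 (by simp)
      rw [sub_zero, Y.pt_side] at this
      rw [pt_zero_zero, pt_zero_zero] at this
      exact this
    unfold mult
    rw [← ncard_image_of_injective {q | X.point q 0 0 = P} Y.right.injective]
    congr 1
    ext q
    simp only [mem_ofPred_eq, mem_image]
    constructor
    · intro h
      refine ⟨Y.right⁻¹ q, ?_, by simp⟩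
      apply F.injective
      rw [h0, ← h]; simp
    · rintro ⟨q', rfl, rfl⟩
      exact (h0 q').symm

/-- The group acts: images exist, as the shear and the quarter turn generate `SL(2,ℤ)`. -/
lemma exists_rel (A : Matrix.SpecialLinearGroup (Fin 2) ℤ) :
    ∀ X : Origami Q, (∃ Y, Rel A X Y) ∧ ∃ Y, Rel A Y X := by
  have hA : A ∈ Subgroup.closure {ModularGroup.S, ModularGroup.T} := by
    rw [SpecialLinearGroup.SL2Z_generators]; trivial
  induction hA using Subgroup.closure_induction with
  | mem B hB =>
    intro X
    rcases hB with rfl | rfl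
    · refine ⟨⟨_, X.rel_turn⟩, X.turn.turn.turn, ?_⟩
      have hX : X.turn.turn.turn.turn = X := by
        obtain ⟨r, u, h⟩ := X
        simp [turn]
      exact hX ▸ X.turn.turn.turn.rel_turn
    · let Y : Origami Q := ⟨X.right, X.up * X.right,
        X.pretransitive_of_mem (Subgroup.subset_closure (by simp)) (by
          have h1 : X.right ∈ Subgroup.closure {X.right, X.up * X.right} :=
            Subgroup.subset_closure (by simp)
          have h2 : X.up * X.right ∈ Subgroup.closure {X.right, X.up * X.right} :=
            Subgroup.subset_closure (by simp)
          simpa using mul_mem h2 (inv_mem h1))⟩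
      have hY : Y.shear = X := by
        obtain ⟨r, u, h⟩ := X
        simp [Y, shear]
      exact ⟨⟨_, X.rel_shear⟩, Y, hY ▸ Y.rel_shear⟩
  | one => exact fun X => ⟨⟨X, Rel.one X⟩, X, Rel.one X⟩
  | mul B C _ _ hB hC =>
    intro X
    obtain ⟨Y, hY⟩ := (hC X).1
    obtain ⟨Z, hZ⟩ := (hB Y).1
    obtain ⟨Y', hY'⟩ := (hB X).2
    obtain ⟨Z', hZ'⟩ := (hC Y').2
    exact ⟨⟨Z, hY.mul hZ⟩, Z', hZ'.mul hY'⟩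
  | inv B _ hB =>
    intro X
    obtain ⟨⟨Y, hY⟩, Z, hZ⟩ := hB X
    exact ⟨⟨Z, hZ.inv⟩, Y, hY.inv⟩

lemma InH2.of_rel {A : Matrix.SpecialLinearGroup (Fin 2) ℤ} {X Y : Origami Q} (h : Rel A X Y)
    (hX : X.InH2) : Y.InH2 := by
  obtain ⟨f, -, hf⟩ := h
  obtain ⟨P, hP, hS⟩ := hX
  refine ⟨f P, by rw [hf, hP], ?_⟩
  ext R
  have := hf (f.symm R)
  rw [f.apply_symm_apply] at this
  rw [Sing, mem_ofPred_eq, this, mem_singleton_iff, ← f.symm_apply_eq]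
  exact (Set.ext_iff.1 hS (f.symm R))

/-! ### Vertices and the commutator -/

/-- The combinatorial shadow of `H(2)`: the set `V` of squares whose lower left corner is the
conical singularity has three elements, and it is the support of the commutator of the two
permutations, which describes a full turn around the lower left corner of a square. -/
structure HasCommutatorSupport (r u : Equiv.Perm Q) (V : Set Q) : Prop where
  comm_eq : ∀ q ∉ V, u (r (u⁻¹ (r⁻¹ q))) = q
  comm_ne : ∀ q ∈ V, u (r (u⁻¹ (r⁻¹ q))) ≠ q
  ncard_eq : V.ncard = 3

/-- The commutator is a full turn around the lower left corner. -/
lemma point_comm (X : Origami Q) (q : Q) :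
    X.point (X.up (X.right (X.up⁻¹ (X.right⁻¹ q)))) 0 0 = X.point q 0 0 := by
  have h1 := X.pt_side (X.right⁻¹ q) 0
  have h2 := X.pt_top (X.up⁻¹ (X.right⁻¹ q)) 1
  have h3 := X.pt_side (X.up⁻¹ (X.right⁻¹ q)) 1
  have h4 := X.pt_top (X.right (X.up⁻¹ (X.right⁻¹ q))) 0
  rw [perm_apply_inv] at h1 h2
  rw [← pt_zero_zero, ← pt_zero_zero, ← h4, ← h3, h2, h1]

/-- If the commutator fixes `q`, then no other square has the same lower left corner. -/
lemma eq_of_point_eq (X : Origami Q) {q q' : Q}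
    (hq : X.up (X.right (X.up⁻¹ (X.right⁻¹ q))) = q) (h : X.point q' 0 0 = X.point q 0 0) :
    q' = q := by
  have hru : ∀ p, X.up (X.right p) = q ↔ X.right (X.up p) = q := fun p => by
    constructor
    · intro hp
      have h1 : X.right p = X.right (X.up⁻¹ (X.right⁻¹ q)) := X.up.injective (hp.trans hq.symm)
      rw [X.right.injective h1, perm_apply_inv, perm_apply_inv]
    · intro hp
      have h1 : p = X.up⁻¹ (X.right⁻¹ q) := by
        rw [← hp, perm_inv_apply, perm_inv_apply]
      rw [h1, hq]
  -- for a corner, the statement that `q` is the only square starting there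
  let F : Q → ℝ → ℝ → Prop := fun p x y =>
    (x = 0 ∧ y = 0 ∧ p = q) ∨ (x = 1 ∧ y = 0 ∧ X.right p = q) ∨ (x = 0 ∧ y = 1 ∧ X.up p = q) ∨
      (x = 1 ∧ y = 1 ∧ X.up (X.right p) = q)
  have hs : ∀ p, ∀ y ∈ Icc (0 : ℝ) 1, F p 1 y = F (X.right p) 0 y := by
    intro p y _
    simp only [F, eq_iff_iff]
    simp
  have ht : ∀ p, ∀ x ∈ Icc (0 : ℝ) 1, F p x 1 = F (X.up p) x 0 := by
    intro p x _
    simp only [F, eq_iff_iff, hru p]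
    simp
  have key : ∀ p, X.desc F hs ht (X.point p 0 0) = (p = q) := fun p => by
    rw [← pt_zero_zero, X.desc_pt p (by simp) (by simp)]
    simp [F]
  have := key q'
  rw [h, key q] at this
  exact this ▸ rfl

lemma hasCommutatorSupport [Finite Q] (X : Origami Q) {P : X.Surface} (hP : X.mult P = 3)
    (hS : X.Sing = {P}) : HasCommutatorSupport X.right X.up {q | X.point q 0 0 = P} where
  comm_eq q hq := by
    have h1 : X.point q 0 0 ∉ X.Sing := by rw [hS]; exact hq
    have h2 : X.mult (X.point q 0 0) ≤ 1 := by
      by_contra h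
      exact h1 (show 2 ≤ X.mult _ by omega)
    exact (ncard_le_one_iff (toFinite _)).1 h2 (X.point_comm q) rfl
  comm_ne q hq h := by
    have : {p | X.point p 0 0 = P} = {q} := by
      ext p
      refine ⟨fun hp => X.eq_of_point_eq h (hp.trans hq.symm), ?_⟩
      rintro rfl
      exact hq
    rw [mult, this, ncard_singleton] at hP
    omega
  ncard_eq := hP

/-! ### Merging the rows of a cylinder -/

lemma mem_of_perm_apply_mem [Finite Q] {g : Equiv.Perm Q} {S : Set Q} (h : ∀ q ∈ S, g q ∈ S) {q : Q}
    (hq : g q ∈ S) : q ∈ S := by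
  have h1 : ∀ n : ℕ, (g ^ n) (g q) ∈ S := by
    intro n
    induction n with
    | zero => exact hq
    | succ n ih => rw [pow_succ', Equiv.Perm.mul_apply]; exact h _ ih
  have h2 : (g ^ (orderOf g - 1)) (g q) = q := by
    rw [← Equiv.Perm.mul_apply, ← pow_succ, Nat.sub_add_cancel (orderOf_pos g), pow_orderOf_eq_one]
    rfl
  exact h2 ▸ h1 _

/-- A nonempty set of squares stable under both permutations contains all squares. -/
lemma eq_univ_of_stable [Finite Q] (X : Origami Q) {S : Set Q} (hr : ∀ q ∈ S, X.right q ∈ S)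
    (hu : ∀ q ∈ S, X.up q ∈ S) (hS : S.Nonempty) : S = univ := by
  obtain ⟨s, hs⟩ := hS
  have key : ∀ g ∈ Subgroup.closure {X.right, X.up}, ∀ q, q ∈ S ↔ g q ∈ S := by
    intro g hg
    induction hg using Subgroup.closure_induction with
    | mem g hg =>
      rcases hg with rfl | rfl
      · exact fun q => ⟨hr q, mem_of_perm_apply_mem hr⟩
      · exact fun q => ⟨hu q, mem_of_perm_apply_mem hu⟩
    | one => exact fun q => Iff.rfl
    | mul g g' _ _ h h' => exact fun q => (h' q).trans (h _)
    | inv g _ h => exact fun q => by rw [h (g⁻¹ q), perm_apply_inv]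
  refine eq_univ_of_forall fun q => ?_
  obtain ⟨g, hg⟩ := X.connected.exists_smul_eq s q
  have := (key g.1 g.2 s).1 hs
  rwa [show g.1 s = q from hg] at this

/-- A nonempty union `B` of rows such that across the bottom side of every other row the gluing is
the one of a cylinder: the two permutations commute there. -/
structure IsRowBase (X : Origami Q) (B : Set Q) : Prop where
  right_mem : ∀ q, X.right q ∈ B ↔ q ∈ B
  comm : ∀ p ∉ B, X.right (X.up⁻¹ p) = X.up⁻¹ (X.right p)
  nonempty : B.Nonempty

/-- The union of the rows that meet `V`. -/
def rowHull (X : Origami Q) (V : Set Q) : Set Q := {q | ∃ k : ℤ, (X.right ^ k) q ∈ V}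

lemma HasCommutatorSupport.isRowBase {X : Origami Q} {V : Set Q}
    (h : HasCommutatorSupport X.right X.up V) :
    X.IsRowBase (X.rowHull V) where
  right_mem q := by
    constructor
    · rintro ⟨k, hk⟩
      exact ⟨k + 1, by rwa [zpow_add, zpow_one, Equiv.Perm.mul_apply]⟩
    · rintro ⟨k, hk⟩
      refine ⟨k - 1, ?_⟩
      rw [zpow_sub, zpow_one, Equiv.Perm.mul_apply, perm_inv_apply]
      exact hk
  comm p hp := by
    have h1 : X.right p ∉ V := fun h1 => hp ⟨1, by simpa using h1⟩
    have h2 := h.comm_eq _ h1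
    rw [perm_inv_apply] at h2
    rw [← h2, perm_inv_apply]
  nonempty := by
    obtain ⟨v, hv⟩ := nonempty_of_ncard_ne_zero (s := V) (by rw [h.ncard_eq]; norm_num)
    exact ⟨v, 0, by simpa using hv⟩

lemma exists_nat_mem_Icc {h : ℕ} (hh : 0 < h) {x : ℝ} (hx : x ∈ Icc (0 : ℝ) h) :
    ∃ n < h, x ∈ Icc (n : ℝ) (n + 1) := by
  rcases hx.2.lt_or_eq with h1 | h1
  · refine ⟨⌊x⌋₊, (Nat.floor_lt hx.1).2 h1, Nat.floor_le hx.1, (Nat.lt_floor_add_one x).le⟩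
  · have : ((h - 1 : ℕ) : ℝ) = h - 1 := by rw [Nat.cast_sub hh]; simp
    exact ⟨h - 1, by omega, by rw [this, h1]; simp⟩

namespace IsRowBase

variable {X : Origami Q} {B : Set Q}

/-- The horizontal permutation of `B`. -/
def rightMap (hB : X.IsRowBase B) : Equiv.Perm B := X.right.subtypePerm hB.right_mem

lemma coe_rightMap (hB : X.IsRowBase B) (b : B) : (hB.rightMap b : Q) = X.right b := rfl

lemma coe_rightMap_zpow (hB : X.IsRowBase B) (b : B) (k : ℤ) :
    ((hB.rightMap ^ k) b : Q) = (X.right ^ k) (b : Q) := by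
  rw [rightMap, Equiv.Perm.subtypePerm_zpow]; rfl

variable [Finite Q]

lemma exists_down_mem (hB : X.IsRowBase B) (q : Q) : ∃ j : ℕ, (X.up⁻¹ ^ j) q ∈ B := by
  by_contra! hq
  let S : Set Q := {q | ∀ j : ℕ, (X.up⁻¹ ^ j) q ∉ B}
  have hr : ∀ q ∈ S, X.right q ∈ S := by
    intro q hq
    have h1 : ∀ j : ℕ, (X.up⁻¹ ^ j) (X.right q) = X.right ((X.up⁻¹ ^ j) q) := by
      intro j
      induction j with
      | zero => rfl
      | succ j ih =>
        rw [pow_succ', Equiv.Perm.mul_apply, Equiv.Perm.mul_apply, ih, hB.comm _ (hq j)]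
    intro j
    rw [h1, hB.right_mem]
    exact hq j
  have hu' : ∀ q ∈ S, X.up⁻¹ q ∈ S := by
    intro q hq j
    have := hq (j + 1)
    rwa [pow_succ, Equiv.Perm.mul_apply] at this
  have hu : ∀ q ∈ S, X.up q ∈ S := by
    intro q hq
    refine mem_of_perm_apply_mem hu' ?_
    rwa [perm_inv_apply]
  have hS := X.eq_univ_of_stable hr hu ⟨q, hq⟩
  obtain ⟨b, hb⟩ := hB.nonempty
  have : b ∈ S := hS ▸ mem_univ b
  exact this 0 hb

lemma exists_return (b : B) : ∃ n : ℕ, 0 < n ∧ (X.up ^ n) (b : Q) ∈ B :=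
  ⟨orderOf X.up, orderOf_pos _, by rw [pow_orderOf_eq_one]; exact b.2⟩

open Classical in
/-- The number of rows from the square `b` of `B` upwards to the next row of `B`. -/
noncomputable def height (X : Origami Q) (B : Set Q) (b : B) : ℕ :=
  Nat.find (exists_return (X := X) b)

open Classical in
lemma height_pos (b : B) : 0 < height X B b := (Nat.find_spec (exists_return (X := X) b)).1

open Classical in
lemma up_height_mem (b : B) : (X.up ^ height X B b) (b : Q) ∈ B :=
  (Nat.find_spec (exists_return (X := X) b)).2

lemma le_height {b : B} {n : ℕ} (h : ∀ j, 0 < j → j < n → (X.up ^ j) (b : Q) ∉ B) :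
    n ≤ height X B b := by
  by_contra! hn
  exact h _ (height_pos b) hn (up_height_mem b)

open Classical in
lemma up_notMem {b : B} {j : ℕ} (h0 : 0 < j) (h : j < height X B b) : (X.up ^ j) (b : Q) ∉ B :=
  fun hj => Nat.find_min (exists_return (X := X) b) h ⟨h0, hj⟩

lemma eq_of_up_eq {b b' : B} {j j' : ℕ} (h : (X.up ^ j) (b : Q) = (X.up ^ j') (b' : Q))
    (hj : j < height X B b) (hj' : j' < height X B b') : b = b' ∧ j = j' := by
  wlog hle : j ≤ j' generalizing b b' j j'
  · have := this h.symm hj' hj (by omega)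
    exact ⟨this.1.symm, this.2.symm⟩
  obtain ⟨i, rfl⟩ := Nat.exists_eq_add_of_le hle
  rw [pow_add, Equiv.Perm.mul_apply] at h
  have h1 : (b : Q) = (X.up ^ i) (b' : Q) := (X.up ^ j).injective h
  rcases Nat.eq_zero_or_pos i with rfl | hi
  · exact ⟨Subtype.ext h1, rfl⟩
  · exact absurd (h1 ▸ b.2) (up_notMem hi (by omega))

lemma exists_foot (hB : X.IsRowBase B) (q : Q) :
    ∃ b : B, ∃ j, j < height X B b ∧ (X.up ^ j) (b : Q) = q := by
  classical
  have h := Nat.find_spec (hB.exists_down_mem q)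
  have hmin := fun {i} => Nat.find_min (hB.exists_down_mem q) (m := i)
  set n := Nat.find (hB.exists_down_mem q)
  have hpow : ∀ i ≤ n, (X.up ^ i) ((X.up⁻¹ ^ n) q) = (X.up⁻¹ ^ (n - i)) q := by
    intro i hi
    conv_lhs => rw [← Nat.add_sub_cancel' hi, pow_add, Equiv.Perm.mul_apply]
    rw [inv_pow X.up i, perm_apply_inv]
  refine ⟨⟨_, h⟩, n, ?_, by simp⟩
  refine le_height fun j hj0 hj => ?_
  rw [hpow j (by omega)]
  exact hmin (by omega)

/-- The square of `B` below `q` in the same cylinder. -/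
noncomputable def foot (hB : X.IsRowBase B) (q : Q) : B := (hB.exists_foot q).choose

/-- The number of rows between `q` and its foot. -/
noncomputable def depth (hB : X.IsRowBase B) (q : Q) : ℕ := (hB.exists_foot q).choose_spec.choose

lemma depth_lt (hB : X.IsRowBase B) (q : Q) : hB.depth q < height X B (hB.foot q) :=
  (hB.exists_foot q).choose_spec.choose_spec.1

lemma up_depth (hB : X.IsRowBase B) (q : Q) : (X.up ^ hB.depth q) (hB.foot q : Q) = q :=
  (hB.exists_foot q).choose_spec.choose_spec.2

lemma foot_eq (hB : X.IsRowBase B) {q : Q} {b : B} {j : ℕ} (h : (X.up ^ j) (b : Q) = q)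
    (hj : j < height X B b) : hB.foot q = b ∧ hB.depth q = j :=
  eq_of_up_eq ((hB.up_depth q).trans h.symm) (hB.depth_lt q) hj

lemma right_up_pow (hB : X.IsRowBase B) {b : B} {j : ℕ} (hj : j < height X B b) :
    X.right ((X.up ^ j) (b : Q)) = (X.up ^ j) (X.right b) := by
  induction j with
  | zero => rfl
  | succ j ih =>
    have h1 := hB.comm _ (up_notMem (Nat.succ_pos j) hj)
    rw [pow_succ', Equiv.Perm.mul_apply, perm_inv_apply, ih (by omega)] at h1
    rw [pow_succ', Equiv.Perm.mul_apply, Equiv.Perm.mul_apply, h1, perm_apply_inv]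

/-- The first return of the vertical permutation to `B`. -/
noncomputable def returnMap (X : Origami Q) (B : Set Q) : Equiv.Perm B :=
  Equiv.ofBijective (fun b : B => (⟨(X.up ^ height X B b) b, up_height_mem b⟩ : B)) (by
    refine Finite.injective_iff_bijective.1 fun b b' h => ?_
    have h : (X.up ^ height X B b) (b : Q) = (X.up ^ height X B b') (b' : Q) :=
      congrArg Subtype.val h
    have hb := height_pos (X := X) b
    have hb' := height_pos (X := X) b'
    obtain ⟨n, hn⟩ : ∃ n, height X B b = n + 1 := ⟨_, (Nat.sub_add_cancel hb).symm⟩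
    obtain ⟨n', hn'⟩ : ∃ n, height X B b' = n + 1 := ⟨_, (Nat.sub_add_cancel hb').symm⟩
    rw [hn, hn', pow_succ', pow_succ', Equiv.Perm.mul_apply, Equiv.Perm.mul_apply] at h
    exact (eq_of_up_eq (X.up.injective h) (by omega) (by omega)).1)

lemma coe_returnMap (b : B) : (returnMap X B b : Q) = (X.up ^ height X B b) (b : Q) := rfl

lemma height_right (hB : X.IsRowBase B) (b : B) : height X B (hB.rightMap b) = height X B b := by
  have key : ∀ b : B, height X B b ≤ height X B (hB.rightMap b) := by
    intro b
    refine le_height fun j h0 hj => ?_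
    rw [coe_rightMap, ← hB.right_up_pow hj, hB.right_mem]
    exact up_notMem h0 hj
  have key' : ∀ (n : ℕ) (b : B), height X B b ≤ height X B ((hB.rightMap ^ n) b) := by
    intro n
    induction n with
    | zero => exact fun b => le_rfl
    | succ n ih => exact fun b => (key b).trans (ih _)
  refine le_antisymm ?_ (key b)
  have h1 := key' (orderOf hB.rightMap - 1) (hB.rightMap b)
  rwa [← Equiv.Perm.mul_apply, ← pow_succ, Nat.sub_add_cancel (orderOf_pos _),
    pow_orderOf_eq_one] at h1

lemma foot_right (hB : X.IsRowBase B) (q : Q) :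
    hB.foot (X.right q) = hB.rightMap (hB.foot q) ∧ hB.depth (X.right q) = hB.depth q := by
  refine hB.foot_eq ?_ (by rw [hB.height_right]; exact hB.depth_lt q)
  rw [coe_rightMap, ← hB.right_up_pow (hB.depth_lt q), hB.up_depth]

lemma foot_up (hB : X.IsRowBase B) (q : Q) :
    (hB.depth q + 1 < height X B (hB.foot q) ∧ hB.foot (X.up q) = hB.foot q ∧
      hB.depth (X.up q) = hB.depth q + 1) ∨
    (hB.depth q + 1 = height X B (hB.foot q) ∧ hB.foot (X.up q) = returnMap X B (hB.foot q) ∧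
      hB.depth (X.up q) = 0) := by
  have h1 : (X.up ^ (hB.depth q + 1)) (hB.foot q : Q) = X.up q := by
    rw [pow_succ', Equiv.Perm.mul_apply, hB.up_depth]
  rcases Nat.lt_or_ge (hB.depth q + 1) (height X B (hB.foot q)) with h | h
  · exact Or.inl ⟨h, hB.foot_eq h1 h⟩
  · have h2 : hB.depth q + 1 = height X B (hB.foot q) := le_antisymm (hB.depth_lt q) h
    refine Or.inr ⟨h2, hB.foot_eq (j := 0) ?_ (height_pos _)⟩
    rw [pow_zero, Equiv.Perm.one_apply, coe_returnMap, ← h2, h1]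

/-- The origami with the rows of every cylinder merged into its bottom row, which belongs to `B`. -/
noncomputable def merge (hB : X.IsRowBase B) : Origami B where
  right := hB.rightMap
  up := returnMap X B
  connected := by
    set H := Subgroup.closure {hB.rightMap, returnMap X B}
    have hr : hB.rightMap ∈ H := Subgroup.subset_closure (by simp)
    have hu : returnMap X B ∈ H := Subgroup.subset_closure (by simp)
    refine ⟨fun b b' => ?_⟩
    have hS := X.eq_univ_of_stable (S := {q | ∃ g ∈ H, g b = hB.foot q})
      (fun q ⟨g, hg, h⟩ => ⟨hB.rightMap * g, mul_mem hr hg, by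
        rw [(hB.foot_right q).1, Equiv.Perm.mul_apply, h]⟩)
      (fun q ⟨g, hg, h⟩ => by
        rcases hB.foot_up q with ⟨-, h1, -⟩ | ⟨-, h1, -⟩
        · exact ⟨g, hg, by rw [h1, h]⟩
        · exact ⟨returnMap X B * g, mul_mem hu hg, by rw [h1, Equiv.Perm.mul_apply, h]⟩)
      ⟨b, 1, one_mem _, by
        rw [(hB.foot_eq (q := (b : Q)) (b := b) (j := 0) rfl (height_pos _)).1]; rfl⟩
    obtain ⟨g, hg, h⟩ : (b' : Q) ∈ {q | ∃ g ∈ H, g b = hB.foot q} := hS ▸ mem_univ _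
    rw [(hB.foot_eq (q := (b' : Q)) (b := b') (j := 0) rfl (height_pos _)).1] at h
    exact ⟨⟨g, hg⟩, h⟩

lemma merge_support (hB : X.IsRowBase B) {V : Set Q} (hV : HasCommutatorSupport X.right X.up V)
    (hVB : V ⊆ B) : HasCommutatorSupport hB.merge.right hB.merge.up {b | (b : Q) ∈ V} := by
  have key : ∀ b : B, (hB.merge.up (hB.merge.right (hB.merge.up⁻¹ (hB.merge.right⁻¹ b))) : Q) =
      X.up (X.right (X.up⁻¹ (X.right⁻¹ (b : Q)))) := by
    intro b
    set d := hB.merge.up⁻¹ (hB.merge.right⁻¹ b)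
    have hd : b = hB.rightMap (returnMap X B d) := by
      change b = hB.merge.right (hB.merge.up d)
      rw [perm_apply_inv, perm_apply_inv]
    change (returnMap X B (hB.rightMap d) : Q) = _
    have h0 := height_pos (X := X) d
    obtain ⟨n, hn⟩ : ∃ n, height X B d = n + 1 := ⟨_, (Nat.sub_add_cancel h0).symm⟩
    rw [coe_returnMap, hB.height_right, hn, coe_rightMap, pow_succ', Equiv.Perm.mul_apply,
      ← hB.right_up_pow (by omega), hd, coe_rightMap, coe_returnMap, hn, perm_inv_apply,
      pow_succ', Equiv.Perm.mul_apply, perm_inv_apply]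
  refine ⟨fun b hb => Subtype.ext ((key b).trans (hV.comm_eq _ hb)), fun b hb h => ?_, ?_⟩
  · exact hV.comm_ne _ hb ((key b).symm.trans (congrArg Subtype.val h))
  · rw [← hV.ncard_eq, ← ncard_image_of_injective _ Subtype.val_injective]
    congr 1
    ext q
    exact ⟨fun ⟨b, hb, h⟩ => h ▸ hb, fun hq => ⟨⟨q, hVB hq⟩, hq, rfl⟩⟩

/-- Merging rows does not change the surface: the square `b` of the merged origami is stretched
vertically to `height X B b` squares. -/
lemma exists_homeo_merge (hB : X.IsRowBase B) : ∃ f : hB.merge.Surface ≃ₜ X.Surface,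
    ∀ b, ∀ x ∈ Icc (0 : ℝ) 1, ∀ y ∈ Icc (0 : ℝ) 1,
      f (hB.merge.pt b x y) = X.col b x (y * height X B b) := by
  have hI : ∀ b : B, ∀ y ∈ Icc (0 : ℝ) 1, y * height X B b ∈ Icc (0 : ℝ) (height X B b) :=
    fun b y hy => ⟨by have := hy.1; positivity, mul_le_of_le_one_left (by positivity) hy.2⟩
  have hpos : ∀ b : B, (0 : ℝ) < height X B b := fun b => by exact_mod_cast height_pos b
  let f : hB.merge.Surface → X.Surface :=
    hB.merge.desc (fun b x y => X.col b x (y * height X B b))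
      (fun b y hy => by
        obtain ⟨n, hn, hmem⟩ := exists_nat_mem_Icc (height_pos b) (hI b y hy)
        change _ = X.col (hB.rightMap b) 0 (y * height X B (hB.rightMap b))
        rw [hB.height_right, X.col_of_mem _ _ n (by exact_mod_cast hmem),
          X.col_of_mem _ _ n (by exact_mod_cast hmem), X.pt_side, coe_rightMap, zpow_natCast,
          hB.right_up_pow hn])
      (fun b x hx => by
        have := X.col_add_int b x 0 (height X B b)
        rw [zpow_natCast, zero_add, Int.cast_natCast] at this
        change _ = X.col (returnMap X B b) x _
        rw [one_mul, zero_mul, this, coe_returnMap])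
  let g : X.Surface → hB.merge.Surface := X.desc
    (fun q x y => hB.merge.pt (hB.foot q) x ((hB.depth q + y) / height X B (hB.foot q)))
    (fun q y hy => by
      rw [(hB.foot_right q).1, (hB.foot_right q).2, hB.height_right, hB.merge.pt_side]
      rfl)
    (fun q x hx => by
      rcases hB.foot_up q with ⟨-, h1, h2⟩ | ⟨h0, h1, h2⟩
      · rw [h1, h2, add_zero]; push_cast; rfl
      · have h3 : (hB.depth q + 1 : ℝ) = height X B (hB.foot q) := by exact_mod_cast h0
        rw [h1, h2, h3, div_self (hpos _).ne', hB.merge.pt_top]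
        simp only [Nat.cast_zero, add_zero, zero_div]; rfl)
  have hfc : Continuous f := hB.merge.continuous_desc fun b =>
    (X.continuous_col b).comp (continuous_fst.prodMk (continuous_snd.mul continuous_const))
  have hgc : Continuous g := X.continuous_desc fun q =>
    (hB.merge.continuous_pt _).comp
      (continuous_fst.prodMk ((continuous_const.add continuous_snd).div_const _))
  have hf : ∀ b, ∀ x ∈ Icc (0 : ℝ) 1, ∀ y ∈ Icc (0 : ℝ) 1,
      f (hB.merge.pt b x y) = X.col b x (y * height X B b) :=
    fun b x hx y hy => hB.merge.desc_pt _ hx hy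
  have hg : ∀ q, ∀ x ∈ Icc (0 : ℝ) 1, ∀ y ∈ Icc (0 : ℝ) 1, g (X.pt q x y) =
      hB.merge.pt (hB.foot q) x ((hB.depth q + y) / height X B (hB.foot q)) :=
    fun q x hx y hy => X.desc_pt _ hx hy
  refine ⟨homeoOfInverse f g hfc hgc (fun b x hx y hy => ?_) (fun q x hx y hy => ?_), hf⟩
  · obtain ⟨n, hn, hmem⟩ := exists_nat_mem_Icc (height_pos b) (hI b y hy)
    obtain ⟨h1, h2⟩ := hB.foot_eq (q := (X.up ^ n) (b : Q)) rfl hn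
    rw [hf b x hx y hy, X.col_of_mem _ _ n (by exact_mod_cast hmem), zpow_natCast,
      Int.cast_natCast, hg _ x hx _ ⟨by linarith [hmem.1], by linarith [hmem.2]⟩, h1, h2,
      add_sub_cancel, mul_div_cancel_right₀ _ (hpos b).ne']
  · have h1 : (hB.depth q + 1 : ℝ) ≤ height X B (hB.foot q) := by exact_mod_cast hB.depth_lt q
    have h2 := hpos (hB.foot q)
    have h3 : (0 : ℝ) ≤ hB.depth q := by positivity
    rw [hg q x hx y hy, hf _ x hx _ ⟨div_nonneg (by linarith [hy.1]) h2.le,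
      (div_le_one h2).2 (by linarith [hy.2])⟩, div_mul_cancel₀ _ h2.ne',
      X.col_of_mem _ _ (hB.depth q) ⟨by push_cast; linarith [hy.1], by push_cast; linarith [hy.2]⟩,
      zpow_natCast, hB.up_depth, Int.cast_natCast, add_sub_cancel_left]

end IsRowBase

/-! ### Surfaces with two horizontal cylinders -/

/-- The gluing data of an origami in `H(2)` with two rows. The long row consists of the squares `q₁,
…` (`a` of them) followed by the squares `q₂, …` (`w` of them), the short one of the `w` squares
`q₃, …`. Going up, one passes from the top of the long row, read off from the `t₂`-th square on, to
the squares `q₁, …` and `q₃, …`, and from the top of the short row, read off from the `t₁`-th square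
on, to the squares `q₂, …`. -/
structure IsTwoRow (r u : Equiv.Perm Q) (q₁ q₂ q₃ : Q) (a w : ℕ) (t₁ t₂ : ℤ) : Prop where
  a_pos : 0 < a
  w_pos : 0 < w
  right_one : (r ^ (a : ℤ)) q₁ = q₂
  right_two : (r ^ (w : ℤ)) q₂ = q₁
  right_three : (r ^ (w : ℤ)) q₃ = q₃
  cover : ∀ b, (∃ i < a, (r ^ (i : ℤ)) q₁ = b) ∨ (∃ i < w, (r ^ (i : ℤ)) q₂ = b) ∨
    ∃ i < w, (r ^ (i : ℤ)) q₃ = b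
  dvd_one : ∀ n : ℤ, (r ^ n) q₁ = q₁ → ((a + w : ℕ) : ℤ) ∣ n
  dvd_three : ∀ n : ℤ, (r ^ n) q₃ = q₃ → (w : ℤ) ∣ n
  ne : ∀ n : ℤ, (r ^ n) q₁ ≠ q₃
  up_one : ∀ i < a, u ((r ^ (t₂ + i)) q₁) = (r ^ (i : ℤ)) q₁
  up_two : ∀ i < w, u ((r ^ (t₂ + i)) q₂) = (r ^ (i : ℤ)) q₃
  up_three : ∀ i < w, u ((r ^ (t₁ + i)) q₃) = (r ^ (i : ℤ)) q₂

lemma zpow_apply_eq_iff_dvd (r : Equiv.Perm Q) (q : Q) (n : ℤ) :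
    (r ^ n) q = q ↔ (Function.minimalPeriod r q : ℤ) ∣ n := by
  have := MulAction.zpow_smul_eq_iff_minimalPeriod_dvd (a := r) (b := q) (n := n)
  exact this

lemma minimalPeriod_zpow (r : Equiv.Perm Q) (q : Q) (n : ℤ) :
    Function.minimalPeriod r ((r ^ n) q) = Function.minimalPeriod r q := by
  have key : ∀ m : ℤ, (r ^ m) ((r ^ n) q) = (r ^ n) q ↔ (r ^ m) q = q := fun m => by
    rw [← Equiv.Perm.mul_apply, ← zpow_add, add_comm, zpow_add, Equiv.Perm.mul_apply,
      (r ^ n).injective.eq_iff]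
  simp only [zpow_apply_eq_iff_dvd] at key
  exact Nat.dvd_antisymm (Int.natCast_dvd_natCast.1 ((key _).2 dvd_rfl))
    (Int.natCast_dvd_natCast.1 ((key _).1 dvd_rfl))

lemma zpow_apply_mod {r : Equiv.Perm Q} {q : Q} {l : ℕ} (hl : 0 < l)
    (hq : (r ^ (l : ℤ)) q = q) (k : ℤ) : ∃ i < l, (r ^ (i : ℤ)) q = (r ^ k) q := by
  have hl' : (0 : ℤ) < l := by exact_mod_cast hl
  refine ⟨(k % l).toNat, by have := Int.emod_lt_of_pos k hl'; omega, ?_⟩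
  rw [Int.toNat_of_nonneg (Int.emod_nonneg _ hl'.ne')]
  conv_rhs => rw [← Int.emod_add_mul_ediv k l, zpow_add, Equiv.Perm.mul_apply, zpow_mul]
  congr 1
  exact (Function.IsFixedPt.perm_zpow hq _).symm

namespace HasCommutatorSupport

variable {r u : Equiv.Perm Q} {V : Set Q}

/-- The squares below a horizontal segment without singularities in its interior are consecutive. -/
lemma down_run (h : HasCommutatorSupport r u V) {v : Q} {n : ℕ}
    (hv : ∀ i : ℕ, 0 < i → i < n → (r ^ (i : ℤ)) v ∉ V) {i : ℕ} (hi : i < n) :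
    u⁻¹ ((r ^ (i : ℤ)) v) = (r ^ (i : ℤ)) (u⁻¹ v) := by
  induction i with
  | zero => simp
  | succ i ih =>
    have h1 := h.comm_eq _ (hv (i + 1) (Nat.succ_pos i) hi)
    have h2 : ∀ p, (r ^ ((i + 1 : ℕ) : ℤ)) p = r ((r ^ (i : ℤ)) p) := fun p => by
      push_cast
      rw [add_comm, zpow_add, zpow_one, Equiv.Perm.mul_apply]
    rw [← h1, perm_inv_apply, h2, h2, perm_inv_apply, ih (by omega)]

/-- A row whose bottom side contains a single singularity lies above a strictly longer row: the
whole bottom side is glued to consecutive squares, and if these filled a row, the full turn around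
the vertex would close up. -/
lemma lt_period_down [Finite Q] (h : HasCommutatorSupport r u V) {v : Q} (hvV : v ∈ V)
    (hv : ∀ i : ℕ, 0 < i → i < Function.minimalPeriod r v → (r ^ (i : ℤ)) v ∉ V) :
    Function.minimalPeriod r v < Function.minimalPeriod r (u⁻¹ v) := by
  set l := Function.minimalPeriod r v with hl
  have hpos : 0 < l := Function.minimalPeriod_pos_of_mem_periodicPts
    (r.injective.mem_periodicPts v)
  have hpos' : 0 < Function.minimalPeriod r (u⁻¹ v) := Function.minimalPeriod_pos_of_mem_periodicPts
    (r.injective.mem_periodicPts _)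
  set m := Function.minimalPeriod r (u⁻¹ v) with hm
  have hmv : (r ^ (m : ℤ)) (u⁻¹ v) = u⁻¹ v := (zpow_apply_eq_iff_dvd _ _ _).2 dvd_rfl
  by_contra! hle
  rcases hle.lt_or_eq with h1 | h1
  · rw [← h.down_run hv h1] at hmv
    have := (zpow_apply_eq_iff_dvd _ _ _).1 (u⁻¹.injective hmv)
    exact absurd (Nat.le_of_dvd hpos' (Int.natCast_dvd_natCast.1 this)) (by omega)
  · apply h.comm_ne v hvV
    have h2 : r⁻¹ v = (r ^ ((l - 1 : ℕ) : ℤ)) v := by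
      apply r.injective
      rw [perm_apply_inv, ← Equiv.Perm.mul_apply, ← zpow_one_add]
      have : (1 + ((l - 1 : ℕ) : ℤ)) = l := by omega
      rw [this, (zpow_apply_eq_iff_dvd _ _ _).2 dvd_rfl]
    rw [h2, h.down_run hv (by omega), ← Equiv.Perm.mul_apply r, ← zpow_one_add]
    have : (1 + ((l - 1 : ℕ) : ℤ)) = m := by omega
    rw [this, hmv, perm_apply_inv]

/-- The gluing of two rows, the long one with two singularities on its bottom side, is determined
once it is known which of the two segments is glued to the short row. -/
lemma isTwoRow_of_runs (h : HasCommutatorSupport r u V) {q₁ q₂ q₃ : Q} {a b w : ℕ} (ha : 0 < a)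
    (hb : 0 < b) (hw : 0 < w) (h12 : (r ^ (a : ℤ)) q₁ = q₂) (h21 : (r ^ (b : ℤ)) q₂ = q₁)
    (h33 : (r ^ (w : ℤ)) q₃ = q₃)
    (hrun₁ : ∀ i : ℕ, 0 < i → i < a → (r ^ (i : ℤ)) q₁ ∉ V)
    (hrun₂ : ∀ i : ℕ, 0 < i → i < b → (r ^ (i : ℤ)) q₂ ∉ V)
    (hrun₃ : ∀ i : ℕ, 0 < i → i < w → (r ^ (i : ℤ)) q₃ ∉ V)
    (hd₁ : ∀ n : ℤ, (r ^ n) q₁ = q₁ → ((a + b : ℕ) : ℤ) ∣ n)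
    (hd₃ : ∀ n : ℤ, (r ^ n) q₃ = q₃ → (w : ℤ) ∣ n)
    (hsep : ∀ m n : ℤ, (r ^ m) q₁ ≠ (r ^ n) q₃)
    (hrow : ∀ b, (∃ k : ℤ, (r ^ k) q₁ = b) ∨ ∃ k : ℤ, (r ^ k) q₃ = b)
    (hdown₃ : ∃ k : ℤ, (r ^ k) q₁ = u⁻¹ q₃) (hdown₂ : ∃ k : ℤ, (r ^ k) q₃ = u⁻¹ q₂)
    (hlt : w < a + b) : ∃ t₁ t₂, IsTwoRow r u q₁ q₂ q₃ a w t₁ t₂ := by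
  obtain ⟨k₃, hk₃⟩ := hdown₃
  obtain ⟨t₁, ht₁⟩ := hdown₂
  have add_apply : ∀ (m n : ℤ) (q : Q), (r ^ (m + n)) q = (r ^ m) ((r ^ n) q) := fun m n q => by
    rw [zpow_add, Equiv.Perm.mul_apply]
  have h11 : (r ^ ((a + b : ℕ) : ℤ)) q₁ = q₁ := by
    push_cast
    rw [add_comm, add_apply, h12, h21]
  have cover : ∀ p, (∃ i < a, (r ^ (i : ℤ)) q₁ = p) ∨ (∃ i < b, (r ^ (i : ℤ)) q₂ = p) ∨
      ∃ i < w, (r ^ (i : ℤ)) q₃ = p := by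
    intro p
    rcases hrow p with ⟨k, rfl⟩ | ⟨k, rfl⟩
    · obtain ⟨i, hi, hik⟩ := zpow_apply_mod (by omega) h11 k
      rcases Nat.lt_or_ge i a with h1 | h1
      · exact Or.inl ⟨i, h1, hik⟩
      · refine Or.inr (Or.inl ⟨i - a, by omega, ?_⟩)
        rw [← hik, ← h12, ← add_apply]
        congr 2; omega
    · obtain ⟨i, hi, hik⟩ := zpow_apply_mod hw h33 k
      exact Or.inr (Or.inr ⟨i, hi, hik⟩)
  -- the top of the long row meets the segment `q₁`, as the short row is too short for both segments
  have hb_le : b ≤ w := by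
    by_contra! hlt'
    have h1 := h.down_run hrun₂ hlt'
    rw [← ht₁, ← add_apply, add_comm, add_apply, h33, ht₁] at h1
    have h2 := u⁻¹.injective h1
    have h3 : (r ^ (w : ℤ)) q₁ = q₁ := by
      rw [← h21, ← add_apply, add_comm, add_apply, h2]
    have := Nat.le_of_dvd hw (Int.natCast_dvd_natCast.1 (hd₁ _ h3))
    omega
  obtain ⟨t₂, ht₂⟩ : ∃ k : ℤ, (r ^ k) q₁ = u⁻¹ q₁ := by
    rcases hrow (u⁻¹ q₁) with h1 | ⟨k, hk⟩
    · exact h1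
    · exfalso
      -- otherwise both segments fit below into the short row without overlap
      have hj : ∀ j : Fin (a + b), ∃ i : Fin w, (r ^ (i : ℤ)) q₃ = u⁻¹ ((r ^ (j : ℤ)) q₁) := by
        rintro ⟨j, hj⟩
        have h2 : ∃ m : ℤ, (r ^ m) q₃ = u⁻¹ ((r ^ (j : ℤ)) q₁) := by
          rcases Nat.lt_or_ge j a with h2 | h2
          · exact ⟨j + k, by rw [h.down_run hrun₁ h2, add_apply, hk]⟩
          · refine ⟨(j - a : ℕ) + t₁, ?_⟩
            rw [add_apply, ht₁, ← h.down_run hrun₂ (by omega), ← h12, ← add_apply]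
            congr 3; omega
        obtain ⟨m, hm⟩ := h2
        obtain ⟨i, hi, him⟩ := zpow_apply_mod hw h33 m
        exact ⟨⟨i, hi⟩, him.trans hm⟩
      choose f hf using hj
      have hinj : Function.Injective f := by
        intro j j' hjj
        have h2 := (hf j).symm.trans
          ((congrArg (fun i : Fin w => (r ^ (i : ℤ)) q₃) hjj).trans (hf j'))
        have h3 : (r ^ ((j : ℤ) - j')) q₁ = q₁ := by
          rw [sub_eq_neg_add, add_apply, u⁻¹.injective h2, zpow_neg, perm_inv_apply]
        have h4 := Int.eq_zero_of_abs_lt_dvd (hd₁ _ h3) (by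
          rw [abs_lt]; have := j.2; have := j'.2; constructor <;> push_cast <;> omega)
        exact Fin.ext (by omega)
      have := Fintype.card_le_of_injective f hinj
      simp only [Fintype.card_fin] at this
      omega
  -- the top of the short row meets neither `q₁` nor `q₃`, so all of it is glued to `q₂`
  have hbw : b = w := by
    refine le_antisymm hb_le ?_
    have hj : ∀ j : Fin w, ∃ i : Fin b, (r ^ (i : ℤ)) q₂ = u ((r ^ (j : ℤ)) q₃) := by
      intro j
      rcases cover (u ((r ^ (j : ℤ)) q₃)) with ⟨i, hi, h2⟩ | ⟨i, hi, h2⟩ | ⟨i, hi, h2⟩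
      · exfalso
        refine hsep (i + t₂) j ?_
        rw [add_apply, ht₂, ← h.down_run hrun₁ hi, h2, perm_inv_apply]
      · exact ⟨⟨i, hi⟩, h2⟩
      · exfalso
        refine hsep (i + k₃) j ?_
        rw [add_apply, hk₃, ← h.down_run hrun₃ hi, h2, perm_inv_apply]
    choose f hf using hj
    have hinj : Function.Injective f := by
      intro j j' hjj
      have h2 := (hf j).symm.trans
        ((congrArg (fun i : Fin b => (r ^ (i : ℤ)) q₂) hjj).trans (hf j'))
      have h3 : (r ^ ((j : ℤ) - j')) q₃ = q₃ := by
        rw [sub_eq_neg_add, add_apply, u.injective h2, zpow_neg, perm_inv_apply]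
      have h4 := Int.eq_zero_of_abs_lt_dvd (hd₃ _ h3) (by
        rw [abs_lt]; have := j.2; have := j'.2; constructor <;> omega)
      exact Fin.ext (by omega)
    simpa using Fintype.card_le_of_injective f hinj
  subst hbw
  have hq₃ : (r ^ (a : ℤ)) (u⁻¹ q₁) = u⁻¹ q₃ := by
    rcases cover (u ((r ^ (a : ℤ)) (u⁻¹ q₁))) with ⟨i, hi, h2⟩ | ⟨i, hi, h2⟩ | ⟨i, hi, h2⟩
    · exfalso
      have h3 := h.down_run hrun₁ hi
      rw [h2, perm_inv_apply, ← ht₂, ← add_apply, ← add_apply, add_comm, add_comm (i : ℤ), add_apply,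
        add_apply] at h3
      have h4 : (r ^ ((a : ℤ) - i)) q₁ = q₁ := by
        rw [sub_eq_neg_add, add_apply, (r ^ t₂).injective h3, zpow_neg, perm_inv_apply]
      have := Int.le_of_dvd (by omega) (hd₁ _ h4)
      push_cast at this
      omega
    · exfalso
      refine hsep (a + t₂) (i + t₁) ?_
      rw [add_apply, add_apply, ht₁, ht₂, ← h.down_run hrun₂ hi, h2, perm_inv_apply]
    · rcases Nat.eq_zero_or_pos i with rfl | hi0
      · have h3 : q₃ = _ := h2
        conv_rhs => rw [h3]
        rw [perm_inv_apply]
      · exfalso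
        have h3 := h.down_run hrun₃ hi
        obtain ⟨c, rfl⟩ : ∃ c, a = c + 1 := ⟨a - 1, by omega⟩
        obtain ⟨d, rfl⟩ : ∃ d, i = d + 1 := ⟨i - 1, by omega⟩
        rw [h2, perm_inv_apply] at h3
        push_cast at h3
        rw [add_comm, add_apply, add_comm (d : ℤ), add_apply] at h3
        have h4 := (r ^ (1 : ℤ)).injective h3
        rw [← h.down_run hrun₁ (by omega), ← h.down_run hrun₃ (by omega)] at h4
        exact hsep _ _ (u⁻¹.injective h4)
  refine ⟨t₁, t₂, ha, hb, h12, h21, h33, cover, hd₁, hd₃, fun n => hsep n 0, ?_, ?_, ?_⟩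
  · intro i hi
    rw [add_comm, add_apply, ht₂, ← h.down_run hrun₁ hi, perm_apply_inv]
  · intro i hi
    have h2 : (r ^ (t₂ + i)) q₂ = (r ^ (i : ℤ)) (u⁻¹ q₃) := by
      rw [← hq₃, ← ht₂, ← h12, ← add_apply, ← add_apply, ← add_apply]
      congr 2; ring
    rw [h2, ← h.down_run hrun₃ hi, perm_apply_inv]
  · intro i hi
    rw [add_comm, add_apply, ht₁, ← h.down_run hrun₂ hi, perm_apply_inv]

/-- If every row contains a square of `V` and there are at least two rows, then there are exactly
two of them, glued as in `IsTwoRow`. -/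
lemma exists_isTwoRow [Finite Q] (h : HasCommutatorSupport r u V)
    (hrow : ∀ b, ∃ k : ℤ, (r ^ k) b ∈ V) (hne : ∃ b b', ∀ k : ℤ, (r ^ k) b ≠ b') :
    ∃ q₁ ∈ V, ∃ q₂ q₃ a w t₁ t₂, IsTwoRow r u q₁ q₂ q₃ a w t₁ t₂ := by
  have hpos : ∀ q, 0 < Function.minimalPeriod r q := fun q =>
    Function.minimalPeriod_pos_of_mem_periodicPts (r.injective.mem_periodicPts q)
  have hVfin : V.Finite := toFinite V
  obtain ⟨v, hv, hmax⟩ := hVfin.exists_maximalFor (Function.minimalPeriod r) V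
    (nonempty_of_ncard_ne_zero (by rw [h.ncard_eq]; norm_num))
  set L := Function.minimalPeriod r v with hL
  have hmax' : ∀ b, Function.minimalPeriod r b ≤ L := fun b => by
    obtain ⟨k, hk⟩ := hrow b
    rw [← minimalPeriod_zpow r b k]
    by_contra! hlt
    exact absurd (hmax hk hlt.le) (by simpa using hlt)
  -- the longest row contains a second square of `V`
  obtain ⟨a, ha0, haL, haV⟩ : ∃ a : ℕ, 0 < a ∧ a < L ∧ (r ^ (a : ℤ)) v ∈ V := by
    by_contra! hcon
    exact absurd (h.lt_period_down hv hcon) (by simpa using hmax' _)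
  set v' := (r ^ (a : ℤ)) v with hv'
  have hvv' : v ≠ v' := fun he => by
    have := (zpow_apply_eq_iff_dvd r v a).1 he.symm
    exact absurd (Nat.le_of_dvd ha0 (Int.natCast_dvd_natCast.1 this)) (by omega)
  obtain ⟨q₃, hq₃, hV⟩ : ∃ q₃ ∈ V, V = {v, v', q₃} := by
    have h1 : ({v, v'} : Set Q) ⊆ V := by
      rintro x (rfl | rfl) <;> assumption
    have h2 : (V \ {v, v'}).ncard = 1 := by
      rw [ncard_sdiff h1 (toFinite _), h.ncard_eq, ncard_pair hvv']
    obtain ⟨q₃, hq₃⟩ := ncard_eq_one.1 h2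
    have h3 : q₃ ∈ V \ {v, v'} := hq₃ ▸ rfl
    refine ⟨q₃, h3.1, ?_⟩
    rw [← sdiff_union_of_subset h1, hq₃]
    ext x; simp only [mem_union, mem_singleton_iff, mem_insert_iff]; tauto
  have trans_zpow : ∀ {x y : Q} {k : ℤ}, (r ^ k) x = y → (r ^ (-k)) y = x := fun {x y k} hk => by
    rw [← hk, zpow_neg, perm_inv_apply]
  have hrow' : ∀ b, (∃ k : ℤ, (r ^ k) v = b) ∨ ∃ k : ℤ, (r ^ k) q₃ = b := by
    intro b
    obtain ⟨k, hk⟩ := hrow b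
    rw [hV] at hk
    rcases hk with hk | hk | hk
    · exact Or.inl ⟨-k, trans_zpow hk⟩
    · refine Or.inl ⟨-k + a, ?_⟩
      rw [zpow_add, Equiv.Perm.mul_apply]
      exact trans_zpow hk
    · exact Or.inr ⟨-k, trans_zpow hk⟩
  have hsep : ∀ n : ℤ, (r ^ n) v ≠ q₃ := by
    intro n hn
    have hall : ∀ b, ∃ k : ℤ, (r ^ k) v = b := fun b => by
      rcases hrow' b with hb | ⟨k, hk⟩
      · exact hb
      · exact ⟨k + n, by rw [zpow_add, Equiv.Perm.mul_apply, hn, hk]⟩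
    obtain ⟨b, b', hbb⟩ := hne
    obtain ⟨k, hk⟩ := hall b
    obtain ⟨k', hk'⟩ := hall b'
    apply hbb (k' + -k)
    rw [zpow_add, Equiv.Perm.mul_apply, trans_zpow hk, hk']
  have hsep' : ∀ m n : ℤ, (r ^ m) v ≠ (r ^ n) q₃ := fun m n he => hsep (-n + m) (by
    rw [zpow_add, Equiv.Perm.mul_apply, he, zpow_neg, perm_inv_apply])
  set w := Function.minimalPeriod r q₃ with hw
  have hrun₃ : ∀ i : ℕ, 0 < i → i < w → (r ^ (i : ℤ)) q₃ ∉ V := by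
    intro i hi0 hi hiV
    rw [hV] at hiV
    rcases hiV with hk | hk | hk
    · exact hsep' 0 i (by simpa using hk.symm)
    · exact hsep' a i hk.symm
    · have := (zpow_apply_eq_iff_dvd r q₃ i).1 hk
      exact absurd (Nat.le_of_dvd hi0 (Int.natCast_dvd_natCast.1 this)) (by omega)
  have hlong₃ := h.lt_period_down hq₃ hrun₃
  have hwL : w < L := hlong₃.trans_le (hmax' _)
  -- below the short row lies the long one
  obtain ⟨k₃, hk₃⟩ : ∃ k : ℤ, (r ^ k) v = u⁻¹ q₃ := by
    rcases hrow' (u⁻¹ q₃) with hb | ⟨k, hk⟩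
    · exact hb
    · rw [← hk, minimalPeriod_zpow] at hlong₃
      exact absurd hlong₃ (lt_irrefl _)
  have hrunv : ∀ i : ℕ, 0 < i → i < a → (r ^ (i : ℤ)) v ∉ V := by
    intro i hi0 hi hiV
    rw [hV] at hiV
    rcases hiV with hk | hk | hk
    · have := (zpow_apply_eq_iff_dvd r v i).1 hk
      exact absurd (Nat.le_of_dvd hi0 (Int.natCast_dvd_natCast.1 this)) (by omega)
    · have h1 : (r ^ ((a : ℤ) - i)) v = v := by
        rw [sub_eq_neg_add, zpow_add, Equiv.Perm.mul_apply, zpow_neg, Equiv.Perm.inv_eq_iff_eq]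
        exact (show (r ^ (i : ℤ)) v = v' from hk).symm
      have h2 := (zpow_apply_eq_iff_dvd r v _).1 h1
      exact absurd (Int.le_of_dvd (by omega) h2) (by omega)
    · exact hsep i hk
  have hv'v : (r ^ ((L - a : ℕ) : ℤ)) v' = v := by
    rw [hv', ← Equiv.Perm.mul_apply, ← zpow_add, zpow_apply_eq_iff_dvd]
    refine ⟨1, ?_⟩
    omega
  have hrunv' : ∀ i : ℕ, 0 < i → i < L - a → (r ^ (i : ℤ)) v' ∉ V := by
    intro i hi0 hi hiV
    have h0 : (r ^ (i : ℤ)) v' = (r ^ ((i + a : ℕ) : ℤ)) v := by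
      rw [hv', ← Equiv.Perm.mul_apply, ← zpow_add]; push_cast; rfl
    rw [hV] at hiV
    rcases hiV with hk | hk | hk
    · have := (zpow_apply_eq_iff_dvd r v _).1 (h0.symm.trans hk)
      exact absurd (Nat.le_of_dvd (by omega) (Int.natCast_dvd_natCast.1 this)) (by omega)
    · have := (zpow_apply_eq_iff_dvd r v' _).1 hk
      rw [hv', minimalPeriod_zpow] at this
      exact absurd (Nat.le_of_dvd hi0 (Int.natCast_dvd_natCast.1 this)) (by omega)
    · exact hsep _ (h0.symm.trans hk)
  have hd₃ : ∀ n : ℤ, (r ^ n) q₃ = q₃ → (w : ℤ) ∣ n := fun n => (zpow_apply_eq_iff_dvd r q₃ n).1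
  have h33 : (r ^ (w : ℤ)) q₃ = q₃ := (zpow_apply_eq_iff_dvd r q₃ w).2 dvd_rfl
  -- one of the two segments on the bottom of the long row is glued to the short row
  have hor : (∃ k : ℤ, (r ^ k) q₃ = u⁻¹ v) ∨ ∃ k : ℤ, (r ^ k) q₃ = u⁻¹ v' := by
    rcases hrow' (u q₃) with ⟨k, hk⟩ | ⟨k, hk⟩
    · have hLL : (r ^ (L : ℤ)) v = v := (zpow_apply_eq_iff_dvd r v L).2 dvd_rfl
      obtain ⟨i, hi, hik⟩ := zpow_apply_mod (hpos v) hLL k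
      rcases Nat.lt_or_ge i a with h1 | h1
      · refine Or.inl ⟨-i, trans_zpow ?_⟩
        rw [← h.down_run hrunv h1, hik, hk, perm_inv_apply]
      · refine Or.inr ⟨-(i - a : ℕ), trans_zpow ?_⟩
        rw [← h.down_run hrunv' (show i - a < L - a by omega), hv',
          ← Equiv.Perm.mul_apply (r ^ _) (r ^ _), ← zpow_add,
          show ((i - a : ℕ) : ℤ) + a = i by omega, hik, hk, perm_inv_apply]
    · exfalso
      obtain ⟨i, hi, hik⟩ := zpow_apply_mod (hpos q₃) h33 k
      refine hsep' (i + k₃) 0 ?_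
      rw [zpow_add, Equiv.Perm.mul_apply, hk₃, ← h.down_run hrun₃ hi, hik, hk, perm_inv_apply]
      rfl
  rcases hor with hor | hor
  · refine ⟨v', haV, v, q₃, L - a, w, ?_⟩
    refine h.isTwoRow_of_runs (b := a) (by omega) ha0 (hpos _) hv'v rfl h33 hrunv' hrunv hrun₃
      (fun n hn => ?_) hd₃ (fun m n => ?_) (fun b => ?_) ?_ hor (by omega)
    · rw [zpow_apply_eq_iff_dvd, hv', minimalPeriod_zpow] at hn
      rwa [Nat.sub_add_cancel haL.le]
    · rw [hv', ← Equiv.Perm.mul_apply, ← zpow_add]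
      exact hsep' _ _
    · rcases hrow' b with ⟨k, hk⟩ | hb
      · exact Or.inl ⟨k + (L - a : ℕ), by rw [zpow_add, Equiv.Perm.mul_apply, hv'v, hk]⟩
      · exact Or.inr hb
    · exact ⟨k₃ + (L - a : ℕ), by rw [zpow_add, Equiv.Perm.mul_apply, hv'v, hk₃]⟩
  · refine ⟨v, hv, v', q₃, a, w, ?_⟩
    refine h.isTwoRow_of_runs (b := L - a) ha0 (by omega) (hpos _) rfl hv'v h33 hrunv hrunv' hrun₃
      (fun n hn => ?_) hd₃ hsep' hrow' ⟨k₃, hk₃⟩ hor (by omega)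
    rw [zpow_apply_eq_iff_dvd] at hn
    rwa [Nat.add_sub_cancel' haL.le]

end HasCommutatorSupport

/-! ### Zigzag functions -/

/-- The distance to the even integers. -/
noncomputable def tent (t : ℝ) : ℝ := ‖((t : ℝ) : AddCircle (2 : ℝ))‖

lemma tent_of_abs_le {t : ℝ} (ht : |t| ≤ 1) : tent t = |t| := by
  refine (AddCircle.norm_coe_eq_abs_iff 2 two_ne_zero).2 ?_
  norm_num
  exact ht

lemma tent_add_two (t : ℝ) : tent (t + 2) = tent t := by
  simp [tent]

lemma abs_tent_sub_le (s t : ℝ) : |tent s - tent t| ≤ |s - t| := by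
  refine (abs_norm_sub_norm_le _ _).trans ?_
  rw [← AddCircle.coe_sub]
  exact QuotientAddGroup.norm_mk_le_norm

lemma continuous_tent : Continuous tent := by
  unfold tent
  exact continuous_norm.comp (AddCircle.continuous_mk' 2)

/-- The continuous function vanishing at `0` with slopes alternating between `p`, on `[0, 1]`, and
`q`, on `[1, 2]`. -/
noncomputable def zig (p q t : ℝ) : ℝ := t / 2 * (p + q) + tent t * ((p - q) / 2)

lemma zig_add_two_mul_int (p q t : ℝ) (n : ℤ) : zig p q (t + 2 * n) = zig p q t + n * (p + q) := by
  have h : tent (t + 2 * n) = tent t := by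
    have h2 : ((2 * n : ℝ) : AddCircle (2 : ℝ)) = 0 :=
      (AddCircle.coe_eq_zero_iff 2).2 ⟨n, by simp [mul_comm]⟩
    rw [tent, AddCircle.coe_add, h2, add_zero, tent]
  rw [zig, zig, h]; ring

lemma zig_of_mem {p q t : ℝ} (ht : t ∈ Icc (0 : ℝ) 1) : zig p q t = p * t := by
  rw [zig, tent_of_abs_le (abs_le.2 ⟨by linarith [ht.1], ht.2⟩), abs_of_nonneg ht.1]; ring

lemma zig_one_add {p q t : ℝ} (ht : t ∈ Icc (0 : ℝ) 1) : zig p q (1 + t) = p + q * t := by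
  have h : tent (1 + t) = 1 - t := by
    have h1 : tent (1 + t) = tent (t - 1) := by rw [← tent_add_two (t - 1)]; congr 1; ring
    have h2 : t - 1 ≤ 0 := by linarith [ht.2]
    rw [h1, tent_of_abs_le (abs_le.2 ⟨by linarith [ht.1], by linarith⟩), abs_of_nonpos h2]
    ring
  rw [zig, h]; ring

lemma continuous_zig (p q : ℝ) : Continuous (zig p q) :=
  ((continuous_id.div_const _).mul continuous_const).add (continuous_tent.mul continuous_const)

lemma strictMono_zig {p q : ℝ} (hp : 0 < p) (hq : 0 < q) : StrictMono (zig p q) := by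
  intro s t hst
  have h1 := abs_le.1 (abs_tent_sub_le t s)
  rw [abs_of_pos (sub_pos.2 hst)] at h1
  have h2 : zig p q t - zig p q s = (t - s + (tent t - tent s)) * (p / 2) +
      (t - s - (tent t - tent s)) * (q / 2) := by
    simp only [zig]; ring
  rcases lt_or_ge (tent t - tent s) 0 with h3 | h3
  · have := mul_nonneg (show 0 ≤ t - s + (tent t - tent s) by linarith) (half_pos hp).le
    have := mul_pos (show 0 < t - s - (tent t - tent s) by linarith) (half_pos hq)
    linarith
  · have := mul_pos (show 0 < t - s + (tent t - tent s) by linarith) (half_pos hp)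
    have := mul_nonneg (show 0 ≤ t - s - (tent t - tent s) by linarith) (half_pos hq).le
    linarith

/-- The zigzag function as an order isomorphism, for positive slopes. -/
noncomputable def zigIso {p q : ℝ} (hp : 0 < p) (hq : 0 < q) : ℝ ≃o ℝ :=
  (strictMono_zig hp hq).orderIsoOfSurjective _ (by
    have hpq : 0 < p + q := add_pos hp hq
    have hv : ∀ n : ℤ, zig p q (2 * n) = n * (p + q) := fun n => by
      have := zig_add_two_mul_int p q 0 n
      rwa [zero_add, zig_of_mem (t := 0) (by simp), mul_zero, zero_add] at this
    intro y
    refine mem_range_of_exists_le_of_exists_ge (continuous_zig p q)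
      ⟨2 * ⌊y / (p + q)⌋, ?_⟩ ⟨2 * ⌈y / (p + q)⌉, ?_⟩
    · rw [hv, ← le_div_iff₀ hpq]; exact Int.floor_le _
    · rw [hv, ← div_le_iff₀ hpq]; exact Int.le_ceil _)

lemma zigIso_apply {p q : ℝ} (hp : 0 < p) (hq : 0 < q) (t : ℝ) : zigIso hp hq t = zig p q t := rfl

lemma zigIso_symm_add {p q : ℝ} (hp : 0 < p) (hq : 0 < q) (x : ℝ) (n : ℤ) :
    (zigIso hp hq).symm (x + n * (p + q)) = (zigIso hp hq).symm x + 2 * n := by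
  rw [OrderIso.symm_apply_eq, zigIso_apply, zig_add_two_mul_int, ← zigIso_apply hp hq,
    OrderIso.apply_symm_apply]

lemma zigIso_symm_of_mem {p q : ℝ} (hp : 0 < p) (hq : 0 < q) {t : ℝ} (ht : t ∈ Icc (0 : ℝ) 1) :
    (zigIso hp hq).symm (p * t) = t := by
  rw [OrderIso.symm_apply_eq, zigIso_apply, zig_of_mem ht]

lemma zigIso_symm_add_of_mem {p q : ℝ} (hp : 0 < p) (hq : 0 < q) {t : ℝ} (ht : t ∈ Icc (0 : ℝ) 1) :
    (zigIso hp hq).symm (p + q * t) = 1 + t := by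
  rw [OrderIso.symm_apply_eq, zigIso_apply, zig_one_add ht]

/-! ### The three-tile origami -/

/-- The origami with three tiles, in the shape of the letter L: the tile `2` is to the right of the
tile `1`, and the tile `0` on top of it. Every surface considered below is obtained from it by
giving the tiles the shape of parallelograms. -/
def ell : Origami (Fin 3) where
  right := Equiv.swap 1 2
  up := Equiv.swap 0 1
  connected := by
    set H : Subgroup (Equiv.Perm (Fin 3)) := Subgroup.closure {Equiv.swap 1 2, Equiv.swap 0 1}
    have hr : Equiv.swap 1 2 ∈ H := Subgroup.subset_closure (by simp)
    have hu : Equiv.swap 0 1 ∈ H := Subgroup.subset_closure (by simp)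
    have key : ∀ k : Fin 3, ∃ g ∈ H, g 1 = k := by
      intro k
      fin_cases k
      · exact ⟨_, hu, by decide⟩
      · exact ⟨1, one_mem _, rfl⟩
      · exact ⟨_, hr, by decide⟩
    refine ⟨fun x y => ?_⟩
    obtain ⟨g, hg, rfl⟩ := key x
    obtain ⟨g', hg', rfl⟩ := key y
    refine ⟨⟨g' * g⁻¹, mul_mem hg' (inv_mem hg)⟩, ?_⟩
    change g' (g⁻¹ (g 1)) = g' 1
    rw [perm_inv_apply]

lemma ell_right_zero : ell.right 0 = 0 := by decide
lemma ell_right_one : ell.right 1 = 2 := by decide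
lemma ell_right_two : ell.right 2 = 1 := by decide
lemma ell_up_zero : ell.up 0 = 1 := by decide
lemma ell_up_one : ell.up 1 = 0 := by decide
lemma ell_up_two : ell.up 2 = 2 := by decide

/-- The horizontal side vectors of the three tiles. -/
def sideX (x₁ x₂ : ℤ × ℤ) : Fin 3 → ℤ × ℤ := ![x₁, x₁, x₂]

/-- The vertical side vectors of the three tiles. -/
def sideY (y₁ y₂ : ℤ × ℤ) : Fin 3 → ℤ × ℤ := ![y₂, y₁, y₁]

/-- The homeomorphism `f` identifies the surface `X` with the one obtained from the origami `K` by
giving the tile `k` the shape of the parallelogram with side vectors `x k` and `y k`. -/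
def IsTiling {κ : Type*} (X : Origami Q) (K : Origami κ) (x y : κ → ℤ × ℤ)
    (f : K.Surface ≃ₜ X.Surface) : Prop :=
  ∀ k, ∀ s ∈ Icc (0 : ℝ) 1, ∀ t ∈ Icc (0 : ℝ) 1,
    X.proj (f (K.pt k s t)) =
      toTorus (s * (x k).1 + t * (y k).1, s * (x k).2 + t * (y k).2)

lemma row_two_add (s t : ℝ) (n : ℤ) : ell.row 2 (s + 2 * n) t = ell.row 2 s t := by
  have h1 : ell.right ^ (2 * n) = 1 := by
    rw [zpow_mul, show ell.right ^ (2 : ℤ) = 1 by decide, one_zpow]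
  have := ell.row_add_int 2 s t (2 * n)
  push_cast at this
  rw [this, h1]; rfl

lemma row_zero_add (s t : ℝ) (n : ℤ) : ell.row 0 (s + n) t = ell.row 0 s t := by
  rw [ell.row_add_int]
  congr 1
  exact Function.IsFixedPt.perm_zpow (e := ell.right) ell_right_zero n

lemma row_two_one_add {s : ℝ} (hs : s ∈ Icc (0 : ℝ) 1) (t : ℝ) :
    ell.row 2 (1 + s) t = ell.pt 1 s t := by
  have := ell.row_add_int 2 s t 1
  rw [Int.cast_one, zpow_one, ell_right_two, add_comm] at this
  rw [this, ell.row_eq_pt _ _ hs]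

lemma fin_three_cases (k : Fin 3) : k = 0 ∨ k = 1 ∨ k = 2 := by
  revert k; decide

/-- Along consecutive squares glued to consecutive squares, the top of the first strip is the bottom
of the second one. -/
lemma row_top (X : Origami Q) {p q : Q} {t : ℤ} {n : ℕ} (hn : 0 < n)
    (h : ∀ i < n, X.up ((X.right ^ (t + i)) p) = (X.right ^ (i : ℤ)) q) {z : ℝ}
    (hz : z ∈ Icc (0 : ℝ) n) : X.row p (z + t) 1 = X.row q z 0 := by
  obtain ⟨i, hi, hmem⟩ := exists_nat_mem_Icc hn hz
  rw [X.row_of_mem p 1 (t + i) ⟨by push_cast; linarith [hmem.1], by push_cast; linarith [hmem.2]⟩,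
    X.row_of_mem q 0 i (by exact_mod_cast hmem), X.pt_top, h i hi]
  congr 1
  push_cast; ring

/-- An origami with two rows, glued as in `IsTwoRow`, is tiled by three parallelograms. -/
lemma IsTwoRow.exists_homeo (X : Origami Q) {q₁ q₂ q₃ : Q} {a w : ℕ} {t₁ t₂ : ℤ}
    (h : IsTwoRow X.right X.up q₁ q₂ q₃ a w t₁ t₂) : ∃ f : ell.Surface ≃ₜ X.Surface,
      ∀ s ∈ Icc (0 : ℝ) 1, ∀ t ∈ Icc (0 : ℝ) 1, f (ell.pt 0 s t) = X.row q₃ (w * s + t * t₁) t ∧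
        f (ell.pt 1 s t) = X.row q₁ (a + w * s + t * t₂) t ∧
        f (ell.pt 2 s t) = X.row q₁ (a * s + t * t₂) t := by
  classical
  have ha : (0 : ℝ) < a := by exact_mod_cast h.a_pos
  have hw : (0 : ℝ) < w := by exact_mod_cast h.w_pos
  let φ := zigIso ha hw
  have hφ : ∀ τ, φ τ = zig a w τ := fun τ => rfl
  have add_apply : ∀ (m n : ℤ) (q : Q), (X.right ^ (m + n)) q = (X.right ^ m) ((X.right ^ n) q) :=
    fun m n q => by rw [zpow_add, Equiv.Perm.mul_apply]
  have h11 : ∀ n : ℤ, (X.right ^ (n * (a + w))) q₁ = q₁ := fun n => by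
    have : (X.right ^ ((a : ℤ) + w)) q₁ = q₁ := by
      rw [add_comm, add_apply, h.right_one, h.right_two]
    rw [mul_comm, zpow_mul]
    exact Function.IsFixedPt.perm_zpow this n
  have h33 : ∀ n : ℤ, (X.right ^ (n * w)) q₃ = q₃ := fun n => by
    rw [mul_comm, zpow_mul]
    exact Function.IsFixedPt.perm_zpow h.right_three n
  have row1 : ∀ (x y : ℝ) (n : ℤ), X.row q₁ (x + n * (a + w)) y = X.row q₁ x y := fun x y n => by
    have := X.row_add_int q₁ x y (n * (a + w))
    push_cast at this
    rw [this, h11]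
  have row3 : ∀ (x y : ℝ) (n : ℤ), X.row q₃ (x + n * w) y = X.row q₃ x y := fun x y n => by
    have := X.row_add_int q₃ x y (n * w)
    push_cast at this
    rw [this, h33]
  have row12 : ∀ x y, X.row q₂ x y = X.row q₁ (a + x) y := fun x y => by
    have := X.row_add_int q₁ x y a
    rw [h.right_one, Int.cast_natCast, add_comm] at this
    exact this.symm
  have hI : ∀ (c : ℕ), ∀ s ∈ Icc (0 : ℝ) 1, (c : ℝ) * s ∈ Icc (0 : ℝ) c := fun c s hs =>
    ⟨mul_nonneg (by positivity) hs.1, mul_le_of_le_one_right (by positivity) hs.2⟩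
  -- the tiles inside the rows
  let F : Fin 3 → ℝ → ℝ → X.Surface := ![fun s t => X.row q₃ (w * s + t * t₁) t,
    fun s t => X.row q₁ (a + w * s + t * t₂) t, fun s t => X.row q₁ (a * s + t * t₂) t]
  let f : ell.Surface → X.Surface := ell.desc F
    (fun k t _ => by
      rcases fin_three_cases k with rfl | rfl | rfl
      · rw [ell_right_zero]
        have := row3 (t * t₁) t 1
        simp only [F, Matrix.cons_val_zero]
        rw [mul_zero, zero_add, ← this]
        congr 1; push_cast; ring
      · rw [ell_right_one]
        have := row1 (t * t₂) t 1
        simp only [F, Matrix.cons_val_one, Matrix.cons_val_zero, Matrix.cons_val]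
        rw [mul_zero, zero_add, ← this]
        congr 1; push_cast; ring
      · rw [ell_right_two]
        simp [F])
    (fun k s hs => by
      rcases fin_three_cases k with rfl | rfl | rfl
      · rw [ell_up_zero]
        have := X.row_top h.w_pos h.up_three (hI w s hs)
        simp only [F, Matrix.cons_val_one, Matrix.cons_val_zero]
        rw [one_mul, this, row12, zero_mul, add_zero]
      · rw [ell_up_one]
        have := X.row_top h.w_pos h.up_two (hI w s hs)
        simp only [F, Matrix.cons_val_one, Matrix.cons_val_zero]
        rw [one_mul, zero_mul, add_zero, ← this, row12, add_assoc]
      · rw [ell_up_two]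
        have := X.row_top h.a_pos h.up_one (hI a s hs)
        simp only [F, Matrix.cons_val]
        rw [one_mul, zero_mul, add_zero, this])
  have hfF : ∀ k, ∀ s ∈ Icc (0 : ℝ) 1, ∀ t ∈ Icc (0 : ℝ) 1, f (ell.pt k s t) = F k s t :=
    fun k s hs t ht => ell.desc_pt k hs ht
  have hfc : Continuous f := ell.continuous_desc fun k => by
    have hlin : ∀ (q : Q) (b c d : ℝ), Continuous fun z : ℝ × ℝ =>
        X.row q (b + c * z.1 + z.2 * d) z.2 := fun q b c d =>
      (X.continuous_row q).comp (((continuous_const.add (continuous_const.mul continuous_fst)).add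
        (continuous_snd.mul continuous_const)).prodMk continuous_snd)
    rcases fin_three_cases k with rfl | rfl | rfl
    · simpa [F] using hlin q₃ 0 w t₁
    · exact hlin q₁ a w t₂
    · simpa [F] using hlin q₁ 0 a t₂
  -- the rows seen from the tiles
  let Wd : ℝ → ℝ → ell.Surface := fun ξ y => ell.row 2 (φ.symm (ξ - y * t₂)) y
  let Nr : ℝ → ℝ → ell.Surface := fun ξ y => ell.row 0 ((ξ - y * t₁) / w) y
  have hWd : ∀ (ξ y : ℝ) (n : ℤ), Wd (ξ + n * (a + w)) y = Wd ξ y := fun ξ y n => by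
    simp only [Wd]
    rw [add_sub_right_comm, zigIso_symm_add, row_two_add]
  have hNr : ∀ (ξ y : ℝ) (n : ℤ), Nr (ξ + n * w) y = Nr ξ y := fun ξ y n => by
    simp only [Nr]
    rw [add_sub_right_comm, add_div, mul_div_cancel_right₀ _ hw.ne', row_zero_add]
  let G : Q → ℝ → ℝ → ell.Surface := fun b x y =>
    if h1 : ∃ n : ℤ, (X.right ^ n) q₁ = b then Wd (h1.choose + x) y
    else if h3 : ∃ n : ℤ, (X.right ^ n) q₃ = b then Nr (h3.choose + x) y else ell.pt 0 0 0
  have sub_apply : ∀ (m n : ℤ) (q : Q), (X.right ^ m) q = (X.right ^ n) q →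
      (X.right ^ (m - n)) q = q := fun m n q hq => by
    rw [sub_eq_neg_add, add_apply, hq, zpow_neg, perm_inv_apply]
  have hG1 : ∀ (n : ℤ) (x y : ℝ), G ((X.right ^ n) q₁) x y = Wd (n + x) y := by
    intro n x y
    have h1 : ∃ m : ℤ, (X.right ^ m) q₁ = (X.right ^ n) q₁ := ⟨n, rfl⟩
    obtain ⟨c, hc⟩ := h.dvd_one _ (sub_apply _ _ _ h1.choose_spec)
    simp only [G, dif_pos h1]
    rw [← hWd (n + x) y c]
    congr 1
    have hc' : (h1.choose : ℝ) - n = (a + w) * c := by exact_mod_cast hc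
    linarith
  have hG3 : ∀ (n : ℤ) (x y : ℝ), G ((X.right ^ n) q₃) x y = Nr (n + x) y := by
    intro n x y
    have h1 : ¬ ∃ m : ℤ, (X.right ^ m) q₁ = (X.right ^ n) q₃ := by
      rintro ⟨m, hm⟩
      refine h.ne (-n + m) ?_
      rw [add_apply, hm, zpow_neg, perm_inv_apply]
    have h3 : ∃ m : ℤ, (X.right ^ m) q₃ = (X.right ^ n) q₃ := ⟨n, rfl⟩
    obtain ⟨c, hc⟩ := h.dvd_three _ (sub_apply _ _ _ h3.choose_spec)
    simp only [G, dif_neg h1, dif_pos h3]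
    rw [← hNr (n + x) y c]
    congr 1
    have hc' : (h3.choose : ℝ) - n = w * c := by exact_mod_cast hc
    linarith
  have cover : ∀ b, (∃ n : ℤ, (X.right ^ n) q₁ = b) ∨ ∃ n : ℤ, (X.right ^ n) q₃ = b := by
    intro b
    rcases h.cover b with ⟨i, -, hi⟩ | ⟨i, -, hi⟩ | ⟨i, -, hi⟩
    · exact Or.inl ⟨i, hi⟩
    · exact Or.inl ⟨i + a, by rw [add_apply, h.right_one, hi]⟩
    · exact Or.inr ⟨i, hi⟩
  have hdiv : ∀ (c : ℝ), 0 < c → ∀ i n : ℕ, i < n → c = n → ∀ x ∈ Icc (0 : ℝ) 1,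
      (i + x) / c ∈ Icc (0 : ℝ) 1 := by
    rintro _ hc i n hi rfl x hx
    have : (i : ℝ) + 1 ≤ n := by exact_mod_cast hi
    exact ⟨div_nonneg (add_nonneg (by positivity) hx.1) hc.le, (div_le_one hc).2 (by linarith [hx.2])⟩
  let g : X.Surface → ell.Surface := X.desc G
    (fun b y _ => by
      rcases cover b with ⟨n, rfl⟩ | ⟨n, rfl⟩
      · have h1 : X.right ((X.right ^ n) q₁) = (X.right ^ (1 + n)) q₁ := by
          rw [add_apply, zpow_one]
        rw [h1, hG1, hG1]
        congr 1; push_cast; ring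
      · have h1 : X.right ((X.right ^ n) q₃) = (X.right ^ (1 + n)) q₃ := by
          rw [add_apply, zpow_one]
        rw [h1, hG3, hG3]
        congr 1; push_cast; ring)
    (fun b x hx => by
      rcases h.cover (X.up b) with ⟨i, hi, hb⟩ | ⟨i, hi, hb⟩ | ⟨i, hi, hb⟩
      · obtain rfl : (X.right ^ (t₂ + i)) q₁ = b := X.up.injective ((h.up_one i hi).trans hb)
        have hm := hdiv a ha i a hi rfl x hx
        have h2 : φ.symm (i + x) = (i + x) / a := by
          conv_lhs => rw [← mul_div_cancel₀ (i + x : ℝ) ha.ne']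
          exact zigIso_symm_of_mem ha hw hm
        rw [← hb, hG1, hG1]
        simp only [Wd]
        push_cast
        rw [one_mul, zero_mul, sub_zero, add_assoc, add_sub_cancel_left, h2, ell.row_eq_pt _ _ hm,
          ell.row_eq_pt _ _ hm, ell.pt_top, ell_up_two]
      · obtain rfl : (X.right ^ (t₁ + i)) q₃ = b := X.up.injective ((h.up_three i hi).trans hb)
        have hm := hdiv w hw i w hi rfl x hx
        have h2 : φ.symm (i + a + x) = 1 + (i + x) / w := by
          rw [show (i + a + x : ℝ) = a + w * ((i + x) / w) by
            rw [mul_div_cancel₀ _ hw.ne']; ring]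
          exact zigIso_symm_add_of_mem ha hw hm
        have h3 : (X.right ^ (i : ℤ)) q₂ = (X.right ^ ((i : ℤ) + a)) q₁ := by
          rw [add_apply, h.right_one]
        rw [← hb, hG3, h3, hG1]
        simp only [Wd, Nr]
        push_cast
        rw [one_mul, zero_mul, sub_zero, add_assoc, add_sub_cancel_left, h2, ell.row_eq_pt _ _ hm,
          row_two_one_add hm, ell.pt_top, ell_up_zero]
      · obtain rfl : (X.right ^ (t₂ + i)) q₂ = b := X.up.injective ((h.up_two i hi).trans hb)
        have hm := hdiv w hw i w hi rfl x hx
        have h2 : φ.symm (i + a + x) = 1 + (i + x) / w := by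
          rw [show (i + a + x : ℝ) = a + w * ((i + x) / w) by
            rw [mul_div_cancel₀ _ hw.ne']; ring]
          exact zigIso_symm_add_of_mem ha hw hm
        have h3 : (X.right ^ (t₂ + i)) q₂ = (X.right ^ (t₂ + i + a)) q₁ := by
          rw [add_apply _ (a : ℤ), h.right_one]
        rw [← hb, hG3, h3, hG1]
        simp only [Wd, Nr]
        push_cast
        rw [one_mul, zero_mul, sub_zero, show (t₂ + i + a + x - t₂ : ℝ) = i + a + x by ring, h2,
          ell.row_eq_pt _ _ hm, row_two_one_add hm, ell.pt_top, ell_up_one])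
  have hgG : ∀ b, ∀ x ∈ Icc (0 : ℝ) 1, ∀ y ∈ Icc (0 : ℝ) 1, g (X.pt b x y) = G b x y :=
    fun b x hx y hy => X.desc_pt b hx hy
  have hgc : Continuous g := X.continuous_desc fun b => by
    rcases cover b with ⟨n, rfl⟩ | ⟨n, rfl⟩
    · simp only [hG1, Wd]
      exact (ell.continuous_row 2).comp ((φ.toHomeomorph.symm.continuous.comp
        ((continuous_const.add continuous_fst).sub
          (continuous_snd.mul continuous_const))).prodMk continuous_snd)
    · simp only [hG3, Nr]
      exact (ell.continuous_row 0).comp (((((continuous_const.add continuous_fst).sub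
        (continuous_snd.mul continuous_const))).div_const _).prodMk continuous_snd)
  have hg1 : ∀ ξ, ∀ y ∈ Icc (0 : ℝ) 1, g (X.row q₁ ξ y) = Wd ξ y := fun ξ y hy => by
    rw [row, hgG _ _ (fract_mem_Icc ξ) _ hy, hG1, Int.floor_add_fract]
  have hg3 : ∀ ξ, ∀ y ∈ Icc (0 : ℝ) 1, g (X.row q₃ ξ y) = Nr ξ y := fun ξ y hy => by
    rw [row, hgG _ _ (fract_mem_Icc ξ) _ hy, hG3, Int.floor_add_fract]
  have hf2 : ∀ τ, ∀ t ∈ Icc (0 : ℝ) 1, f (ell.row 2 τ t) = X.row q₁ (φ τ + t * t₂) t := by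
    intro τ t ht
    have h1 : ∀ σ ∈ Icc (0 : ℝ) 2, f (ell.row 2 σ t) = X.row q₁ (φ σ + t * t₂) t := by
      intro σ hσ
      rcases le_total σ 1 with h1 | h1
      · have hm : σ ∈ Icc (0 : ℝ) 1 := ⟨hσ.1, h1⟩
        rw [ell.row_eq_pt _ _ hm, hfF _ _ hm _ ht, hφ, zig_of_mem hm]
        simp [F]
      · have hm : σ - 1 ∈ Icc (0 : ℝ) 1 := ⟨by linarith, by linarith [hσ.2]⟩
        have h2 : σ = 1 + (σ - 1) := by ring
        rw [h2, row_two_one_add hm, hfF _ _ hm _ ht, hφ, zig_one_add hm]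
        simp [F]
    have h2 := h1 (τ + 2 * (-⌊τ / 2⌋ : ℤ)) (by
      have h3 := Int.floor_le (τ / 2)
      have h4 := Int.lt_floor_add_one (τ / 2)
      constructor <;> push_cast <;> linarith)
    rw [row_two_add, hφ, zig_add_two_mul_int, add_right_comm, row1] at h2
    exact h2
  have hf0 : ∀ τ, ∀ t ∈ Icc (0 : ℝ) 1, f (ell.row 0 τ t) = X.row q₃ (w * τ + t * t₁) t := by
    intro τ t ht
    have h1 := row_zero_add (Int.fract τ) t ⌊τ⌋
    rw [Int.fract_add_floor, ell.row_eq_pt _ _ (fract_mem_Icc τ)] at h1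
    rw [h1, hfF _ _ (fract_mem_Icc τ) _ ht]
    simp only [F, Matrix.cons_val_zero]
    rw [← row3 _ t ⌊τ⌋]
    congr 1
    linarith [congrArg (fun z => (w : ℝ) * z) (Int.fract_add_floor τ)]
  have hgf2 : ∀ τ, ∀ t ∈ Icc (0 : ℝ) 1, g (f (ell.row 2 τ t)) = ell.row 2 τ t := fun τ t ht => by
    rw [hf2 τ t ht, hg1 _ t ht]
    simp only [Wd]
    rw [add_sub_cancel_right, OrderIso.symm_apply_apply]
  have hgf : ∀ k, ∀ s ∈ Icc (0 : ℝ) 1, ∀ t ∈ Icc (0 : ℝ) 1,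
      g (f (ell.pt k s t)) = ell.pt k s t := by
    intro k s hs t ht
    rcases fin_three_cases k with rfl | rfl | rfl
    · rw [← ell.row_eq_pt _ _ hs, hf0 s t ht, hg3 _ t ht]
      simp only [Nr]
      rw [add_sub_cancel_right, mul_div_cancel_left₀ _ hw.ne']
    · rw [← row_two_one_add hs]
      exact hgf2 _ t ht
    · rw [← ell.row_eq_pt _ _ hs]
      exact hgf2 _ t ht
  have hfg : ∀ b, ∀ x ∈ Icc (0 : ℝ) 1, ∀ y ∈ Icc (0 : ℝ) 1, f (g (X.pt b x y)) = X.pt b x y := by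
    intro b x hx y hy
    rcases cover b with ⟨n, rfl⟩ | ⟨n, rfl⟩
    · rw [← X.row_eq_pt _ _ hx, ← X.row_add_int, hg1 _ y hy, hf2 _ y hy, OrderIso.apply_symm_apply,
        sub_add_cancel]
    · rw [← X.row_eq_pt _ _ hx, ← X.row_add_int, hg3 _ y hy, hf0 _ y hy, mul_div_cancel₀ _ hw.ne',
        sub_add_cancel]
  exact ⟨homeoOfInverse f g hfc hgc hgf hfg, fun s hs t ht =>
    ⟨hfF 0 s hs t ht, hfF 1 s hs t ht, hfF 2 s hs t ht⟩⟩

/-! ### Reduced origamis -/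

/-- A tiling of a reduced origami cannot have all its side vectors in a proper sublattice of `ℤ²`:
the covering of the torus would factor through a larger torus, in which all saddle connections close
up. -/
lemma dvd_of_isTiling {κ : Type*} {X : Origami Q} (hX : X.IsReduced) {P : X.Surface}
    (hS : X.Sing = {P}) {K : Origami κ} {x y : κ → ℤ × ℤ} (hxu : ∀ k, x (K.up k) = x k)
    (hyr : ∀ k, y (K.right k) = y k) {f : K.Surface ≃ₜ X.Surface} (hf : X.IsTiling K x y f)
    {p : ℕ} (hp : 0 < p) {α β : ℤ} (hx : ∀ k, (p : ℤ) ∣ α * (x k).1 + β * (x k).2)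
    (hy : ∀ k, (p : ℤ) ∣ α * (y k).1 + β * (y k).2) : (p : ℤ) ∣ α ∧ (p : ℤ) ∣ β := by
  have hp' : (p : ℝ) ≠ 0 := by exact_mod_cast hp.ne'
  let l : ℤ × ℤ → ℝ := fun v => (α * v.1 + β * v.2) / p
  have hl : ∀ v : ℤ × ℤ, (p : ℤ) ∣ α * v.1 + β * v.2 → ((l v : ℝ) : UnitAddCircle) = 0 := by
    rintro v ⟨n, hn⟩
    refine (AddCircle.coe_eq_zero_iff 1).2 ⟨n, ?_⟩
    have hn' : (α * v.1 + β * v.2 : ℝ) = p * n := by exact_mod_cast hn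
    simp only [l, hn', zsmul_eq_mul, mul_one]
    field_simp
  let L : K.Surface → UnitAddCircle := K.desc
    (fun k s t => ((s * l (x k) + t * l (y k) : ℝ) : UnitAddCircle))
    (fun k t _ => by rw [hyr, one_mul, zero_mul, AddCircle.coe_add, hl _ (hx k), zero_add, zero_add])
    (fun k s _ => by rw [hxu, one_mul, zero_mul, AddCircle.coe_add, hl _ (hy k), add_zero, add_zero])
  have hLc : Continuous L := K.continuous_desc fun k => by
    refine (AddCircle.continuous_mk' 1).comp ?_
    fun_prop
  let ψ : UnitAddCircle × UnitAddCircle → UnitAddCircle := fun s => α • s.1 + β • s.2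
  have hψadd : ∀ s s', ψ (s + s') = ψ s + ψ s' := fun s s' => by
    simp only [ψ, Prod.fst_add, Prod.snd_add, smul_add]; abel
  have hψ : ∀ v : ℝ × ℝ, ψ (toTorus v) = ((α * v.1 + β * v.2 : ℝ) : UnitAddCircle) := fun v => by
    simp only [ψ, toTorus, ← AddCircle.coe_zsmul, ← AddCircle.coe_add, zsmul_eq_mul]
  have hL : ∀ R, p • L R = ψ (X.proj (f R)) := by
    intro R
    obtain ⟨k, s, hs, t, ht, rfl⟩ := K.exists_pt R
    rw [hf k s hs t ht, hψ, show L _ = _ from K.desc_pt k hs ht, ← AddCircle.coe_nsmul]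
    congr 1
    simp only [l, nsmul_eq_mul]
    field_simp
    ring
  have hol : ∀ v ∈ X.hol, ∃ n : ℤ, α * v.1 + β * v.2 = n * (p : ℝ) := by
    rintro v ⟨γ, hγ⟩
    set m : ℝ := (α * v.1 + β * v.2) / p with hm
    let D : ℝ → UnitAddCircle := fun t => L (f.symm (γ t)) - ((t * m : ℝ) : UnitAddCircle)
      - L (f.symm (γ 0))
    have hD : ContinuousOn D (Icc 0 1) := by
      refine ContinuousOn.sub (ContinuousOn.sub ?_ ?_) continuousOn_const
      · exact (hLc.comp f.symm.continuous).comp_continuousOn hγ.continuousOn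
      · exact ((AddCircle.continuous_mk' 1).comp (continuous_id.mul continuous_const)).continuousOn
    have hT : MapsTo D (Icc 0 1) {u : UnitAddCircle | p • u = 0} := by
      intro t ht
      have h1 := hL (f.symm (γ t))
      have h2 := hL (f.symm (γ 0))
      rw [f.apply_symm_apply] at h1 h2
      have h3 : p • ((t * m : ℝ) : UnitAddCircle) = ψ (toTorus (t • v)) := by
        rw [hψ, ← AddCircle.coe_nsmul]
        congr 1
        simp only [hm, nsmul_eq_mul, Prod.smul_fst, Prod.smul_snd, smul_eq_mul]
        field_simp
      change p • (_ - _ - _) = 0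
      rw [smul_sub, smul_sub, h1, h2, h3, hγ.proj_eq t ht, hψadd]
      abel
    have hfin : {u : UnitAddCircle | p • u = 0}.Finite := AddCircle.finite_torsion 1 hp
    obtain ⟨c, -, hc⟩ := isPreconnected_Icc.eqOn_const_of_mapsTo hfin.isDiscrete hD hT ⟨0, by simp⟩
    have h0 : D 0 = c := hc ⟨le_rfl, zero_le_one⟩
    have h1 : D 1 = c := hc ⟨zero_le_one, le_rfl⟩
    have e0 : γ 0 = P := by simpa [hS] using hγ.start_mem
    have e1 : γ 1 = P := by simpa [hS] using hγ.end_mem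
    have h2 : ((m : ℝ) : UnitAddCircle) = 0 := by
      have := h1.trans h0.symm
      simp only [D, e0, e1, one_mul, zero_mul, AddCircle.coe_zero, sub_zero] at this
      simpa using this
    obtain ⟨n, hn⟩ := (AddCircle.coe_eq_zero_iff 1).1 h2
    refine ⟨n, ?_⟩
    rw [zsmul_eq_mul, mul_one] at hn
    rw [hn, hm, div_mul_cancel₀ _ hp']
  have hcl : ∀ v ∈ AddSubgroup.closure X.hol, ∃ n : ℤ, α * v.1 + β * v.2 = n * (p : ℝ) := by
    intro v hv
    induction hv using AddSubgroup.closure_induction with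
    | mem v hv => exact hol v hv
    | zero => exact ⟨0, by simp⟩
    | add v w _ _ hv hw =>
      obtain ⟨n, hn⟩ := hv
      obtain ⟨m, hm⟩ := hw
      refine ⟨n + m, ?_⟩
      simp only [Prod.fst_add, Prod.snd_add, Int.cast_add]
      linarith
    | neg v _ hv =>
      obtain ⟨n, hn⟩ := hv
      refine ⟨-n, ?_⟩
      simp only [Prod.fst_neg, Prod.snd_neg, Int.cast_neg]
      linarith
  have hZ : ∀ m : ℤ × ℤ, ((m.1 : ℝ), (m.2 : ℝ)) ∈ AddSubgroup.closure X.hol := fun m => by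
    have : ((m.1 : ℝ), (m.2 : ℝ)) ∈ (AddSubgroup.closure X.hol : Set (ℝ × ℝ)) := by
      rw [hX]; exact ⟨m, rfl⟩
    exact this
  constructor
  · obtain ⟨n, hn⟩ := hcl _ (hZ (1, 0))
    refine ⟨n, ?_⟩
    have : (α : ℝ) = p * n := by simpa [mul_comm] using hn
    exact_mod_cast this
  · obtain ⟨n, hn⟩ := hcl _ (hZ (0, 1))
    refine ⟨n, ?_⟩
    have : (β : ℝ) = p * n := by simpa [mul_comm] using hn
    exact_mod_cast this

/-! ### L-shaped tilings -/

/-- The determinant of two vectors. -/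
def wedge (v w : ℤ × ℤ) : ℤ := v.1 * w.2 - v.2 * w.1

/-- The surface `X` is tiled, in the pattern of `ell`, by the positively oriented parallelograms
`1`, `2` and `0` with sides `(x₁, y₁)`, `(x₂, y₁)` and `(x₁, y₂)`, and the vertex of the tiling is
the conical singularity. -/
def IsEll (X : Origami Q) (x₁ x₂ y₁ y₂ : ℤ × ℤ) : Prop :=
  0 < wedge x₁ y₁ ∧ 0 < wedge x₁ y₂ ∧ 0 < wedge x₂ y₁ ∧
    ∃ f : ell.Surface ≃ₜ X.Surface, X.IsTiling ell (sideX x₁ x₂) (sideY y₁ y₂) f ∧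
      X.Sing = {f (ell.pt 0 0 0)}

lemma ell_pt_two_zero_zero : ell.pt 2 0 0 = ell.pt 0 0 0 := by
  have h1 := ell.pt_side 1 1
  have h2 := ell.pt_top 2 0
  have h3 := ell.pt_top 1 1
  have h4 := ell.pt_side 0 0
  rw [ell_right_one] at h1
  rw [ell_up_two] at h2
  rw [ell_up_one] at h3
  rw [ell_right_zero] at h4
  rw [← h2, ← h1, h3, h4]

lemma ell_pt_one_zero_zero : ell.pt 1 0 0 = ell.pt 0 0 0 := by
  have h1 := ell.pt_side 2 0
  have h2 := ell.pt_top 2 1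
  have h3 := ell.pt_side 2 1
  have h4 := ell.pt_top 1 0
  rw [ell_right_two] at h1 h3
  rw [ell_up_two] at h2
  rw [ell_up_one] at h4
  rw [← h1, ← h2, h3, h4]

lemma IsEll.of_rel {A : Matrix.SpecialLinearGroup (Fin 2) ℤ} {X Y : Origami Q} (h : Rel A X Y)
    {x₁ x₂ y₁ y₂ : ℤ × ℤ} (hX : X.IsEll x₁ x₂ y₁ y₂) (m : ℤ × ℤ → ℤ × ℤ)
    (hm : ∀ v, m v = (A.1 0 0 * v.1 + A.1 0 1 * v.2, A.1 1 0 * v.1 + A.1 1 1 * v.2)) :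
    Y.IsEll (m x₁) (m x₂) (m y₁) (m y₂) := by
  have hdet : A.1 0 0 * A.1 1 1 - A.1 0 1 * A.1 1 0 = 1 := by
    rw [← Matrix.det_fin_two]; exact A.2
  have hw : ∀ v w, wedge (m v) (m w) = wedge v w := fun v w => by
    simp only [wedge, hm]
    linear_combination (v.1 * w.2 - v.2 * w.1) * hdet
  obtain ⟨h1, h2, h3, f, hf, hS⟩ := hX
  obtain ⟨g, hg, hg'⟩ := h
  refine ⟨by rwa [hw], by rwa [hw], by rwa [hw], f.trans g, fun k s hs t ht => ?_, ?_⟩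
  · have e1 : sideX (m x₁) (m x₂) k = m (sideX x₁ x₂ k) := by
      rcases fin_three_cases k with rfl | rfl | rfl <;> rfl
    have e2 : sideY (m y₁) (m y₂) k = m (sideY y₁ y₂ k) := by
      rcases fin_three_cases k with rfl | rfl | rfl <;> rfl
    rw [Homeomorph.trans_apply, hg, hf k s hs t ht, torusMap_toTorus, e1, e2, hm, hm]
    congr 1
    push_cast
    ext <;> dsimp only <;> ring
  · ext R
    have h4 := hg' (g.symm R)
    rw [g.apply_symm_apply] at h4
    rw [Sing, mem_ofPred_eq, h4, Homeomorph.trans_apply, mem_singleton_iff, ← g.symm_apply_eq]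
    exact Set.ext_iff.1 hS (g.symm R)

/-! ### Existence of L-shaped tilings -/

lemma proj_of_row (X : Origami Q) {B : Set Q} [Finite Q] (hB : X.IsRowBase B)
    {f : hB.merge.Surface ≃ₜ X.Surface}
    (hf : ∀ b, ∀ x ∈ Icc (0 : ℝ) 1, ∀ y ∈ Icc (0 : ℝ) 1,
      f (hB.merge.pt b x y) = X.col b x (y * IsRowBase.height X B b))
    (b : B) (x : ℝ) {y : ℝ} (hy : y ∈ Icc (0 : ℝ) 1) :
    X.proj (f (hB.merge.row b x y)) = toTorus (x, y * IsRowBase.height X B b) := by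
  have hh : ∀ k : ℤ, IsRowBase.height X B ((hB.rightMap ^ k) b) = IsRowBase.height X B b := by
    have hn : ∀ (n : ℕ) (b : B),
        IsRowBase.height X B ((hB.rightMap ^ n) b) = IsRowBase.height X B b := by
      intro n
      induction n with
      | zero => exact fun b => rfl
      | succ n ih => exact fun b => (ih _).trans (hB.height_right b)
    intro k
    obtain ⟨i, -, hi⟩ := zpow_apply_mod (r := hB.rightMap) (q := b) (orderOf_pos hB.rightMap)
      (by rw [zpow_natCast, pow_orderOf_eq_one]; rfl) k
    rw [← hi, zpow_natCast, hn]
  rw [row, hf _ _ (fract_mem_Icc x) _ hy, X.proj_col _ _ (fract_mem_Icc x)]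
  change toTorus (_, y * (IsRowBase.height X B ((hB.rightMap ^ ⌊x⌋) b) : ℝ)) = _
  rw [hh, ← toTorus_add_int _ ⌊x⌋ 0]
  simp

/-- An origami in `H(2)` with two horizontal cylinders has an L-shaped tiling. -/
lemma exists_isEll_of_two_cylinders [Finite Q] (X : Origami Q) {P : X.Surface} (hP : X.mult P = 3)
    (hS : X.Sing = {P})
    (hne : ∃ b b', ∀ k : ℤ, ((X.hasCommutatorSupport hP hS).isRowBase.rightMap ^ k) b ≠ b') :
    ∃ x₁ x₂ y₁ y₂, X.IsEll x₁ x₂ y₁ y₂ := by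
  have hV := X.hasCommutatorSupport hP hS
  set V := {q | X.point q 0 0 = P} with hVdef
  have hB := hV.isRowBase
  obtain ⟨g, hg⟩ := hB.exists_homeo_merge
  have hVB : V ⊆ X.rowHull V := fun q hq => ⟨0, hq⟩
  obtain ⟨q₁, hq₁, q₂, q₃, a, w, t₁, t₂, h⟩ := (hB.merge_support hV hVB).exists_isTwoRow
    (fun b => by
      obtain ⟨k, hk⟩ := b.2
      refine ⟨k, ?_⟩
      change ((hB.rightMap ^ k) b : Q) ∈ V
      rwa [hB.coe_rightMap_zpow]) hne
  obtain ⟨f, hf⟩ := h.exists_homeo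
  have ha : (0 : ℤ) < a := by exact_mod_cast h.a_pos
  have hw : (0 : ℤ) < w := by exact_mod_cast h.w_pos
  have hh : ∀ b, (0 : ℤ) < IsRowBase.height X (X.rowHull V) b := fun b => by
    exact_mod_cast IsRowBase.height_pos (X := X) b
  refine ⟨(w, 0), (a, 0), (t₂, IsRowBase.height X (X.rowHull V) q₁),
    (t₁, IsRowBase.height X (X.rowHull V) q₃), ?_, ?_, ?_, f.trans g, ?_, ?_⟩
  · simpa [wedge] using mul_pos hw (hh q₁)
  · simpa [wedge] using mul_pos hw (hh q₃)
  · simpa [wedge] using mul_pos ha (hh q₁)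
  · intro k s hs t ht
    obtain ⟨h0, h1, h2⟩ := hf s hs t ht
    rw [Homeomorph.trans_apply]
    rcases fin_three_cases k with rfl | rfl | rfl
    · rw [h0, X.proj_of_row hB hg _ _ ht]
      simp [sideX, sideY, mul_comm]
    · rw [h1, X.proj_of_row hB hg _ _ ht]
      rw [← toTorus_add_int (_, _) (-a) 0]
      simp only [sideX, sideY]
      congr 2 <;> simp
      ring
    · rw [h2, X.proj_of_row hB hg _ _ ht]
      simp [sideX, sideY, mul_comm]
  · obtain ⟨-, -, h2⟩ := hf 0 (by simp) 0 (by simp)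
    rw [hS, ← ell_pt_two_zero_zero, Homeomorph.trans_apply, h2, mul_zero, zero_mul, add_zero,
      hB.merge.row_eq_pt _ _ (by simp), hg _ _ (by simp) _ (by simp), zero_mul,
      X.col_eq_pt _ _ (by simp), pt_zero_zero]
    exact congrArg _ (show X.point q₁ 0 0 = P from hq₁).symm

/-- Every reduced origami in `H(2)` has an L-shaped tiling: if there is only one horizontal
cylinder, it is made of a single row, and then some direction has a cylinder of circumference `1`
and thus at least two cylinders. -/
lemma exists_isEll [Finite Q] (X : Origami Q) (hX : X.IsReduced) (hH : X.InH2) :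
    ∃ x₁ x₂ y₁ y₂, X.IsEll x₁ x₂ y₁ y₂ := by
  obtain ⟨P, hP, hS⟩ := id hH
  by_cases hne : ∃ b b', ∀ k : ℤ, ((X.hasCommutatorSupport hP hS).isRowBase.rightMap ^ k) b ≠ b'
  · exact X.exists_isEll_of_two_cylinders hP hS hne
  -- the origami has a single horizontal cylinder, whose height is `1` since it is reduced
  push Not at hne
  have hV := X.hasCommutatorSupport hP hS
  have hB := hV.isRowBase
  have hVne : {q | X.point q 0 0 = P}.Nonempty :=
    nonempty_of_ncard_ne_zero (by rw [hV.ncard_eq]; norm_num)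
  obtain ⟨q₀, hq₀⟩ := hVne
  let b₀ : X.rowHull {q | X.point q 0 0 = P} := ⟨q₀, 0, hq₀⟩
  obtain ⟨g, hg⟩ := hB.exists_homeo_merge
  have hheight : ∀ b, IsRowBase.height X (X.rowHull {q | X.point q 0 0 = P}) b =
      IsRowBase.height X (X.rowHull {q | X.point q 0 0 = P}) b₀ := by
    intro b
    obtain ⟨k, rfl⟩ := hne b₀ b
    obtain ⟨i, -, hi⟩ := zpow_apply_mod (r := hB.rightMap) (q := b₀) (orderOf_pos hB.rightMap)
      (by rw [zpow_natCast, pow_orderOf_eq_one]; rfl) k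
    rw [← hi, zpow_natCast]
    clear hi
    induction i with
    | zero => rfl
    | succ n ih => rw [pow_succ', Equiv.Perm.mul_apply, hB.height_right, ih]
  have hone : IsRowBase.height X (X.rowHull {q | X.point q 0 0 = P}) b₀ = 1 := by
    have := dvd_of_isTiling hX hS (K := hB.merge) (x := fun _ => (1, 0))
      (y := fun b => (0, IsRowBase.height X (X.rowHull {q | X.point q 0 0 = P}) b)) (fun _ => rfl)
      (fun b => by rw [hheight, hheight b]) (f := g)
      (fun b s hs t ht => by
        rw [hg b s hs t ht, X.proj_col _ _ hs]
        simp) (p := IsRowBase.height X (X.rowHull {q | X.point q 0 0 = P}) b₀)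
      (IsRowBase.height_pos b₀) (α := 0) (β := 1)
      (fun _ => by simp) (fun b => by simp [hheight b])
    exact Nat.dvd_one.1 (Int.natCast_dvd_natCast.1 (by exact_mod_cast this.2))
  have hall : ∀ q, q ∈ X.rowHull {q | X.point q 0 0 = P} := by
    intro q
    have h1 := hB.depth_lt q
    have h2 := hB.up_depth q
    rw [hheight, hone, Nat.lt_one_iff] at h1
    rw [h1] at h2
    exact h2 ▸ (hB.foot q).2
  have htrans : ∀ q q' : Q, ∃ k : ℤ, (X.right ^ k) q = q' := by
    intro q q'
    obtain ⟨k, hk⟩ := hne ⟨q, hall q⟩ ⟨q', hall q'⟩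
    exact ⟨k, by rw [← hB.coe_rightMap_zpow ⟨q, hall q⟩, hk]⟩
  -- some surface in the orbit then has a row consisting of a single square
  obtain ⟨k, hk⟩ := htrans (X.up⁻¹ q₀) q₀
  obtain ⟨i, -, hi⟩ := zpow_apply_mod (r := X.right) (q := X.up⁻¹ q₀) (orderOf_pos X.right)
    (by rw [zpow_natCast, pow_orderOf_eq_one]; rfl) k
  rw [hk, zpow_natCast] at hi
  have hshear : ∀ n : ℕ, ∃ A Y, Rel A X Y ∧ Y.right = X.right ∧ Y.up = X.up * (X.right⁻¹) ^ n := by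
    intro n
    induction n with
    | zero => exact ⟨1, X, Rel.one X, rfl, by simp⟩
    | succ n ih =>
      obtain ⟨A, Y, hY, h1, h2⟩ := ih
      exact ⟨_, Y.shear, hY.mul Y.rel_shear, h1, by
        change Y.up * Y.right⁻¹ = _
        rw [h1, h2, pow_succ, mul_assoc]⟩
  obtain ⟨A, Y, hY, -, hYu⟩ := hshear i
  have hYq : Y.up q₀ = q₀ := by
    rw [hYu, Equiv.Perm.mul_apply, inv_pow, Equiv.Perm.inv_eq_iff_eq.2 hi.symm, perm_apply_inv]
  have hZ := hY.mul Y.rel_turn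
  set Z := Y.turn
  have hZq : Z.right q₀ = q₀ := Equiv.Perm.inv_eq_iff_eq.2 hYq.symm
  obtain ⟨P', hP', hS'⟩ := hH.of_rel hZ
  have hV' := Z.hasCommutatorSupport hP' hS'
  have hB' := hV'.isRowBase
  by_cases hne' : ∃ b b', ∀ k : ℤ, (hB'.rightMap ^ k) b ≠ b'
  · obtain ⟨x₁, x₂, y₁, y₂, h⟩ := Z.exists_isEll_of_two_cylinders hP' hS' hne'
    exact ⟨_, _, _, _, h.of_rel hZ.inv _ fun v => rfl⟩
  · exfalso
    push Not at hne'
    have hfix : hB'.rightMap (hB'.foot q₀) = hB'.foot q₀ := by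
      have := (hB'.foot_right q₀).1
      rw [hZq] at this
      exact this.symm
    have hcard : {q | Z.point q 0 0 = P'}.ncard ≤ 1 := by
      refine (ncard_le_one_iff (toFinite _)).2 fun {x y} hx hy => ?_
      have key : ∀ x, Z.point x 0 0 = P' → x = hB'.foot q₀ := by
        intro x hx
        obtain ⟨k, hk⟩ := hne' (hB'.foot q₀) ⟨x, 0, hx⟩
        rw [show (hB'.rightMap ^ k) (hB'.foot q₀) = hB'.foot q₀ from
          Function.IsFixedPt.perm_zpow hfix k] at hk
        rw [hk]
      rw [key x hx, key y hy]
    rw [hV'.ncard_eq] at hcard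
    omega

variable {κ : Type*}

/-! ### Dehn twists in a vertical cylinder -/

section twist

variable (K : Origami κ) (b : κ) {N : ℕ} (F F' : ℝ ≃o ℝ) (ε : ℤ)

/-- The twist on the vertical strip through the tile `b`. If `F` and `F'` measure the position on
the left side of the strip, transversally to the old and to the new horizontal direction, then the
point at distance `s` from the left side on the new horizontal segment starting at the height `t`
lies on the old horizontal segment starting at the height `F⁻¹ (F t + ε s)`. -/
noncomputable def twistStrip (s t : ℝ) : K.Surface :=
  K.col b (ε * (F' (F.symm (F t + ε * s)) - F' t)) (F.symm (F t + ε * s))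

variable {K b F F' ε}

lemma col_add_period (hN : (K.up ^ (N : ℤ)) b = b) (x t : ℝ) (n : ℤ) :
    K.col b x (t + n * N) = K.col b x t := by
  have := K.col_add_int b x t (n * N)
  push_cast at this
  rw [this, mul_comm, zpow_mul, show ((K.up ^ (N : ℤ)) ^ n) b = b from
    Function.IsFixedPt.perm_zpow hN n]

lemma iso_symm_add {N : ℝ} (hF : ∀ t (n : ℤ), F (t + n * N) = F t + n) (t : ℝ) (n : ℤ) :
    F.symm (t + n) = F.symm t + n * N := by
  rw [OrderIso.symm_apply_eq, hF, OrderIso.apply_symm_apply]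

lemma twistStrip_zero (t : ℝ) : K.twistStrip b F F' ε 0 t = K.col b 0 t := by
  simp [twistStrip]

lemma twistStrip_one (hN : (K.up ^ (N : ℤ)) b = b) (hF : ∀ t (n : ℤ), F (t + n * N) = F t + n)
    (hF' : ∀ t (n : ℤ), F' (t + n * N) = F' t + n) (hε : ε * ε = 1) (t : ℝ) :
    K.twistStrip b F F' ε 1 t = K.col b 1 t := by
  have h2 : (ε : ℝ) * ε = 1 := by exact_mod_cast hε
  rw [twistStrip, mul_one, iso_symm_add hF, OrderIso.symm_apply_apply, col_add_period hN, hF',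
    add_sub_cancel_left, h2]

lemma twistStrip_add_period (hN : (K.up ^ (N : ℤ)) b = b)
    (hF : ∀ t (n : ℤ), F (t + n * N) = F t + n) (hF' : ∀ t (n : ℤ), F' (t + n * N) = F' t + n)
    (s t : ℝ) (n : ℤ) : K.twistStrip b F F' ε s (t + n * N) = K.twistStrip b F F' ε s t := by
  rw [twistStrip, hF, add_right_comm, iso_symm_add hF, hF', hF', col_add_period hN, twistStrip]
  congr 2; ring

open Classical in
/-- The twist of the column of `b`, on the tile `k`; it is the identity outside the column. -/
noncomputable def twistTile (K : Origami κ) (b : κ) (F F' : ℝ ≃o ℝ) (ε : ℤ) (k : κ) (s t : ℝ) :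
    K.Surface :=
  if h : ∃ n : ℤ, (K.up ^ n) b = k then K.twistStrip b F F' ε s (h.choose + t) else K.pt k s t

lemma twistTile_up (hN : ∀ n : ℤ, (K.up ^ n) b = b ↔ (N : ℤ) ∣ n)
    (hF : ∀ t (n : ℤ), F (t + n * N) = F t + n) (hF' : ∀ t (n : ℤ), F' (t + n * N) = F' t + n)
    (n : ℤ) (s t : ℝ) :
    K.twistTile b F F' ε ((K.up ^ n) b) s t = K.twistStrip b F F' ε s (n + t) := by
  have h : ∃ m : ℤ, (K.up ^ m) b = (K.up ^ n) b := ⟨n, rfl⟩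
  have h1 : (K.up ^ (h.choose - n)) b = b := by
    rw [sub_eq_neg_add, zpow_add, Equiv.Perm.mul_apply, h.choose_spec, zpow_neg, perm_inv_apply]
  obtain ⟨c, hc⟩ := (hN _).1 h1
  rw [twistTile, dif_pos h, ← twistStrip_add_period ((hN _).2 dvd_rfl) hF hF' s (n + t) c]
  congr 1
  have hc' : (h.choose : ℝ) - n = N * c := by exact_mod_cast hc
  linarith

lemma twistTile_of_not {k : κ} (hk : ¬ ∃ n : ℤ, (K.up ^ n) b = k) (s t : ℝ) :
    K.twistTile b F F' ε k s t = K.pt k s t := dif_neg hk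

lemma col_int_add (n : ℤ) (s : ℝ) {t : ℝ} (ht : t ∈ Icc (0 : ℝ) 1) :
    K.col b s (n + t) = K.pt ((K.up ^ n) b) s t := by
  rw [add_comm, K.col_add_int, K.col_eq_pt _ _ ht]

/-- A Dehn twist in the vertical cylinder through the tile `b`, which consists of `N` tiles. -/
lemma exists_twist (hN : ∀ n : ℤ, (K.up ^ n) b = b ↔ (N : ℤ) ∣ n)
    (hF : ∀ t (n : ℤ), F (t + n * N) = F t + n) (hF' : ∀ t (n : ℤ), F' (t + n * N) = F' t + n)
    (hε : ε * ε = 1) : ∃ f : K.Surface ≃ₜ K.Surface, ∀ k, ∀ s ∈ Icc (0 : ℝ) 1,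
      ∀ t ∈ Icc (0 : ℝ) 1, f (K.pt k s t) = K.twistTile b F F' ε k s t := by
  have hε2 : (ε : ℝ) * ε = 1 := by exact_mod_cast hε
  have hNb : (K.up ^ (N : ℤ)) b = b := (hN _).2 dvd_rfl
  -- the construction is carried out for the twist and for its inverse simultaneously
  have key : ∀ (F F' : ℝ ≃o ℝ) (ε : ℤ), (∀ t (n : ℤ), F (t + n * N) = F t + n) →
      (∀ t (n : ℤ), F' (t + n * N) = F' t + n) → ε * ε = 1 → ∃ f : K.Surface → K.Surface,
      Continuous f ∧ (∀ k, ∀ s ∈ Icc (0 : ℝ) 1, ∀ t ∈ Icc (0 : ℝ) 1,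
        f (K.pt k s t) = K.twistTile b F F' ε k s t) ∧
      ∀ s ∈ Icc (0 : ℝ) 1, ∀ t, f (K.col b s t) = K.twistStrip b F F' ε s t := by
    intro F F' ε hF hF' hε
    have h0 : ∀ k, ∀ t ∈ Icc (0 : ℝ) 1, K.twistTile b F F' ε k 0 t = K.pt k 0 t := by
      intro k t ht
      by_cases hk : ∃ n : ℤ, (K.up ^ n) b = k
      · obtain ⟨n, rfl⟩ := hk
        rw [twistTile_up hN hF hF', twistStrip_zero, col_int_add n 0 ht]
      · rw [twistTile_of_not hk]
    have h1 : ∀ k, ∀ t ∈ Icc (0 : ℝ) 1, K.twistTile b F F' ε k 1 t = K.pt k 1 t := by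
      intro k t ht
      by_cases hk : ∃ n : ℤ, (K.up ^ n) b = k
      · obtain ⟨n, rfl⟩ := hk
        rw [twistTile_up hN hF hF', twistStrip_one hNb hF hF' hε, col_int_add n 1 ht]
      · rw [twistTile_of_not hk]
    let f : K.Surface → K.Surface := K.desc (K.twistTile b F F' ε)
      (fun k t ht => by rw [h0 _ t ht, h1 _ t ht, K.pt_side])
      (fun k s _ => by
        by_cases hk : ∃ n : ℤ, (K.up ^ n) b = k
        · obtain ⟨n, rfl⟩ := hk
          have : K.up ((K.up ^ n) b) = (K.up ^ (n + 1)) b := by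
            rw [add_comm, zpow_add, zpow_one, Equiv.Perm.mul_apply]
          rw [this, twistTile_up hN hF hF', twistTile_up hN hF hF']
          push_cast
          rw [add_zero]
        · have hk' : ¬ ∃ n : ℤ, (K.up ^ n) b = K.up k := by
            rintro ⟨n, hn⟩
            refine hk ⟨-1 + n, ?_⟩
            rw [zpow_add, Equiv.Perm.mul_apply, hn, zpow_neg_one, perm_inv_apply]
          rw [twistTile_of_not hk, twistTile_of_not hk', K.pt_top])
    have hf : ∀ k, ∀ s ∈ Icc (0 : ℝ) 1, ∀ t ∈ Icc (0 : ℝ) 1,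
        f (K.pt k s t) = K.twistTile b F F' ε k s t := fun k s hs t ht => K.desc_pt k hs ht
    refine ⟨f, K.continuous_desc fun k => ?_, hf, fun s hs t => ?_⟩
    · by_cases hk : ∃ n : ℤ, (K.up ^ n) b = k
      · obtain ⟨n, rfl⟩ := hk
        simp only [twistTile_up hN hF hF', twistStrip]
        have hc : Continuous F := F.toHomeomorph.continuous
        have hc' : Continuous F' := F'.toHomeomorph.continuous
        have hcs : Continuous F.symm := F.toHomeomorph.symm.continuous
        refine (K.continuous_col b).comp (Continuous.prodMk ?_ ?_) <;> fun_prop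
      · simp only [twistTile_of_not hk]
        exact K.continuous_pt k
    · rw [col, hf _ s hs _ (fract_mem_Icc t), twistTile_up hN hF hF', Int.floor_add_fract]
  have hinv : ∀ (F F' : ℝ ≃o ℝ) (ε : ℤ) (f g : K.Surface → K.Surface),
      (∀ t (n : ℤ), F (t + n * N) = F t + n) → (∀ t (n : ℤ), F' (t + n * N) = F' t + n) →
      (ε = 1 ∨ ε = -1) →
      (∀ k, ∀ s ∈ Icc (0 : ℝ) 1, ∀ t ∈ Icc (0 : ℝ) 1,
        f (K.pt k s t) = K.twistTile b F F' ε k s t) →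
      (∀ k, ∀ s ∈ Icc (0 : ℝ) 1, ∀ t ∈ Icc (0 : ℝ) 1,
        g (K.pt k s t) = K.twistTile b F' F (-ε) k s t) →
      (∀ s ∈ Icc (0 : ℝ) 1, ∀ t, g (K.col b s t) = K.twistStrip b F' F (-ε) s t) →
      ∀ k, ∀ s ∈ Icc (0 : ℝ) 1, ∀ t ∈ Icc (0 : ℝ) 1, g (f (K.pt k s t)) = K.pt k s t := by
    intro F F' ε f g hF hF' hε hf hg hg' k s hs t ht
    rw [hf k s hs t ht]
    by_cases hk : ∃ n : ℤ, (K.up ^ n) b = k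
    · obtain ⟨n, rfl⟩ := hk
      rw [twistTile_up hN hF hF', twistStrip]
      set T := (n : ℝ) + t
      set T' := F.symm (F T + ε * s) with hT'
      have hε2 : (ε : ℝ) * ε = 1 := by rcases hε with rfl | rfl <;> norm_num
      have hFT : F T' = F T + ε * s := by rw [hT', OrderIso.apply_symm_apply]
      have hs' : ε * (F' T' - F' T) ∈ Icc (0 : ℝ) 1 := by
        rcases hε with rfl | rfl
        · have h1 : T ≤ T' := F.le_iff_le.1 (by rw [hFT]; push_cast; linarith [hs.1])
          have h2 : T' ≤ T + (1 : ℤ) * N :=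
            F.le_iff_le.1 (by rw [hFT, hF]; push_cast; linarith [hs.2])
          have h3 := F'.le_iff_le.2 h1
          have h4 := F'.le_iff_le.2 h2
          rw [hF'] at h4
          push_cast at h4 ⊢
          constructor <;> linarith
        · have h1 : T' ≤ T := F.le_iff_le.1 (by rw [hFT]; push_cast; linarith [hs.1])
          have h2 : T + (-1 : ℤ) * N ≤ T' :=
            F.le_iff_le.1 (by rw [hFT, hF]; push_cast; linarith [hs.2])
          have h3 := F'.le_iff_le.2 h1
          have h4 := F'.le_iff_le.2 h2
          rw [hF'] at h4
          push_cast at h4 ⊢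
          constructor <;> linarith
      have hback : F'.symm (F' T' + ((-ε : ℤ) : ℝ) * (ε * (F' T' - F' T))) = T := by
        rw [OrderIso.symm_apply_eq]
        push_cast
        linear_combination (-(F' T' - F' T)) * hε2
      rw [hg' _ hs', twistStrip, hback, hFT, ← col_int_add n s ht]
      congr 1
      push_cast
      linear_combination s * hε2
    · rw [twistTile_of_not hk, hg k s hs t ht, twistTile_of_not hk]
  have hε' : ε = 1 ∨ ε = -1 := Int.isUnit_iff.1 (IsUnit.of_mul_eq_one _ hε)
  obtain ⟨f, hfc, hf, hf'⟩ := key F F' ε hF hF' hε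
  obtain ⟨g, hgc, hg, hg'⟩ := key F' F (-ε) hF' hF (by rwa [neg_mul_neg])
  refine ⟨homeoOfInverse f g hfc hgc (hinv F F' ε f g hF hF' hε' hf hg hg') ?_, hf⟩
  have hε'' : -ε = 1 ∨ -ε = -1 := by rcases hε' with rfl | rfl <;> simp
  exact hinv F' F (-ε) g f hF' hF hε'' hg (by rwa [neg_neg]) (by rwa [neg_neg])

end twist

/-- A Dehn twist changes the horizontal sides of the tiles in a column by the holonomy of the core
curve of the column. Here `ζ` is the development of the left side of the column. -/
lemma IsTiling.twist {X : Origami Q} {K : Origami κ} {x y x' : κ → ℤ × ℤ}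
    {f : K.Surface ≃ₜ X.Surface} (hf : X.IsTiling K x y f) {b : κ} {N : ℕ} {F F' : ℝ ≃o ℝ} {ε : ℤ}
    (hN : ∀ n : ℤ, (K.up ^ n) b = b ↔ (N : ℤ) ∣ n) (hF : ∀ t (n : ℤ), F (t + n * N) = F t + n)
    (hF' : ∀ t (n : ℤ), F' (t + n * N) = F' t + n) (hε : ε * ε = 1) {v v' : ℤ × ℤ}
    {ζ₁ ζ₂ : ℝ → ℝ} (hζ : ∀ n : ℤ, ∃ m : ℤ × ℤ, ∀ t ∈ Icc (0 : ℝ) 1,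
      ζ₁ (n + t) = m.1 + t * (y ((K.up ^ n) b)).1 ∧ ζ₂ (n + t) = m.2 + t * (y ((K.up ^ n) b)).2)
    {c : ℝ} (hc : c ≠ 0) (hcv : wedge v v' = ε * c) (hvF : ∀ t, v.1 * ζ₂ t - v.2 * ζ₁ t = c * F t)
    (hvF' : ∀ t, v'.1 * ζ₂ t - v'.2 * ζ₁ t = c * F' t)
    (hx : ∀ n : ℤ, x ((K.up ^ n) b) = v) (hx' : ∀ n : ℤ, x' ((K.up ^ n) b) = v')
    (hxx : ∀ k, (¬ ∃ n : ℤ, (K.up ^ n) b = k) → x' k = x k) {P : K.Surface}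
    (hP : ∃ k, P = K.pt k 0 0) :
    ∃ g : K.Surface ≃ₜ X.Surface, X.IsTiling K x' y g ∧ g P = f P := by
  obtain ⟨h, hh⟩ := K.exists_twist hN hF hF' hε
  have hε2 : (ε : ℝ) * ε = 1 := by exact_mod_cast hε
  have hε' : ε = 1 ∨ ε = -1 := Int.isUnit_iff.1 (IsUnit.of_mul_eq_one _ hε)
  refine ⟨h.trans f, fun k s hs t ht => ?_, ?_⟩
  · rw [Homeomorph.trans_apply, hh k s hs t ht]
    by_cases hk : ∃ n : ℤ, (K.up ^ n) b = k
    · obtain ⟨n, rfl⟩ := hk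
      rw [twistTile_up hN hF hF', twistStrip]
      set T := (n : ℝ) + t with hT
      set T' := F.symm (F T + ε * s) with hT'
      have hFT : F T' = F T + ε * s := by rw [hT', OrderIso.apply_symm_apply]
      set σ := ε * (F' T' - F' T) with hσ
      have hs' : σ ∈ Icc (0 : ℝ) 1 := by
        rcases hε' with rfl | rfl
        · have h1 : T ≤ T' := F.le_iff_le.1 (by rw [hFT]; push_cast; linarith [hs.1])
          have h2 : T' ≤ T + (1 : ℤ) * N :=
            F.le_iff_le.1 (by rw [hFT, hF]; push_cast; linarith [hs.2])
          have h3 := F'.le_iff_le.2 h1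
          have h4 := F'.le_iff_le.2 h2
          rw [hF'] at h4
          push_cast at h4 hσ
          constructor <;> linarith
        · have h1 : T' ≤ T := F.le_iff_le.1 (by rw [hFT]; push_cast; linarith [hs.1])
          have h2 : T + (-1 : ℤ) * N ≤ T' :=
            F.le_iff_le.1 (by rw [hFT, hF]; push_cast; linarith [hs.2])
          have h3 := F'.le_iff_le.2 h1
          have h4 := F'.le_iff_le.2 h2
          rw [hF'] at h4
          push_cast at h4 hσ
          constructor <;> linarith
      obtain ⟨m, hm⟩ := hζ n
      obtain ⟨m', hm'⟩ := hζ ⌊T'⌋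
      obtain ⟨e1, e2⟩ := hm t ht
      obtain ⟨e1', e2'⟩ := hm' _ (fract_mem_Icc T')
      rw [Int.floor_add_fract] at e1' e2'
      rw [← hT] at e1 e2
      -- the two developments of the point agree: their difference is killed by two determinants
      have hcv' : (v.1 * v'.2 - v.2 * v'.1 : ℝ) = ε * c := by
        rw [← hcv]; simp [wedge]
      have w1 : v.1 * (σ * v.2 + ζ₂ T' - s * v'.2 - ζ₂ T)
          - v.2 * (σ * v.1 + ζ₁ T' - s * v'.1 - ζ₁ T) = 0 := by
        linear_combination hvF T' - hvF T - s * hcv' + c * hFT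
      have w2 : v'.1 * (σ * v.2 + ζ₂ T' - s * v'.2 - ζ₂ T)
          - v'.2 * (σ * v.1 + ζ₁ T' - s * v'.1 - ζ₁ T) = 0 := by
        linear_combination hvF' T' - hvF' T - σ * hcv' - ε * c * hσ
          - c * (F' T' - F' T) * hε2
      have hne : (ε : ℝ) * c ≠ 0 := mul_ne_zero (by rcases hε' with rfl | rfl <;> norm_num) hc
      have z1 : σ * v.1 + ζ₁ T' - s * v'.1 - ζ₁ T = 0 := by
        apply mul_left_cancel₀ hne
        linear_combination v'.1 * w1 - v.1 * w2 - (σ * v.1 + ζ₁ T' - s * v'.1 - ζ₁ T) * hcv'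
      have z2 : σ * v.2 + ζ₂ T' - s * v'.2 - ζ₂ T = 0 := by
        apply mul_left_cancel₀ hne
        linear_combination v'.2 * w1 - v.2 * w2 - (σ * v.2 + ζ₂ T' - s * v'.2 - ζ₂ T) * hcv'
      rw [col, hf _ _ hs' _ (fract_mem_Icc T'), hx, hx', ← toTorus_add_int _ m'.1 m'.2,
        ← toTorus_add_int (_ + _ * _, _) m.1 m.2]
      congr 2 <;> dsimp only <;> linarith
    · rw [twistTile_of_not hk, hf k s hs t ht, hxx k hk]
  · obtain ⟨k, rfl⟩ := hP
    rw [Homeomorph.trans_apply, hh k 0 (by simp) 0 (by simp)]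
    by_cases hk : ∃ n : ℤ, (K.up ^ n) b = k
    · obtain ⟨n, rfl⟩ := hk
      rw [twistTile_up hN hF hF', twistStrip_zero, col_int_add n 0 (by simp)]
    · rw [twistTile_of_not hk]

/-! ### The reflection in the diagonal -/

/-- The surface reflected in the diagonal. -/
def transpose (X : Origami Q) : Origami Q where
  right := X.up
  up := X.right
  connected := by
    rw [Set.pair_comm]
    exact X.connected

/-- Relabelling the squares and exchanging the two coordinates. -/
lemma exists_flip {Q' : Type*} (X : Origami Q) (Y : Origami Q') (σ : Q ≃ Q')
    (h1 : ∀ q, σ (X.right q) = Y.up (σ q)) (h2 : ∀ q, σ (X.up q) = Y.right (σ q)) :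
    ∃ f : X.Surface ≃ₜ Y.Surface, ∀ q, ∀ x ∈ Icc (0 : ℝ) 1, ∀ y ∈ Icc (0 : ℝ) 1,
      f (X.pt q x y) = Y.pt (σ q) y x := by
  have h1' : ∀ q, σ.symm (Y.up q) = X.right (σ.symm q) := fun q => by
    rw [σ.symm_apply_eq, h1, σ.apply_symm_apply]
  have h2' : ∀ q, σ.symm (Y.right q) = X.up (σ.symm q) := fun q => by
    rw [σ.symm_apply_eq, h2, σ.apply_symm_apply]
  let f : X.Surface → Y.Surface := X.desc (fun q x y => Y.pt (σ q) y x)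
    (fun q y _ => by rw [h1, Y.pt_top]) (fun q x _ => by rw [h2, Y.pt_side])
  let g : Y.Surface → X.Surface := Y.desc (fun q x y => X.pt (σ.symm q) y x)
    (fun q y _ => by rw [h2', X.pt_top]) (fun q x _ => by rw [h1', X.pt_side])
  have hf : ∀ q, ∀ x ∈ Icc (0 : ℝ) 1, ∀ y ∈ Icc (0 : ℝ) 1, f (X.pt q x y) = Y.pt (σ q) y x :=
    fun q x hx y hy => X.desc_pt q hx hy
  have hg : ∀ q, ∀ x ∈ Icc (0 : ℝ) 1, ∀ y ∈ Icc (0 : ℝ) 1, g (Y.pt q x y) = X.pt (σ.symm q) y x :=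
    fun q x hx y hy => Y.desc_pt q hx hy
  refine ⟨homeoOfInverse f g
    (X.continuous_desc fun q => (Y.continuous_pt _).comp continuous_swap)
    (Y.continuous_desc fun q => (X.continuous_pt _).comp continuous_swap)
    (fun q x hx y hy => ?_) (fun q x hx y hy => ?_), hf⟩
  · rw [hf q x hx y hy, hg _ y hy x hx, σ.symm_apply_apply]
  · rw [hg q x hx y hy, hf _ y hy x hx, σ.apply_symm_apply]

/-- The reflection of an L-shaped tiling. -/
lemma IsEll.transpose {X : Origami Q} {x₁ x₂ y₁ y₂ : ℤ × ℤ} (h : X.IsEll x₁ x₂ y₁ y₂) :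
    X.transpose.IsEll y₁.swap y₂.swap x₁.swap x₂.swap := by
  have hw : ∀ v w : ℤ × ℤ, wedge v.swap w.swap = wedge w v := fun v w => by
    simp only [wedge, Prod.fst_swap, Prod.snd_swap]; ring
  obtain ⟨hB, hA, hC, f, hf, hS⟩ := h
  obtain ⟨T, hT⟩ := X.exists_flip X.transpose (Equiv.refl Q) (fun _ => rfl) fun _ => rfl
  obtain ⟨S, hSe⟩ := ell.exists_flip ell (Equiv.swap 0 2) (by decide) (by decide)
  have hTp : ∀ P, X.transpose.proj (T P) = (X.proj P).swap := by
    intro P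
    obtain ⟨q, x, hx, y, hy, rfl⟩ := X.exists_pt P
    rw [hT q x hx y hy, proj_pt _ _ hy hx, proj_pt _ _ hx hy]
    rfl
  have hTm : ∀ P, X.transpose.mult (T P) = X.mult P := by
    intro P
    unfold mult
    congr 1
    ext q
    have h0 : X.transpose.point q 0 0 = T (X.point q 0 0) := by
      rw [← pt_zero_zero, ← pt_zero_zero, hT q 0 (by simp) 0 (by simp)]
      rfl
    rw [mem_ofPred_eq, mem_ofPred_eq, h0, T.injective.eq_iff]
  refine ⟨by rwa [hw], by rwa [hw], by rwa [hw], (S.trans f).trans T, fun k s hs t ht => ?_, ?_⟩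
  · rw [Homeomorph.trans_apply, Homeomorph.trans_apply, hTp, hSe k s hs t ht, hf _ t ht s hs]
    have e1 : sideX y₁.swap y₂.swap k = (sideY y₁ y₂ (Equiv.swap 0 2 k)).swap := by
      rcases fin_three_cases k with rfl | rfl | rfl <;> rfl
    have e2 : sideY x₁.swap x₂.swap k = (sideX x₁ x₂ (Equiv.swap 0 2 k)).swap := by
      rcases fin_three_cases k with rfl | rfl | rfl <;> rfl
    rw [e1, e2]
    simp only [toTorus, Prod.swap, add_comm]
  · ext R
    have h4 := hTm (T.symm R)
    rw [T.apply_symm_apply] at h4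
    rw [Sing, mem_ofPred_eq, h4, Homeomorph.trans_apply, Homeomorph.trans_apply, mem_singleton_iff,
      ← T.symm_apply_eq, hSe 0 0 (by simp) 0 (by simp), Equiv.swap_apply_left, ell_pt_two_zero_zero]
    exact Set.ext_iff.1 hS (T.symm R)

/-! ### Moves between L-shaped tilings -/

lemma ell_up_zpow_two (n : ℤ) : (ell.up ^ n) 2 = 2 :=
  Function.IsFixedPt.perm_zpow (e := ell.up) ell_up_two n

lemma ell_up_zpow_even (n : ℤ) : ell.up ^ (2 * n) = 1 := by
  rw [zpow_mul, show ell.up ^ (2 : ℤ) = 1 by decide, one_zpow]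

lemma ell_up_zpow_odd (n : ℤ) : ell.up ^ (2 * n + 1) = ell.up := by
  rw [zpow_add, ell_up_zpow_even, one_mul, zpow_one]

/-- A Dehn twist in the column of the tile `2`. -/
lemma IsEll.twist_two {X : Origami Q} {x₁ x₂ y₁ y₂ : ℤ × ℤ} (h : X.IsEll x₁ x₂ y₁ y₂) {ε : ℤ}
    (hε : ε * ε = 1) : X.IsEll x₁ (x₂ + ε • y₁) y₁ y₂ := by
  obtain ⟨hB, hA, hC, f, hf, hS⟩ := h
  have hw : wedge (x₂ + ε • y₁) y₁ = wedge x₂ y₁ := by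
    simp only [wedge, Prod.fst_add, Prod.snd_add, Prod.smul_fst, Prod.smul_snd, smul_eq_mul]; ring
  have hc : (wedge x₂ y₁ : ℝ) = x₂.1 * y₁.2 - x₂.2 * y₁.1 := by simp [wedge]
  obtain ⟨g, hg, hgP⟩ := hf.twist (b := 2) (N := 1) (F := OrderIso.refl ℝ) (F' := OrderIso.refl ℝ)
    (x' := sideX x₁ (x₂ + ε • y₁)) (v := x₂) (v' := x₂ + ε • y₁) (P := ell.pt 0 0 0)
    (ζ₁ := fun t => t * y₁.1) (ζ₂ := fun t => t * y₁.2) (c := wedge x₂ y₁)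
    (fun n => by simp [ell_up_zpow_two]) (by simp) (by simp) hε
    (fun n => ⟨(n * y₁.1, n * y₁.2), fun t _ => by
      rw [ell_up_zpow_two]
      simp only [sideY, Matrix.cons_val]
      push_cast
      constructor <;> ring⟩)
    (by exact_mod_cast hC.ne')
    (by
      rw [← Int.cast_mul, Int.cast_inj]
      simp only [wedge, Prod.fst_add, Prod.snd_add, Prod.smul_fst, Prod.smul_snd, smul_eq_mul]; ring)
    (fun t => by rw [hc, OrderIso.refl_apply]; ring)
    (fun t => by
      rw [hc, OrderIso.refl_apply]
      simp only [Prod.fst_add, Prod.snd_add, Prod.smul_fst, Prod.smul_snd, smul_eq_mul]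
      push_cast; ring)
    (fun n => by rw [ell_up_zpow_two]; rfl) (fun n => by rw [ell_up_zpow_two]; rfl)
    (fun k hk => by
      rcases fin_three_cases k with rfl | rfl | rfl
      · rfl
      · rfl
      · exact absurd ⟨0, rfl⟩ hk) ⟨0, rfl⟩
  exact ⟨hB, hA, by rwa [hw], g, hg, by rw [hS, hgP]⟩

/-- A Dehn twist in the column of the tiles `1` and `0`, provided that the new parallelograms are
positively oriented. -/
lemma IsEll.twist_one {X : Origami Q} {x₁ x₂ y₁ y₂ : ℤ × ℤ} (h : X.IsEll x₁ x₂ y₁ y₂)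
    (h1 : 0 < wedge (x₁ + y₁ + y₂) y₁) (h2 : 0 < wedge (x₁ + y₁ + y₂) y₂) :
    X.IsEll (x₁ + y₁ + y₂) x₂ y₁ y₂ := by
  obtain ⟨hB, hA, hC, f, hf, hS⟩ := h
  have hsum : wedge (x₁ + y₁ + y₂) y₁ + wedge (x₁ + y₁ + y₂) y₂ = wedge x₁ y₁ + wedge x₁ y₂ := by
    simp only [wedge, Prod.fst_add, Prod.snd_add]; ring
  set c : ℝ := wedge x₁ y₁ + wedge x₁ y₂ with hc
  have hB' : (0 : ℝ) < wedge x₁ y₁ := by exact_mod_cast hB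
  have hA' : (0 : ℝ) < wedge x₁ y₂ := by exact_mod_cast hA
  have h1' : (0 : ℝ) < wedge (x₁ + y₁ + y₂) y₁ := by exact_mod_cast h1
  have h2' : (0 : ℝ) < wedge (x₁ + y₁ + y₂) y₂ := by exact_mod_cast h2
  have hsum' : (wedge (x₁ + y₁ + y₂) y₁ + wedge (x₁ + y₁ + y₂) y₂ : ℝ) = c := by
    rw [hc]; exact_mod_cast hsum
  have hc0 : 0 < c := add_pos hB' hA'
  have hper : ∀ {p q : ℝ} (hp : 0 < p) (hq : 0 < q), p + q = 1 → ∀ (t : ℝ) (n : ℤ),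
      zigIso hp hq (t + n * (2 : ℕ)) = zigIso hp hq t + n := fun hp hq hpq t n => by
    rw [zigIso_apply, zigIso_apply, mul_comm, Nat.cast_ofNat, zig_add_two_mul_int, hpq, mul_one]
  have hzig : ∀ (v : ℤ × ℤ) (hp : 0 < wedge v y₁ / c) (hq : 0 < wedge v y₂ / c) (t : ℝ),
      (v.1 * zig y₁.2 y₂.2 t - v.2 * zig y₁.1 y₂.1 t : ℝ) = c * zigIso hp hq t := by
    intro v hp hq t
    have e1 : (wedge v y₁ : ℝ) = v.1 * y₁.2 - v.2 * y₁.1 := by simp [wedge]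
    have e2 : (wedge v y₂ : ℝ) = v.1 * y₂.2 - v.2 * y₂.1 := by simp [wedge]
    have e3 : ∀ p q : ℝ, c * zig (p / c) (q / c) t = zig p q t := fun p q => by
      simp only [zig]; field_simp
    rw [zigIso_apply, e3, e1, e2]
    simp only [zig]; ring
  obtain ⟨g, hg, hgP⟩ := hf.twist (b := 1) (N := 2) (ε := 1)
    (F := zigIso (div_pos hB' hc0) (div_pos hA' hc0))
    (F' := zigIso (div_pos h1' hc0) (div_pos h2' hc0))
    (x' := sideX (x₁ + y₁ + y₂) x₂) (v := x₁) (v' := x₁ + y₁ + y₂) (P := ell.pt 0 0 0)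
    (ζ₁ := zig y₁.1 y₂.1) (ζ₂ := zig y₁.2 y₂.2) (c := c)
    (fun n => by
      rcases Int.even_or_odd' n with ⟨m, rfl | rfl⟩
      · simp [ell_up_zpow_even]
      · rw [ell_up_zpow_odd, ell_up_one]
        have : (0 : Fin 3) ≠ 1 := by decide
        simp only [this, false_iff]
        push_cast; omega)
    (hper _ _ (by rw [← add_div, div_self hc0.ne']))
    (hper _ _ (by rw [← add_div, hsum', div_self hc0.ne'])) (by norm_num)
    (fun n => by
      rcases Int.even_or_odd' n with ⟨m, rfl | rfl⟩
      · refine ⟨(m * (y₁.1 + y₂.1), m * (y₁.2 + y₂.2)), fun t ht => ?_⟩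
        rw [ell_up_zpow_even]
        simp only [Equiv.Perm.one_apply, sideY, Matrix.cons_val]
        push_cast
        rw [add_comm, zig_add_two_mul_int, zig_add_two_mul_int, zig_of_mem ht, zig_of_mem ht]
        constructor <;> ring
      · refine ⟨(y₁.1 + m * (y₁.1 + y₂.1), y₁.2 + m * (y₁.2 + y₂.2)), fun t ht => ?_⟩
        rw [ell_up_zpow_odd, ell_up_one]
        simp only [sideY, Matrix.cons_val]
        push_cast
        rw [show (2 * m + 1 + t : ℝ) = 1 + t + 2 * m by ring, zig_add_two_mul_int,
          zig_add_two_mul_int, zig_one_add ht, zig_one_add ht]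
        constructor <;> ring)
    hc0.ne'
    (by
      rw [hc, Int.cast_one, one_mul]
      simp only [wedge, Prod.fst_add, Prod.snd_add]; push_cast; ring)
    (hzig _ _ _) (hzig _ _ _)
    (fun n => by
      rcases Int.even_or_odd' n with ⟨m, rfl | rfl⟩
      · rw [ell_up_zpow_even]; rfl
      · rw [ell_up_zpow_odd, ell_up_one]; rfl)
    (fun n => by
      rcases Int.even_or_odd' n with ⟨m, rfl | rfl⟩
      · rw [ell_up_zpow_even]; rfl
      · rw [ell_up_zpow_odd, ell_up_one]; rfl)
    (fun k hk => by
      rcases fin_three_cases k with rfl | rfl | rfl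
      · exact absurd ⟨1, ell_up_one⟩ hk
      · exact absurd ⟨0, rfl⟩ hk
      · rfl) ⟨0, rfl⟩
  exact ⟨h1, h2, hC, g, hg, by rw [hS, hgP]⟩

lemma IsEll.twist_two_zsmul {X : Origami Q} {x₁ x₂ y₁ y₂ : ℤ × ℤ} (h : X.IsEll x₁ x₂ y₁ y₂)
    (n : ℤ) : X.IsEll x₁ (x₂ + n • y₁) y₁ y₂ := by
  induction n with
  | zero => simpa using h
  | succ n ih =>
    have := ih.twist_two (ε := 1) (by norm_num)
    rwa [add_assoc, ← add_smul] at this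
  | pred n ih =>
    have := ih.twist_two (ε := -1) (by norm_num)
    rwa [add_assoc, ← add_smul] at this

/-- The image of `IsEll.twist_two_zsmul` under the reflection in the diagonal. -/
lemma IsEll.slide_zsmul {X : Origami Q} {x₁ x₂ y₁ y₂ : ℤ × ℤ} (h : X.IsEll x₁ x₂ y₁ y₂)
    (n : ℤ) : X.IsEll x₁ x₂ y₁ (y₂ + n • x₁) :=
  (h.transpose.twist_two_zsmul n).transpose

/-- The image of `IsEll.twist_one` under the reflection in the diagonal. -/
lemma IsEll.slide {X : Origami Q} {x₁ x₂ y₁ y₂ : ℤ × ℤ} (h : X.IsEll x₁ x₂ y₁ y₂)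
    (h1 : 0 < wedge x₁ (y₁ + x₁ + x₂)) (h2 : 0 < wedge x₂ (y₁ + x₁ + x₂)) :
    X.IsEll x₁ x₂ (y₁ + x₁ + x₂) y₂ := by
  have hw : ∀ v w : ℤ × ℤ, wedge v.swap w.swap = wedge w v := fun v w => by
    simp only [wedge, Prod.fst_swap, Prod.snd_swap]; ring
  exact (h.transpose.twist_one ((hw (y₁ + x₁ + x₂) x₁).symm ▸ h1)
    ((hw (y₁ + x₁ + x₂) x₂).symm ▸ h2)).transpose

/-! ### The smallest first parallelogram -/

/-- If the area of the first parallelogram is minimal, it divides `y₁ ∧ y₂`: otherwise the remainder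
can be subtracted from it by a twist. -/
lemma IsEll.dvd_wedge {X : Origami Q} {x₁ x₂ y₁ y₂ : ℤ × ℤ} (h : X.IsEll x₁ x₂ y₁ y₂)
    (hmin : ∀ {a b c d}, X.IsEll a b c d → wedge x₁ y₁ ≤ wedge a c) :
    wedge x₁ y₁ ∣ wedge y₁ y₂ := by
  have hB := h.1
  have hA := h.2.1
  by_contra hr
  have h0 := Int.emod_nonneg (wedge y₁ y₂) hB.ne'
  have h1 := Int.emod_lt_of_pos (wedge y₁ y₂) hB
  have h2 : wedge y₁ y₂ % wedge x₁ y₁ ≠ 0 := fun h => hr (Int.dvd_of_emod_eq_zero h)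
  have h3 := h.slide_zsmul (wedge y₁ y₂ / wedge x₁ y₁)
  set k := wedge y₁ y₂ / wedge x₁ y₁ with hk
  have h4 : wedge y₁ y₂ % wedge x₁ y₁ = wedge y₁ y₂ - k * wedge x₁ y₁ := by
    have := Int.emod_add_mul_ediv (wedge y₁ y₂) (wedge x₁ y₁)
    rw [hk]; linarith
  have e1 : wedge (x₁ + y₁ + (y₂ + k • x₁)) y₁ = wedge x₁ y₁ - (wedge y₁ y₂ - k * wedge x₁ y₁) := by
    simp only [wedge, Prod.fst_add, Prod.snd_add, Prod.smul_fst, Prod.smul_snd, smul_eq_mul]; ring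
  have e2 : wedge (x₁ + y₁ + (y₂ + k • x₁)) (y₂ + k • x₁) =
      wedge x₁ y₂ + (wedge y₁ y₂ - k * wedge x₁ y₁) := by
    simp only [wedge, Prod.fst_add, Prod.snd_add, Prod.smul_fst, Prod.smul_snd, smul_eq_mul]; ring
  have h5 := hmin (h3.twist_one (by rw [e1]; omega) (by rw [e2]; omega))
  rw [e1] at h5
  omega

lemma IsEll.dvd_wedge' {X : Origami Q} {x₁ x₂ y₁ y₂ : ℤ × ℤ} (h : X.IsEll x₁ x₂ y₁ y₂)
    (hmin : ∀ {a b c d}, X.IsEll a b c d → wedge x₁ y₁ ≤ wedge a c) :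
    wedge x₁ y₁ ∣ wedge x₁ x₂ := by
  have hw : ∀ v w : ℤ × ℤ, wedge v.swap w.swap = wedge w v := fun v w => by
    simp only [wedge, Prod.fst_swap, Prod.snd_swap]; ring
  have h1 := h.transpose.dvd_wedge fun {a b c d} h' => by
    rw [hw, show wedge a c = wedge c.swap a.swap from (hw c a).symm]
    exact hmin h'.transpose
  rw [hw, hw] at h1
  rw [show wedge x₁ x₂ = -wedge x₂ x₁ by simp only [wedge]; ring]
  exact h1.neg_right

/-- A reduced origami with an L-shaped tiling has one whose first parallelogram has area `1`, and
the others have their sides parallel to it. Writing `B = x₁ ∧ y₁`, `A = x₁ ∧ y₂`, `C = x₂ ∧ y₁` and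
`D = x₂ ∧ y₂`, one takes `B` minimal; then `B` divides `A + D` and `C + D`, and `A C = B D`, so that
a prime factor of `B` would divide all the determinants and contradict reducedness. -/
lemma IsReduced.exists_isEll_one {X : Origami Q} (hX : X.IsReduced)
    (h : ∃ x₁ x₂ y₁ y₂, X.IsEll x₁ x₂ y₁ y₂) :
    ∃ (x y : ℤ × ℤ) (l m : ℤ), wedge x y = 1 ∧ X.IsEll x (l • x) y (m • y) := by
  classical
  have hex : ∃ n : ℕ, ∃ x₁ x₂ y₁ y₂, X.IsEll x₁ x₂ y₁ y₂ ∧ wedge x₁ y₁ = n := by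
    obtain ⟨x₁, x₂, y₁, y₂, h⟩ := h
    exact ⟨(wedge x₁ y₁).toNat, x₁, x₂, y₁, y₂, h, (Int.toNat_of_nonneg h.1.le).symm⟩
  obtain ⟨x₁, x₂, y₁, y₂, h, hn⟩ := Nat.find_spec hex
  have hmin : ∀ {a b c d}, X.IsEll a b c d → wedge x₁ y₁ ≤ wedge a c := fun {a b c d} h' => by
    have h2 := Nat.find_min' hex
      ⟨a, b, c, d, h', (Int.toNat_of_nonneg h'.1.le).symm⟩
    have h3 := Int.toNat_of_nonneg h'.1.le
    omega
  clear hn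
  obtain ⟨k, hk⟩ := h.dvd_wedge hmin
  have h' := h.slide_zsmul k
  obtain ⟨k', hk'⟩ := h'.dvd_wedge' hmin
  have h'' := h'.twist_two_zsmul (-k')
  set z₂ := x₂ + (-k') • y₁
  set w₂ := y₂ + k • x₁
  have hE : wedge y₁ w₂ = 0 := by
    simp only [w₂, wedge, Prod.fst_add, Prod.snd_add, Prod.smul_fst, Prod.smul_snd, smul_eq_mul]
      at hk ⊢
    linear_combination hk
  have hG : wedge x₁ z₂ = 0 := by
    simp only [z₂, wedge, Prod.fst_add, Prod.snd_add, Prod.smul_fst, Prod.smul_snd, smul_eq_mul]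
      at hk' ⊢
    linear_combination hk'
  clear_value z₂ w₂
  have hB := h''.1
  have hC := h''.2.2.1
  have hA := h''.2.1
  -- after one further move, which keeps `x₁ ∧ y₁`, the divisibilities hold for the new sides too
  have hAD : wedge x₁ y₁ ∣ wedge x₁ w₂ + wedge z₂ w₂ := by
    have e1 : wedge x₁ (y₁ + x₁ + z₂) = wedge x₁ y₁ := by
      simp only [wedge, Prod.fst_add, Prod.snd_add] at hG ⊢; linear_combination hG
    have e2 : wedge z₂ (y₁ + x₁ + z₂) = wedge z₂ y₁ := by
      simp only [wedge, Prod.fst_add, Prod.snd_add] at hG ⊢; linear_combination -hG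
    have := (h''.slide (by rwa [e1]) (by rwa [e2])).dvd_wedge (by rw [e1]; exact hmin)
    rw [e1] at this
    convert this using 1
    simp only [wedge, Prod.fst_add, Prod.snd_add] at hE ⊢; linear_combination -hE
  have hCD : wedge x₁ y₁ ∣ wedge z₂ y₁ + wedge z₂ w₂ := by
    have e1 : wedge (x₁ + y₁ + w₂) y₁ = wedge x₁ y₁ := by
      simp only [wedge, Prod.fst_add, Prod.snd_add] at hE ⊢; linear_combination -hE
    have e2 : wedge (x₁ + y₁ + w₂) w₂ = wedge x₁ w₂ := by
      simp only [wedge, Prod.fst_add, Prod.snd_add] at hE ⊢; linear_combination hE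
    have := (h''.twist_one (by rwa [e1]) (by rwa [e2])).dvd_wedge' (by rw [e1]; exact hmin)
    rw [e1] at this
    have e3 : wedge (x₁ + y₁ + w₂) z₂ = -(wedge z₂ y₁ + wedge z₂ w₂) := by
      simp only [wedge, Prod.fst_add, Prod.snd_add] at hG ⊢; linear_combination hG
    rwa [e3, dvd_neg] at this
  -- the Plücker relation
  have hpl : wedge x₁ y₁ * wedge z₂ w₂ = wedge x₁ w₂ * wedge z₂ y₁ := by
    have : wedge x₁ y₁ * wedge z₂ w₂ - wedge x₁ w₂ * wedge z₂ y₁ = wedge x₁ z₂ * wedge y₁ w₂ := by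
      simp only [wedge]; ring
    rw [hG, zero_mul] at this
    linarith
  have hone : wedge x₁ y₁ = 1 := by
    by_contra hne
    obtain ⟨p, hp, hpB⟩ := Nat.exists_prime_and_dvd
      (show (wedge x₁ y₁).natAbs ≠ 1 by omega)
    replace hpB : (p : ℤ) ∣ wedge x₁ y₁ := Int.natCast_dvd.2 hpB
    have hpp : Prime (p : ℤ) := Nat.prime_iff_prime_int.1 hp
    replace hAD := hpB.trans hAD
    replace hCD := hpB.trans hCD
    -- modulo `p`, `A ≡ C ≡ -D` and `A C ≡ 0`
    have hD : (p : ℤ) ∣ wedge z₂ w₂ := by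
      have h1 : (p : ℤ) ∣ wedge x₁ w₂ * wedge z₂ y₁ := hpl ▸ hpB.mul_right _
      rcases hpp.dvd_or_dvd h1 with h2 | h2
      · exact (dvd_add_right h2).1 hAD
      · exact (dvd_add_right h2).1 hCD
    have hA' : (p : ℤ) ∣ wedge x₁ w₂ := (dvd_add_left hD).1 hAD
    have hC' : (p : ℤ) ∣ wedge z₂ y₁ := (dvd_add_left hD).1 hCD
    have hanti : ∀ v w, (p : ℤ) ∣ wedge v w → (p : ℤ) ∣ wedge w v := fun v w hvw => by
      rw [show wedge w v = -wedge v w by simp only [wedge]; ring]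
      exact hvw.neg_right
    have hself : ∀ v, (p : ℤ) ∣ wedge v v := fun v => by
      rw [show wedge v v = 0 by simp only [wedge]; ring]
      exact dvd_zero _
    obtain ⟨-, -, -, f, hf, hS⟩ := h''
    have key : ∀ α β : ℤ, (∀ v, v = x₁ ∨ v = z₂ ∨ v = y₁ ∨ v = w₂ → (p : ℤ) ∣ α * v.1 + β * v.2) →
        (p : ℤ) ∣ α ∧ (p : ℤ) ∣ β := fun α β hv =>
      dvd_of_isTiling hX hS
        (fun k => by rcases fin_three_cases k with rfl | rfl | rfl <;> rfl)
        (fun k => by rcases fin_three_cases k with rfl | rfl | rfl <;> rfl) hf hp.pos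
        (fun k => hv _ (by rcases fin_three_cases k with rfl | rfl | rfl <;> simp [sideX]))
        (fun k => hv _ (by rcases fin_three_cases k with rfl | rfl | rfl <;> simp [sideY]))
    have hall : ∀ u, u = x₁ ∨ u = z₂ ∨ u = y₁ ∨ u = w₂ → (p : ℤ) ∣ u.1 ∧ (p : ℤ) ∣ u.2 := by
      intro u hu
      -- the linear form `u ∧ ·` is divisible by `p` on all sides, hence so are its coefficients
      have := key (-u.2) u.1 fun v hv => by
        rw [show -u.2 * v.1 + u.1 * v.2 = wedge u v by simp only [wedge]; ring]
        have hG' : (p : ℤ) ∣ wedge x₁ z₂ := hG ▸ dvd_zero _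
        have hE' : (p : ℤ) ∣ wedge y₁ w₂ := hE ▸ dvd_zero _
        rcases hu with rfl | rfl | rfl | rfl <;> rcases hv with rfl | rfl | rfl | rfl <;>
          first | assumption | exact hself _ | (apply hanti; assumption)
      exact ⟨this.2, (dvd_neg.1 this.1)⟩
    have := (key 1 0 fun v hv => by simpa using (hall v hv).1).1
    exact hpp.not_dvd_one this
  refine ⟨x₁, y₁, wedge z₂ y₁, wedge x₁ w₂, hone, ?_⟩
  have ez : z₂ = wedge z₂ y₁ • x₁ := by
    simp only [wedge] at hone hG ⊢
    ext
    · simp only [Prod.smul_fst, smul_eq_mul]; linear_combination -z₂.1 * hone + y₁.1 * hG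
    · simp only [Prod.smul_snd, smul_eq_mul]; linear_combination -z₂.2 * hone + y₁.2 * hG
  have ew : w₂ = wedge x₁ w₂ • y₁ := by
    simp only [wedge] at hone hE ⊢
    ext
    · simp only [Prod.smul_fst, smul_eq_mul]; linear_combination -w₂.1 * hone - x₁.1 * hE
    · simp only [Prod.smul_snd, smul_eq_mul]; linear_combination -w₂.2 * hone - x₁.2 * hE
  rwa [← ez, ← ew]

/-- In the orbit of a reduced origami in `H(2)`, there is a surface tiled by a unit square, a
rectangle of height `1` on its right, and a rectangle of width `1` on top of it. -/
lemma exists_rel_isEll [Finite Q] (X : Origami Q) (hX : X.IsReduced) (hH : X.InH2) :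
    ∃ (A : Matrix.SpecialLinearGroup (Fin 2) ℤ) (Y : Origami Q) (l m : ℤ), Rel A X Y ∧
      Y.IsEll (1, 0) (l, 0) (0, 1) (0, m) := by
  obtain ⟨x, y, l, m, hw, h⟩ := hX.exists_isEll_one (X.exists_isEll hX hH)
  let A : Matrix.SpecialLinearGroup (Fin 2) ℤ := ⟨!![y.2, -y.1; -x.2, x.1], by
    rw [Matrix.det_fin_two_of, ← hw, wedge]; ring⟩
  obtain ⟨Y, hY⟩ := (exists_rel A X).1
  refine ⟨A, Y, l, m, hY, ?_⟩
  have := h.of_rel hY (fun v => (y.2 * v.1 + -y.1 * v.2, -x.2 * v.1 + x.1 * v.2)) fun v => rfl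
  rw [wedge] at hw
  convert this using 1 <;> ext <;> simp only [Prod.smul_fst, Prod.smul_snd, smul_eq_mul]
  · linear_combination -hw
  · ring
  · linear_combination -l * hw
  · ring
  · ring
  · linear_combination -hw
  · ring
  · linear_combination -m * hw

/-! ### Columns as vertical cylinders -/

/-- Off the vertical sides of the tiles, the coordinates along a column determine the point up to
the period of the column. -/
lemma col_inj (K : Origami κ) {b b' : κ} {s s' t t' : ℝ} (hs : s ∈ Ioo (0 : ℝ) 1)
    (hs' : s' ∈ Icc (0 : ℝ) 1) (h : K.col b s t = K.col b' s' t') :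
    s = s' ∧ Int.fract t = Int.fract t' ∧ (K.up ^ ⌊t⌋) b = (K.up ^ ⌊t'⌋) b' := by
  classical
  -- the position in the half-open tile, for points off the vertical sides
  let F : κ → ℝ → ℝ → Option (κ × ℝ × ℝ) := fun q x y =>
    if 0 < x ∧ x < 1 then if y < 1 then some (q, x, y) else some (K.up q, x, 0) else none
  let D := K.desc F (fun q y _ => by simp [F]) (fun q x _ => by simp [F])
  have hD : ∀ q, ∀ x ∈ Icc (0 : ℝ) 1, ∀ y ∈ Icc (0 : ℝ) 1, D (K.pt q x y) = F q x y :=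
    fun q x hx y hy => K.desc_pt q hx hy
  have h1 := congrArg D h
  rw [col, col, hD _ _ (Ioo_subset_Icc_self hs) _ (fract_mem_Icc t), hD _ _ hs' _ (fract_mem_Icc t')]
    at h1
  simp only [F, if_pos (show 0 < s ∧ s < 1 from hs), if_pos (Int.fract_lt_one _)] at h1
  split_ifs at h1
  simp only [Option.some.injEq, Prod.mk.injEq] at h1
  exact ⟨h1.2.1, h1.2.2, h1.1⟩

/-- A point of a tile off the corners is not a vertex of the tiling. -/
lemma pt_ne_vertex (K : Origami κ) {k k' : κ} {s t : ℝ} (hs : s ∈ Icc (0 : ℝ) 1)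
    (ht : t ∈ Icc (0 : ℝ) 1) (h : s ∈ Ioo (0 : ℝ) 1 ∨ t ∈ Ioo (0 : ℝ) 1) :
    K.pt k s t ≠ K.pt k' 0 0 := by
  intro he
  let D : K.Surface → Prop := K.desc (fun _ x y => (x = 0 ∨ x = 1) ∧ (y = 0 ∨ y = 1))
    (fun _ _ _ => by simp) (fun _ _ _ => by simp)
  have h1 : D (K.pt k s t) = ((s = 0 ∨ s = 1) ∧ (t = 0 ∨ t = 1)) := K.desc_pt k hs ht
  have h2 : D (K.pt k' 0 0) = (((0 : ℝ) = 0 ∨ (0 : ℝ) = 1) ∧ ((0 : ℝ) = 0 ∨ (0 : ℝ) = 1)) :=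
    K.desc_pt k' (by simp) (by simp)
  rw [he, h2] at h1
  have h3 : (s = 0 ∨ s = 1) ∧ (t = 0 ∨ t = 1) := h1 ▸ by simp
  rcases h with ⟨a, b⟩ | ⟨a, b⟩
  · rcases h3.1 with rfl | rfl <;> linarith
  · rcases h3.2 with rfl | rfl <;> linarith

/-- In a tiling of `X` by rectangles in the pattern of `K`, a column is a vertical cylinder. Here
`F` is the height as a function of the coordinate along the column. -/
lemma isVerticalCylinder_col {X : Origami Q} {K : Origami κ} (f : K.Surface ≃ₜ X.Surface) {b k : κ}
    {N : ℕ} (hN : ∀ n : ℤ, (K.up ^ n) b = b ↔ (N : ℤ) ∣ n) {w ℓ : ℝ} (hw : 0 < w) (hℓ : 0 < ℓ)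
    (F : ℝ ≃o ℝ) (hF : ∀ t (n : ℤ), F (t + n * N) = F t + n * ℓ)
    (hproj : ∀ s ∈ Icc (0 : ℝ) 1, ∀ t, X.proj (f (K.col b s t)) = toTorus (w * s, F t))
    (hS : X.Sing = {f (K.pt k 0 0)}) (hl : K.pt b 0 0 = K.pt k 0 0)
    (hr : K.pt (K.right b) 0 0 = K.pt k 0 0) :
    X.IsVerticalCylinder (fun z => f (K.col b (z.1 / w) (F.symm z.2))) ℓ w := by
  have hdiv : ∀ x ∈ Icc 0 w, x / w ∈ Icc (0 : ℝ) 1 := fun x hx =>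
    ⟨div_nonneg hx.1 hw.le, (div_le_one hw).2 hx.2⟩
  have hdiv' : ∀ x ∈ Ioo 0 w, x / w ∈ Ioo (0 : ℝ) 1 := fun x hx =>
    ⟨div_pos hx.1 hw, (div_lt_one hw).2 hx.2⟩
  have hcont : Continuous fun z : ℝ × ℝ => f (K.col b (z.1 / w) (F.symm z.2)) :=
    f.continuous.comp ((K.continuous_col b).comp ((continuous_fst.div_const w).prodMk
      (F.toHomeomorph.symm.continuous.comp continuous_snd)))
  have hp : ∀ x ∈ Icc 0 w, ∀ y, X.proj (f (K.col b (x / w) (F.symm y))) = toTorus (x, y) := by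
    intro x hx y
    rw [hproj _ (hdiv x hx), mul_div_cancel₀ _ hw.ne', OrderIso.apply_symm_apply]
  have hFs : ∀ t (n : ℤ), F.symm (t + n * ℓ) = F.symm t + n * N := fun t n => by
    rw [OrderIso.symm_apply_eq, hF, OrderIso.apply_symm_apply]
  have h0 : (0 : ℝ) ∈ Icc 0 w := ⟨le_rfl, hw.le⟩
  refine ⟨hw, hcont.continuousOn, fun x hx y => ?_, fun x hx => ⟨hℓ, ?_, fun t => ?_, fun t => ?_,
    fun s t => ⟨fun h => ?_, ?_⟩⟩, fun x hx x' hx' y y' h => ?_, ⟨F 0, ?_⟩, ⟨F 0, ?_⟩⟩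
  · rw [hp x hx, hp 0 h0, ← toTorus_add]
    simp
  · exact hcont.comp (continuous_const.prodMk continuous_id)
  · rw [hp x (Ioo_subset_Icc_self hx), hp x (Ioo_subset_Icc_self hx), ← toTorus_add]
    simp
  · rw [hS, mem_singleton_iff, f.injective.eq_iff]
    exact K.pt_ne_vertex (Ioo_subset_Icc_self (hdiv' x hx)) (fract_mem_Icc _) (Or.inl (hdiv' x hx))
  · obtain ⟨-, h1, h2⟩ := K.col_inj (hdiv' x hx) (Ioo_subset_Icc_self (hdiv' x hx)) (f.injective h)
    have h3 : (K.up ^ (⌊F.symm t⌋ - ⌊F.symm s⌋)) b = b := by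
      rw [sub_eq_neg_add, zpow_add, Equiv.Perm.mul_apply, ← h2, zpow_neg, perm_inv_apply]
    obtain ⟨c, hc⟩ := (hN _).1 h3
    have hc' : (⌊F.symm t⌋ : ℝ) - ⌊F.symm s⌋ = N * c := by exact_mod_cast hc
    refine ⟨c, ?_⟩
    apply F.symm.injective
    rw [hFs]
    have h4 := Int.floor_add_fract (F.symm t)
    have h5 := Int.floor_add_fract (F.symm s)
    linarith
  · rintro ⟨n, rfl⟩
    simp only
    rw [hFs, col_add_period ((hN _).2 dvd_rfl)]
  · have := (K.col_inj (hdiv' x hx) (Ioo_subset_Icc_self (hdiv' x' hx')) (f.injective h)).1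
    exact (div_left_inj' hw.ne').1 this
  · rw [hS, mem_singleton_iff, F.symm_apply_apply, zero_div, K.col_eq_pt _ _ (by simp), hl]
  · rw [hS, mem_singleton_iff, F.symm_apply_apply, div_self hw.ne', K.col_eq_pt _ _ (by simp),
      K.pt_side, hr]

/-! ### The splitting pair -/

/-- A function separating the column of the tile `2` from the column of the tiles `1` and `0`. -/
lemma exists_separation : ∃ D : ell.Surface → ℝ, Continuous D ∧ (∀ s ∈ Icc (0 : ℝ) 1, ∀ t,
    D (ell.col 1 s t) = 0) ∧ ∀ s ∈ Icc (0 : ℝ) 1, ∀ t, D (ell.col 2 s t) = s * (1 - s) := by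
  let F : Fin 3 → ℝ → ℝ → ℝ := fun k s _ => if k = 2 then s * (1 - s) else 0
  let D := ell.desc F (fun k _ _ => by simp [F])
    (fun k s _ => by rcases fin_three_cases k with rfl | rfl | rfl <;> rfl)
  have hD : ∀ k, ∀ x ∈ Icc (0 : ℝ) 1, ∀ y ∈ Icc (0 : ℝ) 1, D (ell.pt k x y) = F k x y :=
    fun k x hx y hy => ell.desc_pt k hx hy
  refine ⟨D, ell.continuous_desc fun k => ?_, fun s hs t => ?_, fun s hs t => ?_⟩
  · rcases fin_three_cases k with rfl | rfl | rfl
    · exact continuous_const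
    · exact continuous_const
    · exact continuous_fst.mul (continuous_const.sub continuous_fst)
  · rw [col, hD _ _ hs _ (fract_mem_Icc t)]
    rcases Int.even_or_odd' ⌊t⌋ with ⟨m, h | h⟩
    · rw [h, ell_up_zpow_even]; rfl
    · rw [h, ell_up_zpow_odd, ell_up_one]; rfl
  · rw [col, hD _ _ hs _ (fract_mem_Icc t), ell_up_zpow_two]; rfl

/-- On a surface tiled by a unit square, a rectangle of height `1` on its right and a rectangle of
width `1` on top of it, the column over the unit square has width `1`, and both vertical sides of
its upper tile are the same saddle connection. -/
lemma IsEll.exists_splittingPair {X : Origami Q} {l m : ℕ}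
    (h : X.IsEll (1, 0) (l, 0) (0, 1) (0, m)) :
    ∃ σ γ, X.IsVerticalSplittingPair σ γ (1 + m) 1 := by
  obtain ⟨-, hm, hl, f, hf, hS⟩ := h
  replace hm : (0 : ℝ) < m := by simpa [wedge] using hm
  replace hl : (0 : ℝ) < l := by simpa [wedge] using hl
  -- the column of the tiles `1` and `0`
  have h1 : X.IsVerticalCylinder
      (fun z => f (ell.col 1 (z.1 / 1) ((zigIso one_pos hm).symm z.2))) (1 + m) 1 := by
    refine isVerticalCylinder_col f (N := 2) (fun n => ?_) one_pos (by positivity) _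
      (fun t n => ?_) (fun s hs t => ?_) hS ell_pt_one_zero_zero
      (by rw [ell_right_one, ell_pt_two_zero_zero])
    · rcases Int.even_or_odd' n with ⟨k, rfl | rfl⟩
      · simp [ell_up_zpow_even]
      · rw [ell_up_zpow_odd, ell_up_one]
        have : (0 : Fin 3) ≠ 1 := by decide
        simp only [this, false_iff]
        push_cast; omega
    · rw [zigIso_apply, zigIso_apply, mul_comm, Nat.cast_ofNat, zig_add_two_mul_int]
    · have h2 := Int.floor_add_fract t
      rw [col, zigIso_apply]
      rcases Int.even_or_odd' ⌊t⌋ with ⟨k, hk | hk⟩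
      · have h3 : zig 1 m t = Int.fract t + k * (1 + m) := by
          conv_lhs => rw [← h2, hk]
          push_cast
          rw [add_comm, zig_add_two_mul_int, zig_of_mem (fract_mem_Icc t), one_mul]
        rw [hk, ell_up_zpow_even, hf _ _ hs _ (fract_mem_Icc t),
          ← toTorus_add_int _ 0 (k * (1 + m)), h3]
        simp [sideX, sideY]
      · have h3 : zig 1 m t = 1 + m * Int.fract t + k * (1 + m) := by
          conv_lhs => rw [← h2, hk]
          push_cast
          rw [show (2 * k + 1 + Int.fract t : ℝ) = 1 + Int.fract t + 2 * k by ring,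
            zig_add_two_mul_int, zig_one_add (fract_mem_Icc t)]
        rw [hk, ell_up_zpow_odd, ell_up_one, hf _ _ hs _ (fract_mem_Icc t),
          ← toTorus_add_int _ 0 (1 + k * (1 + m)), h3]
        congr 1
        simp [sideX, sideY]
        ring
  -- the column of the tile `2`
  have h2 : X.IsVerticalCylinder
      (fun z => f (ell.col 2 (z.1 / l) ((OrderIso.refl ℝ).symm z.2))) 1 l := by
    refine isVerticalCylinder_col f (N := 1) (fun n => ?_) hl one_pos _
      (fun t n => by simp) (fun s hs t => ?_) hS ell_pt_two_zero_zero
      (by rw [ell_right_two, ell_pt_one_zero_zero])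
    · simp [ell_up_zpow_two]
    · rw [col, ell_up_zpow_two, hf _ _ hs _ (fract_mem_Icc t), ← toTorus_add_int _ 0 ⌊t⌋]
      simp [sideX, sideY, mul_comm]
  obtain ⟨D, hD, hD1, hD2⟩ := exists_separation
  have hcyl : X.cylinder (fun z => f (ell.col 1 (z.1 / 1) ((zigIso one_pos hm).symm z.2))) 1 ⊆
      {P | D (f.symm P) = 0} := by
    rintro _ ⟨⟨x, y⟩, ⟨hx, -⟩, rfl⟩
    change D _ = 0
    rw [f.symm_apply_apply]
    exact hD1 _ (by rw [div_one]; exact Ioo_subset_Icc_self hx) _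
  have hmid : D (f.symm (f (ell.col 2 (1 / 2) 0))) ≠ 0 := by
    rw [f.symm_apply_apply, hD2 _ (by constructor <;> norm_num)]
    norm_num
  have hedge : ∀ t ∈ Icc (0 : ℝ) 1, ∀ x, ell.col 1 x ((zigIso one_pos hm).symm (1 + t * m)) =
      ell.pt 0 x t := fun t ht x => by
    have := col_int_add (K := ell) (b := 1) 1 x ht
    rw [mul_comm, zigIso_symm_add_of_mem one_pos hm ht, ← Int.cast_one, this, zpow_one, ell_up_one]
  refine ⟨fun y => f (ell.col 1 (1 / 2 / 1) ((zigIso one_pos hm).symm y)),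
    fun t => f (ell.pt 0 0 t), ?_, m, hm, ⟨?_, ?_, fun t ht => ?_, ?_, ?_, fun t ht => ?_⟩,
    fun z => f (ell.col 1 (z.1 / 1) ((zigIso one_pos hm).symm z.2)),
    by rw [Nat.cast_add, Nat.cast_one]; exact h1,
    ⟨1 / 2, by norm_num, fun y => rfl⟩, ⟨1, fun t ht => ?_⟩,
    ⟨1, fun t ht => ?_⟩, fun hu => ?_, ⟨_, _, _, h2, fun he => ?_⟩, Nat.coprime_one_right _⟩
  · simpa using h1.closed (1 / 2) (by norm_num)
  · simp [hm.ne']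
  · exact (f.continuous.comp ((ell.continuous_pt 0).comp
      (continuous_const.prodMk continuous_id))).continuousOn
  · rw [hf _ _ (by simp) _ ht, hf _ _ (by simp) _ (by simp), ← toTorus_add]
    simp [sideX, sideY]
  · rw [hS]; rfl
  · rw [hS, ell.pt_top, ell_up_zero, ell_pt_one_zero_zero]; rfl
  · rw [hS, mem_singleton_iff, f.injective.eq_iff]
    exact ell.pt_ne_vertex (by simp) (Ioo_subset_Icc_self ht) (Or.inr ht)
  · simp only
    rw [hedge t ht, zero_div]
  · simp only
    rw [hedge t ht, Nat.cast_one, div_one, ell.pt_side, ell_right_zero]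
  · refine hmid (closure_minimal hcyl (isClosed_eq (hD.comp f.symm.continuous) continuous_const) ?_)
    rw [Nat.cast_one] at hu
    rw [hu]
    trivial
  · refine hmid (hcyl ?_)
    rw [Nat.cast_one] at he
    rw [← he]
    refine ⟨(l / 2, 0), ⟨⟨by positivity, by simp only; linarith⟩, mem_univ _⟩, ?_⟩
    simp only [OrderIso.symm_refl, OrderIso.refl_apply]
    congr 2
    field_simp

end Origami

theorem lemma6p3 {Q : Type*} [Finite Q] (X : Origami Q) (hX : X.IsReduced) (hH2 : X.InH2) :
    ∃ X₀ ∈ X.orbit, ∃ (σ₀ γ₀ : ℝ → X₀.Surface) (ℓ₀ W₀ : ℕ),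
      X₀.IsVerticalSplittingPair σ₀ γ₀ ℓ₀ W₀ ∧ W₀ = 1 := by
  obtain ⟨A, Y, l, m, ⟨f, hf, -⟩, h⟩ := X.exists_rel_isEll hX hH2
  have hl : 0 ≤ l := by simpa [Origami.wedge] using h.2.2.1.le
  have hm : 0 ≤ m := by simpa [Origami.wedge] using h.2.1.le
  lift l to ℕ using hl
  lift m to ℕ using hm
  obtain ⟨σ, γ, hσ⟩ := h.exists_splittingPair
  exact ⟨Y, ⟨A, f, hf⟩, σ, γ, 1 + m, 1, hσ, rfl⟩
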